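/- For every constant $c>0$ there are a randomized word-RAM program $\mathcal A$ and constants $\kappa, C$ (depending only on $c$) such that the following holds. Let $n\ge 2$, $1\le m\le n$, $0<\varepsilon\le 1$, let $T=t_1\dots t_n$ (text) and $P=p_1\dots p_m$ (pattern) be strings of integers, and let $W\ge (n\lceil 1/\varepsilon\rceil)^{\kappa}$ be an integer that bounds the absolute value of all letters of $T$ and $P$. Given $n$, $m$, $\lceil 1/\varepsilon\rceil$, $T$ and $P$, the program halts, for every outcome of its coin flips, within $$C\cdot\frac{n\log^4 n}{\varepsilon^3}$$ steps, and with probability at least $1-n^{-c}$ it outputs an array $S_\varepsilon$ of integers such that, simultaneously for all $0\le i\le n-m$, $$(1-\varepsilon)\cdot S[i]\;\le\; S_\varepsilon[i]\;\le\;(1+\varepsilon)\cdot S[i],\qquad\text{where } S[i]=|\{\,1\le j\le m : t_{i+j}\neq p_j\,\}|$$ is the Hamming distance between $P$ and the $m$-substring of $T$ at position $i$. Here the machine uses only basic arithmetic operations and has no convolution (or Fourier transform) primitive: all its words are integers in $[-W,W]$, every intermediate result has to be such a word, and its only instructions, each of unit cost, are addition, subtraction, multiplication and integer division of words, comparison of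 words, reading and writing memory cells (also by computed address), conditional branching and loops, and flipping a fair coin. -/

import Mathlib

/-!
A randomized word RAM, given by a small imperative language with a step count.

* A word is an integer `z` with `|z| ≤ W`.
* The memory consists of registers `0, 1, 2, …` holding one word each, and of arrays `0, 1, 2, …`
  whose cells are addressed by words and hold one word each. A program is a finite text, so that
  it names finitely many registers and arrays only.
* The only operations on words are addition, subtraction, multiplication, integer division and
  the two comparisons `<` and `=`. Every operation costs one step, and its result has to be a
  word: a run in which some value leaves the range `[-W, W]` gets stuck and never ends.
* Randomness comes from independent fair coins, one bit per step.
-/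

namespace WordRAM

/-- The operations of the machine. -/
inductive Op where
  | add | sub | mul | div | lt | eq

/-- Value of an operation; the comparisons give `1` (true) or `0` (false). -/
def Op.eval : Op → ℤ → ℤ → ℤ
  | .add, a, b => a + b
  | .sub, a, b => a - b
  | .mul, a, b => a * b
  | .div, a, b => a / b
  | .lt, a, b => if a < b then 1 else 0
  | .eq, a, b => if a = b then 1 else 0

/-- Expressions: constants, registers, array cells `a[e]`, and operations. -/
inductive Expr where
  | const (z : ℤ)
  | reg (x : ℕ)
  | get (a : ℕ) (e : Expr)
  | bin (o : Op) (e₁ e₂ : Expr)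

/-- Programs. -/
inductive Prog where
  | skip
  /-- register `x` := `e` -/
  | assign (x : ℕ) (e : Expr)
  /-- array cell `a[i]` := `e` -/
  | store (a : ℕ) (i e : Expr)
  /-- register `x` := fresh random bit -/
  | flip (x : ℕ)
  | seq (p q : Prog)
  /-- if `e ≠ 0` then `p` else `q` -/
  | ite (e : Expr) (p q : Prog)
  /-- while `e ≠ 0` do `p` -/
  | while (e : Expr) (p : Prog)

/-- State of the machine: registers, arrays, and the number of coins flipped so far. -/
structure State where
  reg : ℕ → ℤ
  arr : ℕ → ℤ → ℤ
  coins : ℕ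

def State.setReg (s : State) (x : ℕ) (v : ℤ) : State :=
  { s with reg := Function.update s.reg x v }

def State.setArr (s : State) (a : ℕ) (i v : ℤ) : State :=
  { s with arr := Function.update s.arr a (Function.update (s.arr a) i v) }

/-- Value of an expression. -/
def Expr.eval (s : State) : Expr → ℤ
  | .const z => z
  | .reg x => s.reg x
  | .get a e => s.arr a (e.eval s)
  | .bin o e₁ e₂ => o.eval (e₁.eval s) (e₂.eval s)

/-- The expression is evaluated without overflow of any intermediate result and without
division by zero. -/
def Expr.Fits (W : ℕ) (s : State) : Expr → Prop
  | .const z => |z| ≤ W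
  | .reg x => |s.reg x| ≤ W
  | .get a e => e.Fits W s ∧ |s.arr a (e.eval s)| ≤ W
  | .bin o e₁ e₂ => e₁.Fits W s ∧ e₂.Fits W s ∧ (o = Op.div → e₂.eval s ≠ 0) ∧
      |o.eval (e₁.eval s) (e₂.eval s)| ≤ W

/-- Number of steps for evaluating an expression: one for each of its nodes. -/
def Expr.cost : Expr → ℕ
  | .const _ => 1
  | .reg _ => 1
  | .get _ e => e.cost + 1
  | .bin _ e₁ e₂ => e₁.cost + e₂.cost + 1

/-- `Exec W ω p s s' t`: with words bounded by `W` and coin outcomes `ω`, the program `p` started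
in the state `s` halts in the state `s'` after exactly `t` steps. -/
inductive Exec (W : ℕ) (ω : ℕ → Bool) : Prog → State → State → ℕ → Prop
  | skip (s : State) : Exec W ω .skip s s 1
  | assign (x : ℕ) (e : Expr) (s : State) (h : e.Fits W s) :
      Exec W ω (.assign x e) s (s.setReg x (e.eval s)) (e.cost + 1)
  | store (a : ℕ) (i e : Expr) (s : State) (hi : i.Fits W s) (he : e.Fits W s) :
      Exec W ω (.store a i e) s (s.setArr a (i.eval s) (e.eval s)) (i.cost + e.cost + 1)
  | flip (x : ℕ) (s : State) :
      Exec W ω (.flip x) s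
        { s.setReg x (if ω s.coins then 1 else 0) with coins := s.coins + 1 } 1
  | seq (p q : Prog) (s s₁ s₂ : State) (t₁ t₂ : ℕ)
      (hp : Exec W ω p s s₁ t₁) (hq : Exec W ω q s₁ s₂ t₂) :
      Exec W ω (.seq p q) s s₂ (t₁ + t₂)
  | ite_true (e : Expr) (p q : Prog) (s s' : State) (t : ℕ) (h : e.Fits W s)
      (hne : e.eval s ≠ 0) (hp : Exec W ω p s s' t) :
      Exec W ω (.ite e p q) s s' (e.cost + 1 + t)
  | ite_false (e : Expr) (p q : Prog) (s s' : State) (t : ℕ) (h : e.Fits W s)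
      (heq : e.eval s = 0) (hq : Exec W ω q s s' t) :
      Exec W ω (.ite e p q) s s' (e.cost + 1 + t)
  | while_true (e : Expr) (p : Prog) (s s₁ s₂ : State) (t₁ t₂ : ℕ) (h : e.Fits W s)
      (hne : e.eval s ≠ 0) (hp : Exec W ω p s s₁ t₁) (hw : Exec W ω (.while e p) s₁ s₂ t₂) :
      Exec W ω (.while e p) s s₂ (e.cost + 1 + t₁ + t₂)
  | while_false (e : Expr) (p : Prog) (s : State) (h : e.Fits W s) (heq : e.eval s = 0) :
      Exec W ω (.while e p) s s (e.cost + 1)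

/-- The law of an infinite sequence of independent fair coins. -/
noncomputable def coinLaw : MeasureTheory.Measure (ℕ → Bool) :=
  MeasureTheory.Measure.infinitePi fun _ => (PMF.uniformOfFintype Bool).toMeasure

/-- The contents of an array into which a string is loaded: the letters occupy the cells
`0, …, n - 1`, all other cells hold `0`. -/
def load {n : ℕ} (X : Fin n → ℤ) (i : ℤ) : ℤ :=
  if h : 0 ≤ i ∧ i.toNat < n then X ⟨i.toNat, h.2⟩ else 0

/-- The initial state: registers `0, 1, 2` hold the text length, the pattern length and the
precision parameter `q`; arrays `0, 1` hold the text and the pattern; all else is `0`. -/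
def init {n m : ℕ} (T : Fin n → ℤ) (P : Fin m → ℤ) (q : ℕ) : State where
  reg x := if x = 0 then n else if x = 1 then m else if x = 2 then q else 0
  arr a := if a = 0 then load T else if a = 1 then load P else fun _ => 0
  coins := 0

end WordRAM

/-- The `m`-substring of `T` that starts after its first `i` letters. -/
def window {n : ℕ} (T : Fin n → ℤ) (m i : ℕ) (h : i + m ≤ n) : Fin m → ℤ :=
  fun j => T ⟨i + j, by omega⟩

/-- The array `S` holds, in its cells `0, …, n - m`, a `(1 ± ε)`-approximation of all text-to-pattern
Hamming distances of the text `T` and the pattern `P`. -/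
def ApproximatesHamming {n m : ℕ} (ε : ℝ) (T : Fin n → ℤ) (P : Fin m → ℤ) (S : ℤ → ℤ) : Prop :=
  ∀ (i : ℕ) (h : i + m ≤ n),
    (1 - ε) * (hammingDist (window T m i h) P : ℝ) ≤ (S i : ℝ) ∧
      (S i : ℝ) ≤ (1 + ε) * (hammingDist (window T m i h) P : ℝ)

/-!
The algorithm gives every letter a random sign `h z = ±1` and computes, for all positions `i`, the
correlation `X i = ∑ j < m, h (t (i + j)) * h (p j)`. A matched position contributes `1` whatever
the signs are, and a mismatched one a product of two independent signs, which has mean `0`. Hence,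
if `S` is the Hamming distance, `m - X i` has mean `S`, and it deviates from `S` by at most `S`. The
average over `k` independent rounds therefore deviates by more than `ε * S / 4` with probability at
most `2 * exp (-k * ε ^ 2 / 32)` only, by Hoeffding's inequality (`WordRAM.measure_noise_ge_le`). With
`k = O(log n / ε ^ 2)` rounds, all positions are good at once with the desired probability
(`WordRAM.le_measure_estimate`, `WordRAM.mul_exp_le`). The final rounding to an integer is harmless:
it restores the exact value if `ε * S < 1`, and otherwise an error of `1 / 2` is allowed for
(`WordRAM.ediv_approximates`).

The signs take no hashing. They are stored in an array that is addressed by the letters themselves: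
in each round every letter of the text and of the pattern in turn gets a fresh coin, so that
in the end the sign of a letter is given by the coin of its last occurrence, and distinct letters
have distinct coins (`WordRAM.exists_signTable_eq`).

The correlations of one round are computed in `O(n log n)` steps by fast Fourier transforms, which
the machine does not have and which are carried out here in fixed-point arithmetic on words. The
reversed text is the real part and the pattern the imaginary part of one complex vector of length
`N = 2 ^ K > n`. Its transform is squared and transformed again, and the correlations appear
in the imaginary part, multiplied by `2 * N` (`im_dft_sq_dft_packed`). They are integers, so that an
absolute error below `N` disappears by rounding. With the scale `N ^ 32` the error is less than `1`:
a root of unity of order `N` is obtained from iterated square roots by the half-angle formula, its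
powers by repeated multiplication, and each of the `K` stages of a transform increases the error by
a constant factor only (`WordRAM.Runs.rootProg`, `WordRAM.Runs.tableProg`, `WordRAM.Runs.fftProg`,
`WordRAM.Runs.roundProg`).

All values are bounded by a fixed power of `n * ⌈1 / ε⌉₊`, except for the letters, on which no
arithmetic is done. In total there are `O(log n / ε ^ 2)` rounds of `O(n log n)` steps each, which
is within the time bound. Programs are verified by rules for total correctness with a time bound
(`WordRAM.Runs`); overflow is excluded by a static analysis of the expressions
(`WordRAM.Expr.fits_and_abs_eval_le`).
-/

namespace WordRAM

/-! ### Total correctness with a time bound -/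

/-- Started in `s`, the program `p` halts within `t` steps in a state that satisfies `Q`. -/
def Runs (W : ℕ) (ω : ℕ → Bool) (p : Prog) (s : State) (t : ℕ) (Q : State → Prop) : Prop :=
  ∃ s' t', t' ≤ t ∧ Exec W ω p s s' t' ∧ Q s'

variable {W : ℕ} {ω : ℕ → Bool}

theorem Runs.mono {p : Prog} {s : State} {t t' : ℕ} {Q Q' : State → Prop}
    (h : Runs W ω p s t Q) (ht : t ≤ t') (hQ : ∀ s', Q s' → Q' s') : Runs W ω p s t' Q' := by
  obtain ⟨s', u, hu, he, hq⟩ := h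
  exact ⟨s', u, hu.trans ht, he, hQ _ hq⟩

theorem Runs.skip {s : State} {Q : State → Prop} (h : Q s) : Runs W ω .skip s 1 Q :=
  ⟨s, 1, le_rfl, .skip s, h⟩

theorem Runs.assign {x : ℕ} {e : Expr} {s : State} {Q : State → Prop} (hf : e.Fits W s)
    (h : Q (s.setReg x (e.eval s))) : Runs W ω (.assign x e) s (e.cost + 1) Q :=
  ⟨_, _, le_rfl, .assign x e s hf, h⟩

theorem Runs.store {a : ℕ} {i e : Expr} {s : State} {Q : State → Prop} (hi : i.Fits W s)
    (he : e.Fits W s) (h : Q (s.setArr a (i.eval s) (e.eval s))) :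
    Runs W ω (.store a i e) s (i.cost + e.cost + 1) Q :=
  ⟨_, _, le_rfl, .store a i e s hi he, h⟩

theorem Runs.flip {x : ℕ} {s : State} {Q : State → Prop}
    (h : Q { s.setReg x (if ω s.coins then 1 else 0) with coins := s.coins + 1 }) :
    Runs W ω (.flip x) s 1 Q :=
  ⟨_, _, le_rfl, .flip x s, h⟩

theorem Runs.seq {p q : Prog} {s : State} {t₁ t₂ : ℕ} {Q : State → Prop}
    (h : Runs W ω p s t₁ fun s₁ => Runs W ω q s₁ t₂ Q) : Runs W ω (.seq p q) s (t₁ + t₂) Q := by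
  obtain ⟨s₁, u₁, hu₁, he₁, s₂, u₂, hu₂, he₂, hq⟩ := h
  exact ⟨s₂, u₁ + u₂, add_le_add hu₁ hu₂, .seq p q s s₁ s₂ u₁ u₂ he₁ he₂, hq⟩

theorem Runs.ite {e : Expr} {p q : Prog} {s : State} {t : ℕ} {Q : State → Prop}
    (hf : e.Fits W s) (h₁ : e.eval s ≠ 0 → Runs W ω p s t Q)
    (h₂ : e.eval s = 0 → Runs W ω q s t Q) : Runs W ω (.ite e p q) s (e.cost + 1 + t) Q := by
  by_cases he : e.eval s = 0
  · obtain ⟨s', u, hu, hx, hq⟩ := h₂ he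
    exact ⟨s', _, by omega, .ite_false e p q s s' u hf he hx, hq⟩
  · obtain ⟨s', u, hu, hx, hq⟩ := h₁ he
    exact ⟨s', _, by omega, .ite_true e p q s s' u hf he hx, hq⟩

/-- A loop that makes exactly `N` rounds, with an invariant indexed by the number of rounds made. -/
theorem Runs.while {e : Expr} {p : Prog} (I : ℕ → State → Prop) (N t : ℕ)
    (hfit : ∀ k ≤ N, ∀ s, I k s → e.Fits W s)
    (hgo : ∀ k < N, ∀ s, I k s → e.eval s ≠ 0) (hdone : ∀ s, I N s → e.eval s = 0)
    (hbody : ∀ k < N, ∀ s, I k s → Runs W ω p s t (I (k + 1))) {s : State} (h0 : I 0 s) :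
    Runs W ω (.while e p) s (N * (t + (e.cost + 1)) + (e.cost + 1)) (I N) := by
  suffices h : ∀ j ≤ N, ∀ s, I (N - j) s →
      Runs W ω (.while e p) s (j * (t + (e.cost + 1)) + (e.cost + 1)) (I N) from
    h N le_rfl s (by simpa using h0)
  intro j
  induction j with
  | zero =>
    intro _ s hs
    simp only [Nat.sub_zero] at hs
    exact ⟨s, _, by simp, .while_false e p s (hfit N le_rfl s hs) (hdone s hs), hs⟩
  | succ j ih =>
    intro hj s hs
    obtain ⟨s₁, u₁, hu₁, he₁, hs₁⟩ := hbody (N - (j + 1)) (by omega) s hs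
    rw [show N - (j + 1) + 1 = N - j by omega] at hs₁
    obtain ⟨s₂, u₂, hu₂, he₂, hq⟩ := ih (by omega) s₁ hs₁
    refine ⟨s₂, _, ?_, .while_true e p s s₁ s₂ u₁ u₂ (hfit _ (by omega) s hs)
      (hgo _ (by omega) s hs) he₁ he₂, hq⟩
    rw [Nat.succ_mul]; omega

instance : Add Expr := ⟨.bin .add⟩
instance : Sub Expr := ⟨.bin .sub⟩
instance : Mul Expr := ⟨.bin .mul⟩
instance : Div Expr := ⟨.bin .div⟩

/-- The comparison `e₁ < e₂` as an expression. -/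
def Expr.less (e₁ e₂ : Expr) : Expr := .bin .lt e₁ e₂

/-- The comparison `e₁ = e₂` as an expression. -/
def Expr.equal (e₁ e₂ : Expr) : Expr := .bin .eq e₁ e₂

section Eval
variable (s : State) (e₁ e₂ : Expr)

@[simp] theorem Expr.eval_add : (e₁ + e₂).eval s = e₁.eval s + e₂.eval s := rfl
@[simp] theorem Expr.eval_sub : (e₁ - e₂).eval s = e₁.eval s - e₂.eval s := rfl
@[simp] theorem Expr.eval_mul : (e₁ * e₂).eval s = e₁.eval s * e₂.eval s := rfl
@[simp] theorem Expr.eval_div : (e₁ / e₂).eval s = e₁.eval s / e₂.eval s := rfl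
@[simp] theorem Expr.eval_less :
    (e₁.less e₂).eval s = if e₁.eval s < e₂.eval s then 1 else 0 := rfl
@[simp] theorem Expr.eval_equal :
    (e₁.equal e₂).eval s = if e₁.eval s = e₂.eval s then 1 else 0 := rfl
@[simp] theorem Expr.eval_const (z : ℤ) : (Expr.const z).eval s = z := rfl
@[simp] theorem Expr.eval_reg (x : ℕ) : (Expr.reg x).eval s = s.reg x := rfl
@[simp] theorem Expr.eval_get (a : ℕ) : (Expr.get a e₁).eval s = s.arr a (e₁.eval s) := rfl

end Eval

/-- `for Y := 0, …, l - 1 do p`, where `l` is a register that `p` does not change. -/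
def Prog.for (Y l : ℕ) (p : Prog) : Prog :=
  .seq (.assign Y (.const 0)) (.while ((Expr.reg Y).less (.reg l))
    (.seq p (.assign Y (.reg Y + .const 1))))

/-- A counting loop, with an invariant indexed by the number of rounds made. -/
theorem Runs.for {Y l : ℕ} {p : Prog} (I : ℕ → State → Prop) (N t : ℕ) (hYl : l ≠ Y)
    (hNW : N ≤ W) (hW : 1 ≤ W) {s : State} (hl : s.reg l = N) (h0 : I 0 (s.setReg Y 0))
    (hbody : ∀ y < N, ∀ s : State, s.reg Y = y → s.reg l = N → I y s →
      Runs W ω p s t fun s' => s'.reg Y = y ∧ s'.reg l = N ∧ I (y + 1) (s'.setReg Y (y + 1))) :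
    Runs W ω (.for Y l p) s (N * (t + 8) + 6)
      (fun s' => s'.reg Y = N ∧ s'.reg l = N ∧ I N s') := by
  refine Runs.mono (t := 2 + (N * ((t + 4) + 4) + 4)) (Runs.seq (Runs.assign ?_ ?_)) ?_
    fun _ h => h
  · simp [Expr.Fits]
  · refine Runs.while (fun y s => s.reg Y = y ∧ s.reg l = N ∧ I y s) N (t + 4) ?_ ?_ ?_ ?_ ?_
    · rintro k hk s ⟨h1, h2, -⟩
      simp only [Expr.less, Expr.Fits, h1, h2, Expr.eval, Op.eval]
      refine ⟨by simp; omega, by simp; omega, by simp, ?_⟩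
      split <;> simp [hW]
    · rintro k hk s ⟨h1, h2, -⟩
      simp [h1, h2, hk]
    · rintro s ⟨h1, h2, -⟩
      simp [h1, h2]
    · rintro k hk s ⟨h1, h2, h3⟩
      refine Runs.seq ((hbody k hk s h1 h2 h3).mono le_rfl ?_)
      rintro s' ⟨h1', h2', h3'⟩
      refine Runs.assign (e := .reg Y + .const 1) ?_ ?_
      · change Expr.Fits W s' (.bin .add (.reg Y) (.const 1))
        simp only [Expr.Fits, Expr.eval, Op.eval, h1']
        refine ⟨by simp; omega, by simp [hW], by simp, ?_⟩
        rw [abs_of_nonneg (by positivity)]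
        exact_mod_cast (by omega : k + 1 ≤ W)
      · simp only [Expr.eval_add, Expr.eval_reg, Expr.eval_const, h1']
        exact ⟨by simp [State.setReg], by simp [State.setReg, hYl, h2'], h3'⟩
    · exact ⟨by simp [State.setReg], by simp [State.setReg, hYl, hl], by simpa using h0⟩
  · ring_nf; omega

/-! ### Sizes of words

Overflow is excluded by bookkeeping with degrees. Every register and every array is assigned once
and for all a degree `d`, meaning that it holds values of absolute value at most `β ^ d`, for a
number `β` that bounds the lengths of the input strings and the precision parameter. As
`β ^ degLimit ≤ W`, an expression can be evaluated as soon as its degree, which is computed from its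
text, is less than `degLimit`.
-/

/-- The number of powers of `β` that fit into a machine word. -/
def degLimit : ℕ := 100

/-- A bound for the values of degree `d`: powers of `β`, and `W` for degrees from `degLimit` on. -/
def sizeBound (W β d : ℕ) : ℕ := if d < degLimit then β ^ d else W

/-- Degree of the register `x`: its value is at most `β ^ regDeg x` in absolute value.

The registers hold: `0`, `1`, `2` the input numbers `n`, `m`, `q`; `3` a constant of the program;
`4` and `5` the length `N = 2 ^ K` of the transforms and `K`; `6` the scale of the fixed-point
numbers; `7` the number of rounds; `8` the number of positions; `9` and `14` the root of unity of
order `N`; `11`, `12`, `13` the argument, the result and the current digit of a square root; `10`,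
`15`, `16` loop counters; `17` a coin; `18` the length of the current stage of a transform. -/
def regDeg : ℕ → ℕ
  | 0 | 1 | 2 | 3 | 4 | 5 | 8 | 10 | 16 | 18 => 1
  | 6 => 32
  | 7 | 15 => 4
  | 9 | 12 | 13 | 14 => 33
  | 11 => 66
  | _ => 0

/-- Degree of the array `a`.

The arrays hold: `0` and `1` the text and the pattern, whose letters may be as large as `W`; `2` the
output; `3` the signs of the letters; `4` and `5` the powers of the root of unity; `6` and `7` the
vector to be transformed; `8` and `9` its next stage; `10` the sum of the correlations. -/
def arrDeg : ℕ → ℕ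
  | 0 | 1 => degLimit
  | 2 => 3
  | 4 | 5 => 33
  | 6 | 7 | 8 | 9 => 40
  | 10 => 5
  | _ => 0

/-- All registers and cells respect the bounds given by their degrees. -/
structure Bounded (W β : ℕ) (s : State) : Prop where
  reg : ∀ x, |s.reg x| ≤ sizeBound W β (regDeg x)
  arr : ∀ a z, |s.arr a z| ≤ sizeBound W β (arrDeg a)

/-- Degree of an expression, which bounds its value. -/
def Expr.deg : Expr → ℕ
  | .const z => z.natAbs.log2 + 1
  | .reg x => regDeg x
  | .get a _ => arrDeg a
  | .bin .add e₁ e₂ => max e₁.deg e₂.deg + 1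
  | .bin .sub e₁ e₂ => max e₁.deg e₂.deg + 1
  | .bin .mul e₁ e₂ => e₁.deg + e₂.deg
  | .bin .div e₁ _ => e₁.deg
  | .bin .lt _ _ => 0
  | .bin .eq _ _ => 0

/-- All intermediate results that may grow have degree less than `degLimit`. -/
def Expr.degOK : Expr → Bool
  | .const z => decide ((Expr.const z).deg < degLimit)
  | .reg _ => true
  | .get _ e => e.degOK
  | .bin .add e₁ e₂ => e₁.degOK && e₂.degOK && decide (max e₁.deg e₂.deg + 1 < degLimit)
  | .bin .sub e₁ e₂ => e₁.degOK && e₂.degOK && decide (max e₁.deg e₂.deg + 1 < degLimit)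
  | .bin .mul e₁ e₂ => e₁.degOK && e₂.degOK && decide (e₁.deg + e₂.deg < degLimit)
  | .bin .div e₁ e₂ => e₁.degOK && e₂.degOK
  | .bin .lt e₁ e₂ => e₁.degOK && e₂.degOK
  | .bin .eq e₁ e₂ => e₁.degOK && e₂.degOK

/-- No division by zero occurs. -/
def Expr.DivOK (s : State) : Expr → Prop
  | .const _ => True
  | .reg _ => True
  | .get _ e => e.DivOK s
  | .bin .div e₁ e₂ => e₁.DivOK s ∧ e₂.DivOK s ∧ e₂.eval s ≠ 0
  | .bin _ e₁ e₂ => e₁.DivOK s ∧ e₂.DivOK s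

section DivOK
variable (s : State) (e₁ e₂ : Expr)

@[simp] theorem Expr.divOK_add : (e₁ + e₂).DivOK s ↔ e₁.DivOK s ∧ e₂.DivOK s := Iff.rfl
@[simp] theorem Expr.divOK_sub : (e₁ - e₂).DivOK s ↔ e₁.DivOK s ∧ e₂.DivOK s := Iff.rfl
@[simp] theorem Expr.divOK_mul : (e₁ * e₂).DivOK s ↔ e₁.DivOK s ∧ e₂.DivOK s := Iff.rfl
@[simp] theorem Expr.divOK_div :
    (e₁ / e₂).DivOK s ↔ e₁.DivOK s ∧ e₂.DivOK s ∧ e₂.eval s ≠ 0 := Iff.rfl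
@[simp] theorem Expr.divOK_less : (e₁.less e₂).DivOK s ↔ e₁.DivOK s ∧ e₂.DivOK s := Iff.rfl
@[simp] theorem Expr.divOK_equal : (e₁.equal e₂).DivOK s ↔ e₁.DivOK s ∧ e₂.DivOK s := Iff.rfl
@[simp] theorem Expr.divOK_const (z : ℤ) : (Expr.const z).DivOK s ↔ True := Iff.rfl
@[simp] theorem Expr.divOK_reg (x : ℕ) : (Expr.reg x).DivOK s ↔ True := Iff.rfl
@[simp] theorem Expr.divOK_get (a : ℕ) : (Expr.get a e₁).DivOK s ↔ e₁.DivOK s := Iff.rfl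

end DivOK

/-- The size conditions under which the machine is analysed. With `4 ≤ β`, the sum of two numbers
of degree `d` has degree `d + 1`. -/
structure Room (W β : ℕ) : Prop where
  four_le : 4 ≤ β
  pow_le : β ^ degLimit ≤ W

variable {β : ℕ}

theorem Room.pow_le_of_le (h : Room W β) {d : ℕ} (hd : d ≤ degLimit) : β ^ d ≤ W :=
  (Nat.pow_le_pow_right (by have := h.four_le; omega) hd).trans h.pow_le

theorem Room.one_le (h : Room W β) : 1 ≤ W := by simpa using h.pow_le_of_le (d := 0) (by simp)

theorem Room.le (h : Room W β) : β ≤ W := by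
  simpa using h.pow_le_of_le (d := 1) (by simp [degLimit])

theorem Room.sizeBound_le (h : Room W β) (d : ℕ) : sizeBound W β d ≤ W := by
  unfold sizeBound; split
  · exact h.pow_le_of_le (by omega)
  · exact le_rfl

theorem Room.one_le_sizeBound (h : Room W β) (d : ℕ) : 1 ≤ sizeBound W β d := by
  unfold sizeBound; split
  · exact Nat.one_le_pow _ _ (by have := h.four_le; omega)
  · exact h.one_le

theorem sizeBound_of_lt {d : ℕ} (hd : d < degLimit) : sizeBound W β d = β ^ d := if_pos hd

/-- In a state that respects the bounds, an expression of small degree that does not divide by zero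
can be evaluated, and its value respects the bound given by its degree. -/
theorem Expr.fits_and_abs_eval_le (hR : Room W β) {s : State} (hs : Bounded W β s) (e : Expr)
    (hd : e.degOK = true) (hq : e.DivOK s) :
    e.Fits W s ∧ |e.eval s| ≤ sizeBound W β e.deg := by
  suffices h : e.degOK = true → e.DivOK s → e.Fits W s ∧ |e.eval s| ≤ sizeBound W β e.deg from
    h hd hq
  clear hd hq
  have hβ := hR.four_le
  have top : ∀ {z : ℤ} {d : ℕ}, |z| ≤ sizeBound W β d → |z| ≤ W := fun h =>
    h.trans (by exact_mod_cast hR.sizeBound_le _)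
  have addb : ∀ {x y : ℤ} {a b : ℕ}, max a b + 1 < degLimit → |x| ≤ sizeBound W β a →
      |y| ≤ sizeBound W β b → |x| + |y| ≤ sizeBound W β (max a b + 1) := by
    intro x y a b hlt hx hy
    rw [sizeBound_of_lt (by omega)] at hx hy ⊢
    have h1 : (β : ℤ) ^ a ≤ (β : ℤ) ^ (max a b) :=
      pow_le_pow_right₀ (by exact_mod_cast (by omega : 1 ≤ β)) (le_max_left _ _)
    have h2 : (β : ℤ) ^ b ≤ (β : ℤ) ^ (max a b) :=
      pow_le_pow_right₀ (by exact_mod_cast (by omega : 1 ≤ β)) (le_max_right _ _)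
    have h3 : (0 : ℤ) ≤ (β : ℤ) ^ (max a b) := by positivity
    have h4 : (2 : ℤ) ≤ β := by exact_mod_cast (by omega : 2 ≤ β)
    push_cast at hx hy ⊢
    rw [pow_succ]
    nlinarith
  have ind : ∀ p : Prop, [Decidable p] → |(if p then 1 else 0 : ℤ)| ≤ sizeBound W β 0 := by
    intro p _
    have := hR.one_le_sizeBound 0
    split <;> (simp; try omega)
  induction e with
  | const z =>
    intro hd _
    have hz : |z| ≤ sizeBound W β (Expr.const z).deg := by
      simp only [Expr.degOK, decide_eq_true_eq] at hd
      rw [sizeBound_of_lt hd, Int.abs_eq_natAbs]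
      have h1 : z.natAbs < 2 ^ (z.natAbs.log2 + 1) := Nat.lt_log2_self
      have h2 : 2 ^ (z.natAbs.log2 + 1) ≤ β ^ (z.natAbs.log2 + 1) :=
        Nat.pow_le_pow_left (by omega) _
      exact_mod_cast (h1.le.trans h2)
    exact ⟨top hz, hz⟩
  | reg x => exact fun _ _ => ⟨top (hs.reg x), hs.reg x⟩
  | get a e ih =>
    intro hd hq
    exact ⟨⟨(ih hd hq).1, top (hs.arr a _)⟩, hs.arr a _⟩
  | bin o e₁ e₂ ih₁ ih₂ =>
    intro hd hq
    cases o with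
    | add =>
      simp only [Expr.degOK, Bool.and_eq_true, decide_eq_true_eq] at hd
      obtain ⟨f₁, b₁⟩ := ih₁ hd.1.1 hq.1
      obtain ⟨f₂, b₂⟩ := ih₂ hd.1.2 hq.2
      have := (abs_add_le _ _).trans (addb hd.2 b₁ b₂)
      exact ⟨⟨f₁, f₂, by simp, top this⟩, this⟩
    | sub =>
      simp only [Expr.degOK, Bool.and_eq_true, decide_eq_true_eq] at hd
      obtain ⟨f₁, b₁⟩ := ih₁ hd.1.1 hq.1
      obtain ⟨f₂, b₂⟩ := ih₂ hd.1.2 hq.2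
      have := (abs_sub _ _).trans (addb hd.2 b₁ b₂)
      exact ⟨⟨f₁, f₂, by simp, top this⟩, this⟩
    | mul =>
      simp only [Expr.degOK, Bool.and_eq_true, decide_eq_true_eq] at hd
      obtain ⟨f₁, b₁⟩ := ih₁ hd.1.1 hq.1
      obtain ⟨f₂, b₂⟩ := ih₂ hd.1.2 hq.2
      have : |e₁.eval s * e₂.eval s| ≤ sizeBound W β (e₁.deg + e₂.deg) := by
        rw [sizeBound_of_lt (by omega)] at b₁ b₂ ⊢
        rw [abs_mul, pow_add]; push_cast at b₁ b₂ ⊢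
        gcongr
      exact ⟨⟨f₁, f₂, by simp, top this⟩, this⟩
    | div =>
      simp only [Expr.degOK, Bool.and_eq_true] at hd
      obtain ⟨f₁, b₁⟩ := ih₁ hd.1 hq.1
      obtain ⟨f₂, b₂⟩ := ih₂ hd.2 hq.2.1
      have : |e₁.eval s / e₂.eval s| ≤ sizeBound W β e₁.deg := by
        refine le_trans ?_ b₁
        rw [Int.abs_eq_natAbs, Int.abs_eq_natAbs]
        exact_mod_cast Int.natAbs_ediv_le_natAbs _ _
      exact ⟨⟨f₁, f₂, fun _ => hq.2.2, top this⟩, this⟩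
    | lt =>
      simp only [Expr.degOK, Bool.and_eq_true] at hd
      obtain ⟨f₁, b₁⟩ := ih₁ hd.1 hq.1
      obtain ⟨f₂, b₂⟩ := ih₂ hd.2 hq.2
      have := ind (e₁.eval s < e₂.eval s)
      exact ⟨⟨f₁, f₂, by simp, top this⟩, this⟩
    | eq =>
      simp only [Expr.degOK, Bool.and_eq_true] at hd
      obtain ⟨f₁, b₁⟩ := ih₁ hd.1 hq.1
      obtain ⟨f₂, b₂⟩ := ih₂ hd.2 hq.2
      have := ind (e₁.eval s = e₂.eval s)
      exact ⟨⟨f₁, f₂, by simp, top this⟩, this⟩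

theorem Bounded.fits (hR : Room W β) {s : State} (hs : Bounded W β s) {e : Expr}
    (hd : e.degOK = true) (hq : e.DivOK s) : e.Fits W s :=
  (Expr.fits_and_abs_eval_le hR hs e hd hq).1

theorem Bounded.setReg {s : State} (hs : Bounded W β s) {x : ℕ} {v : ℤ}
    (hx : regDeg x < degLimit) (hv : |v| ≤ (β : ℤ) ^ regDeg x) : Bounded W β (s.setReg x v) where
  reg y := by
    by_cases h : y = x
    · subst h; simpa [State.setReg, sizeBound_of_lt hx] using hv
    · simpa [State.setReg, h] using hs.reg y
  arr := hs.arr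

theorem Bounded.setArr {s : State} (hs : Bounded W β s) {a : ℕ} {i v : ℤ}
    (ha : arrDeg a < degLimit) (hv : |v| ≤ (β : ℤ) ^ arrDeg a) : Bounded W β (s.setArr a i v) where
  reg := hs.reg
  arr b z := by
    by_cases h : b = a
    · subst h
      by_cases hz : z = i
      · subst hz; simpa [State.setArr, sizeBound_of_lt ha] using hv
      · simpa [State.setArr, hz] using hs.arr b z
    · simpa [State.setArr, h] using hs.arr b z

theorem Bounded.coins {s : State} (hs : Bounded W β s) (c : ℕ) :
    Bounded W β { s with coins := c } := ⟨hs.reg, hs.arr⟩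

/-! ### Filling an array -/

/-- The function `old`, overwritten by `f` on `0, …, y - 1`. -/
def patch (old : ℤ → ℤ) (f : ℕ → ℤ) (y : ℕ) (z : ℤ) : ℤ :=
  if 0 ≤ z ∧ z < y then f z.toNat else old z

theorem patch_of_lt {old : ℤ → ℤ} {f : ℕ → ℤ} {y z : ℕ} (h : z < y) : patch old f y z = f z := by
  simp [patch, h]

theorem patch_self (old : ℤ → ℤ) (f : ℕ → ℤ) (y : ℕ) : patch old f y y = old y := by
  simp [patch]

theorem patch_zero (old : ℤ → ℤ) (f : ℕ → ℤ) : patch old f 0 = old := by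
  funext z; simp only [patch]; rw [if_neg]; push_cast; omega

theorem patch_succ (old : ℤ → ℤ) (f : ℕ → ℤ) (y : ℕ) :
    Function.update (patch old f y) y (f y) = patch old f (y + 1) := by
  funext z
  by_cases hz : z = y
  · subst hz; simp [patch]
  · rw [Function.update_of_ne hz]
    simp only [patch]
    by_cases h : 0 ≤ z ∧ z < y
    · rw [if_pos h, if_pos (by push_cast; omega)]
    · rw [if_neg h, if_neg (by push_cast; omega)]

/-- The state after the cells `0, …, y - 1` of the array `a` have been set to `f`, with the counter
`Y` at `y`. -/
def State.fill (s : State) (Y a : ℕ) (f : ℕ → ℤ) (y : ℕ) : State where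
  reg := Function.update s.reg Y y
  arr := Function.update s.arr a (patch (s.arr a) f y)
  coins := s.coins

theorem Bounded.fill {s : State} (hs : Bounded W β s) {Y a : ℕ} {f : ℕ → ℤ} {y : ℕ}
    (hY : regDeg Y = 1) (hy : y ≤ β) (ha : arrDeg a < degLimit)
    (hf : ∀ j < y, |f j| ≤ (β : ℤ) ^ arrDeg a) : Bounded W β (s.fill Y a f y) where
  reg x := by
    by_cases h : x = Y
    · subst h
      simp only [State.fill, Function.update_self, hY]
      rw [sizeBound_of_lt (by simp [degLimit])]
      simpa using hy
    · simpa [State.fill, h] using hs.reg x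
  arr b z := by
    by_cases h : b = a
    · subst h
      simp only [State.fill, Function.update_self, patch]
      split
      · next hz =>
        rw [sizeBound_of_lt ha]
        exact_mod_cast hf _ (by omega)
      · exact hs.arr b z
    · simpa [State.fill, h] using hs.arr b z

/-- `for Y := 0, …, l - 1 do a[Y] := e` -/
def Prog.fill (Y l a : ℕ) (e : Expr) : Prog := .for Y l (.store a (.reg Y) e)

/-- The invariant of a filling loop is an equation for the state: `e` may read the cells of `a` that
have not been overwritten yet, and every other part of the memory. -/
theorem Runs.fill (hR : Room W β) {s : State} (Y l a : ℕ) (e : Expr) (t N : ℕ) (f : ℕ → ℤ)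
    (hs : Bounded W β s) (hl : s.reg l = N) (hN : N ≤ β)
    (hf : ∀ y < N, |f y| ≤ (β : ℤ) ^ arrDeg a) (hq : ∀ y < N, e.DivOK (s.fill Y a f y))
    (he : ∀ y < N, e.eval (s.fill Y a f y) = f y) {Q : State → Prop}
    (hQ : Bounded W β (s.fill Y a f N) → Q (s.fill Y a f N)) (hYl : l ≠ Y := by decide)
    (hY : regDeg Y = 1 := by decide) (ha : arrDeg a < degLimit := by decide)
    (hd : e.degOK = true := by decide) (ht : e.cost + 10 ≤ t := by decide) :
    Runs W ω (.fill Y l a e) s (N * t + 6) Q := by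
  have hNW : N ≤ W := hN.trans hR.le
  refine Runs.mono (t := N * ((1 + e.cost + 1) + 8) + 6)
    (Runs.for (fun y s' => s' = s.fill Y a f y) N _ hYl hNW hR.one_le hl ?_ ?_) ?_ ?_
  · simp [State.fill, State.setReg, patch_zero]
  · rintro y hy _ - - rfl
    have hb : Bounded W β (s.fill Y a f y) :=
      hs.fill hY (hy.le.trans hN) ha fun j hj => hf j (by omega)
    refine Runs.store (hb.fits hR rfl trivial) (hb.fits hR hd (hq y hy)) ⟨?_, ?_, ?_⟩
    · simp [State.setArr, State.fill]
    · simp [State.setArr, State.fill, hYl, hl]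
    · rw [he y hy]
      simp [State.setArr, State.fill, State.setReg, patch_succ]
  · have : N * ((1 + e.cost + 1) + 8) ≤ N * t := Nat.mul_le_mul_left _ (by omega)
    omega
  · rintro s' ⟨-, -, rfl⟩
    exact hQ (hs.fill hY hN ha hf)

end WordRAM

/-! ### The fast Fourier transform in exact arithmetic -/

/-- Stage `s` of the transform of length `2 ^ K`. In the cell `j * 2 ^ s + r` it holds the entry `r`
of the discrete Fourier transform of length `2 ^ s` of the entries `j, j + 2 ^ (K - s), …` of `x`.
The entry `e` of the table `w` is the power `e` of the root of unity of order `2 ^ K`. This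
arrangement needs no bit reversal. -/
def fftStage (K : ℕ) (w : ℕ → ℂ) (x : ℕ → ℂ) : ℕ → ℕ → ℂ
  | 0, y => x y
  | s + 1, y =>
    fftStage K w x s (y / 2 ^ (s + 1) * 2 ^ s + y % 2 ^ s) +
      w (y % 2 ^ (s + 1) * (2 ^ K / 2 ^ (s + 1))) *
        fftStage K w x s (y / 2 ^ (s + 1) * 2 ^ s + y % 2 ^ s + 2 ^ K / 2)

/-- The discrete Fourier transform of length `N`. -/
def dft (N : ℕ) (ζ : ℂ) (x : ℕ → ℂ) (r : ℕ) : ℂ := ∑ l ∈ Finset.range N, x l * ζ ^ (r * l)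

theorem sum_range_two_mul {M : Type*} [AddCommMonoid M] (f : ℕ → M) (n : ℕ) :
    ∑ l ∈ Finset.range (2 * n), f l =
      ∑ l ∈ Finset.range n, f (2 * l) + ∑ l ∈ Finset.range n, f (2 * l + 1) := by
  induction n with
  | zero => simp
  | succ n ih =>
    rw [Nat.mul_succ, Finset.sum_range_succ, Finset.sum_range_succ, ih, Finset.sum_range_succ,
      Finset.sum_range_succ]
    abel

theorem fftStage_eq_sum (K : ℕ) (ζ : ℂ) (hζ : ζ ^ 2 ^ K = 1) (x : ℕ → ℂ) (s : ℕ) (hs : s ≤ K)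
    (j r : ℕ) (hr : r < 2 ^ s) :
    fftStage K (fun e => ζ ^ e) x s (j * 2 ^ s + r) =
      ∑ l ∈ Finset.range (2 ^ s), x (j + l * 2 ^ (K - s)) * ζ ^ (2 ^ (K - s) * (r * l)) := by
  induction s generalizing j r with
  | zero =>
    obtain rfl : r = 0 := by simpa using hr
    simp [fftStage]
  | succ s ih =>
    have hp : 0 < 2 ^ (s + 1) := by positivity
    have hq : 0 < 2 ^ s := by positivity
    have e1 : (j * 2 ^ (s + 1) + r) / 2 ^ (s + 1) = j := by
      rw [mul_comm, Nat.mul_add_div hp, Nat.div_eq_of_lt hr, add_zero]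
    have e2 : (j * 2 ^ (s + 1) + r) % 2 ^ (s + 1) = r := by
      rw [mul_comm, Nat.mul_add_mod, Nat.mod_eq_of_lt hr]
    have e3 : (j * 2 ^ (s + 1) + r) % 2 ^ s = r % 2 ^ s := by
      rw [pow_succ, show j * (2 ^ s * 2) = 2 ^ s * (j * 2) by ring, Nat.mul_add_mod]
    have hK : 2 ^ (K - s) = 2 * 2 ^ (K - (s + 1)) := by
      rw [← pow_succ']; congr 1; omega
    have e4 : 2 ^ K / 2 ^ (s + 1) = 2 ^ (K - (s + 1)) := Nat.pow_div hs (by norm_num)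
    have e5 : 2 ^ K / 2 = 2 ^ (K - (s + 1)) * 2 ^ s := by
      rw [← pow_add, show K - (s + 1) + s = K - 1 by omega]
      conv_lhs => rw [show K = K - 1 + 1 by omega, pow_succ]
      simp
    have e6 : ∀ l, ζ ^ (2 ^ (K - s) * (r % 2 ^ s * l)) = ζ ^ (2 ^ (K - s) * (r * l)) := by
      intro l
      have hprod : 2 ^ (K - s) * 2 ^ s = 2 ^ K := by rw [← pow_add]; congr 1; omega
      conv_rhs => rw [← Nat.mod_add_div r (2 ^ s)]
      rw [show 2 ^ (K - s) * ((r % 2 ^ s + 2 ^ s * (r / 2 ^ s)) * l) =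
        2 ^ (K - s) * (r % 2 ^ s * l) + (2 ^ (K - s) * 2 ^ s) * (r / 2 ^ s * l) by ring,
        hprod, pow_add, pow_mul ζ (2 ^ K), hζ, one_pow, mul_one]
    rw [fftStage, e1, e2, e3, e4, e5, ih (by omega) j _ (Nat.mod_lt _ hq)]
    rw [show j * 2 ^ s + r % 2 ^ s + 2 ^ (K - (s + 1)) * 2 ^ s =
      (j + 2 ^ (K - (s + 1))) * 2 ^ s + r % 2 ^ s by ring, ih (by omega) _ _ (Nat.mod_lt _ hq)]
    rw [pow_succ' 2 s, sum_range_two_mul, Finset.mul_sum]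
    congr 1
    · refine Finset.sum_congr rfl fun l _ => ?_
      rw [e6, hK]
      congr 2 <;> ring
    · refine Finset.sum_congr rfl fun l _ => ?_
      rw [e6, hK, ← mul_assoc, mul_comm (ζ ^ _) (x _), mul_assoc, ← pow_add]
      congr 2 <;> ring

/-- The last stage is the discrete Fourier transform. -/
theorem fftStage_self (K : ℕ) (ζ : ℂ) (hζ : ζ ^ 2 ^ K = 1) (x : ℕ → ℂ) {r : ℕ} (hr : r < 2 ^ K) :
    fftStage K (fun e => ζ ^ e) x K r = dft (2 ^ K) ζ x r := by
  have h := fftStage_eq_sum K ζ hζ x K le_rfl 0 r hr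
  simp only [zero_mul, zero_add, Nat.sub_self, pow_zero, mul_one, one_mul] at h
  exact h

theorem fft_index_lt {K s y : ℕ} (hs : s < K) (hy : y < 2 ^ K) :
    y / 2 ^ (s + 1) * 2 ^ s + y % 2 ^ s < 2 ^ K / 2 := by
  have hK : 2 ^ K = 2 ^ (K - (s + 1)) * 2 ^ (s + 1) := by rw [← pow_add]; congr 1; omega
  have h1 : y / 2 ^ (s + 1) < 2 ^ (K - (s + 1)) := by
    rw [Nat.div_lt_iff_lt_mul (by positivity), ← hK]; exact hy
  have h2 : y % 2 ^ s < 2 ^ s := Nat.mod_lt _ (by positivity)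
  have h3 : 2 ^ K / 2 = 2 ^ (K - (s + 1)) * 2 ^ s := by
    rw [hK, pow_succ, ← mul_assoc, Nat.mul_div_cancel _ (by norm_num)]
  rw [h3]
  calc _ < y / 2 ^ (s + 1) * 2 ^ s + 2 ^ s := by omega
    _ = (y / 2 ^ (s + 1) + 1) * 2 ^ s := by ring
    _ ≤ _ := Nat.mul_le_mul_right _ h1

theorem fft_root_index_lt {K s y : ℕ} (hs : s < K) :
    y % 2 ^ (s + 1) * (2 ^ K / 2 ^ (s + 1)) < 2 ^ K := by
  have hK : 2 ^ K = 2 ^ (s + 1) * 2 ^ (K - (s + 1)) := by rw [← pow_add]; congr 1; omega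
  rw [Nat.pow_div hs (by norm_num)]
  conv_rhs => rw [hK]
  exact Nat.mul_lt_mul_of_pos_right (Nat.mod_lt _ (by positivity)) (by positivity)

theorem two_mul_half {K : ℕ} (hK : 0 < K) : 2 ^ K / 2 + 2 ^ K / 2 = 2 ^ K := by
  obtain ⟨k, rfl⟩ := Nat.exists_eq_succ_of_ne_zero hK.ne'
  rw [pow_succ]; omega

theorem norm_fftStage_le (K : ℕ) (ζ : ℂ) (hζ : ‖ζ‖ = 1) (x : ℕ → ℂ) (M : ℝ)
    (hx : ∀ y < 2 ^ K, ‖x y‖ ≤ M) (s : ℕ) (hs : s ≤ K) (y : ℕ) (hy : y < 2 ^ K) :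
    ‖fftStage K (fun e => ζ ^ e) x s y‖ ≤ 2 ^ s * M := by
  induction s generalizing y with
  | zero => simpa [fftStage] using hx y hy
  | succ s ih =>
    have h := fft_index_lt (by omega : s < K) hy
    have h2 := two_mul_half (by omega : 0 < K)
    rw [fftStage]
    refine (norm_add_le _ _).trans ?_
    rw [norm_mul, norm_pow, hζ, one_pow, one_mul]
    have a := ih (by omega) _ (by omega : y / 2 ^ (s + 1) * 2 ^ s + y % 2 ^ s < 2 ^ K)
    have b := ih (by omega) _
      (by omega : y / 2 ^ (s + 1) * 2 ^ s + y % 2 ^ s + 2 ^ K / 2 < 2 ^ K)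
    rw [pow_succ (2 : ℝ) s]; linarith

/-! ### Correlation by two Fourier transforms -/

theorem sum_pow_mul_eq {N : ℕ} {ζ : ℂ} (hζ : IsPrimitiveRoot ζ N) (t : ℕ) :
    ∑ r ∈ Finset.range N, ζ ^ (r * t) = if N ∣ t then (N : ℂ) else 0 := by
  split
  · next h =>
    obtain ⟨c, rfl⟩ := h
    simp [show ∀ r, r * (N * c) = N * (r * c) by intro r; ring, pow_mul, hζ.pow_eq_one]
  · next h =>
    have h1 : ζ ^ t ≠ 1 := fun h' => h (hζ.dvd_of_pow_eq_one t h')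
    have h2 := geom_sum_mul (ζ ^ t) N
    rw [← pow_mul, mul_comm t N, pow_mul, hζ.pow_eq_one, one_pow, sub_self] at h2
    have h3 := (mul_eq_zero.mp h2).resolve_right (sub_ne_zero.mpr h1)
    simpa [← pow_mul, mul_comm] using h3

/-- Transforming the squares of a transform gives, at the index `k`, `N` times the value at `-k` of
the cyclic convolution of `x` with itself. -/
theorem dft_sq_dft {N : ℕ} {ζ : ℂ} (hζ : IsPrimitiveRoot ζ N) (x : ℕ → ℂ) (k : ℕ) :
    dft N ζ (fun r => dft N ζ x r * dft N ζ x r) k =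
      N * ∑ a ∈ Finset.range N, ∑ b ∈ Finset.range N, if N ∣ a + b + k then x a * x b else 0 := by
  calc dft N ζ (fun r => dft N ζ x r * dft N ζ x r) k
      = ∑ r ∈ Finset.range N, ∑ a ∈ Finset.range N, ∑ b ∈ Finset.range N,
          x a * x b * ζ ^ (r * (a + b + k)) := by
        refine Finset.sum_congr rfl fun r _ => ?_
        simp only [dft]
        rw [Finset.sum_mul_sum, Finset.sum_mul]
        refine Finset.sum_congr rfl fun a _ => ?_
        rw [Finset.sum_mul]
        refine Finset.sum_congr rfl fun b _ => ?_
        rw [show r * (a + b + k) = r * a + r * b + k * r by ring, pow_add, pow_add]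
        ring
    _ = _ := by
        rw [Finset.sum_comm, Finset.mul_sum]
        refine Finset.sum_congr rfl fun a _ => ?_
        rw [Finset.sum_comm, Finset.mul_sum]
        refine Finset.sum_congr rfl fun b _ => ?_
        rw [← Finset.mul_sum, sum_pow_mul_eq hζ]
        split <;> ring

/-- The text `u`, reversed, as real part and the pattern `v` as imaginary part. -/
noncomputable def packed (N n m : ℕ) (u v : ℕ → ℝ) (a : ℕ) : ℂ :=
  ⟨if N - 1 - a < n then u (N - 1 - a) else 0, if a < m then v a else 0⟩

/-- The square of `packed` under cyclic convolution has the correlation of text and pattern in its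
imaginary part. The second transform replaces an inverse one: it differs from it by a factor and
by the sign of the index, which the reversal of the text undoes. -/
theorem im_dft_sq_dft_packed {N n m i : ℕ} {ζ : ℂ} (hζ : IsPrimitiveRoot ζ N) (u v : ℕ → ℝ)
    (hn : n < N) (hi : i + m ≤ n) :
    (dft N ζ (fun r => dft N ζ (packed N n m u v) r * dft N ζ (packed N n m u v) r) (i + 1)).im =
      2 * N * ∑ j ∈ Finset.range m, u (i + j) * v j := by
  rw [dft_sq_dft hζ, ← Complex.ofReal_natCast, Complex.im_ofReal_mul, mul_comm (2 : ℝ), mul_assoc]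
  congr 1
  set α : ℕ → ℝ := fun a => if N - 1 - a < n then u (N - 1 - a) else 0 with hα
  set γ : ℕ → ℝ := fun a => if a < m then v a else 0 with hγ
  have key : ∑ b ∈ Finset.range N, ∑ a ∈ Finset.range N,
      (if N ∣ a + b + (i + 1) then α a * γ b else 0) =
      ∑ j ∈ Finset.range m, u (i + j) * v j := by
    rw [← Finset.sum_subset (Finset.range_subset_range.2 (by omega : m ≤ N))]
    · refine Finset.sum_congr rfl fun b hb => ?_
      have hb := Finset.mem_range.1 hb
      rw [Finset.sum_eq_single (N - 1 - (i + b))]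
      · rw [if_pos ⟨1, by omega⟩]
        simp only [hα, hγ]
        rw [if_pos (by omega), if_pos hb, show N - 1 - (N - 1 - (i + b)) = i + b by omega]
      · intro a ha hne
        have ha := Finset.mem_range.1 ha
        by_cases hd : N ∣ a + b + (i + 1)
        · have : ¬ N - 1 - a < n := by
            intro hlt
            obtain ⟨c, hc⟩ := hd
            have h1 : c < 2 := by
              by_contra hcc
              have : N * 2 ≤ N * c := Nat.mul_le_mul_left _ (by omega)
              omega
            interval_cases c <;> omega
          simp [hα, this]
        · simp [hd]
      · intro h; exact absurd (Finset.mem_range.2 (by omega)) h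
    · intro b _ hb
      have : ¬ b < m := by simpa using hb
      simp [hγ, this]
  have hsplit : (∑ a ∈ Finset.range N, ∑ b ∈ Finset.range N,
      if N ∣ a + b + (i + 1) then packed N n m u v a * packed N n m u v b else 0).im =
      ∑ a ∈ Finset.range N, ∑ b ∈ Finset.range N,
        ((if N ∣ a + b + (i + 1) then α a * γ b else 0) +
          if N ∣ b + a + (i + 1) then α b * γ a else 0) := by
    rw [Complex.im_sum]
    refine Finset.sum_congr rfl fun a _ => ?_
    rw [Complex.im_sum]
    refine Finset.sum_congr rfl fun b _ => ?_
    rw [add_comm b a]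
    split
    · simp only [Complex.mul_im, packed, hα, hγ]; ring
    · simp
  rw [hsplit]
  simp only [Finset.sum_add_distrib]
  rw [key, Finset.sum_comm, key]
  ring

/-! ### Fixed-point complex arithmetic -/

/-- The complex number that the words `a`, `b` stand for, with the scale `B`. -/
noncomputable def fixed (B : ℕ) (a b : ℤ) : ℂ := ⟨a / B, b / B⟩

theorem abs_ediv_sub_le {B : ℕ} (hB : 0 < B) (p : ℤ) : |((p / (B : ℤ) : ℤ) : ℝ) - p / B| ≤ 1 := by
  have hB' : (0 : ℝ) < B := by exact_mod_cast hB
  have h1 := Int.emod_add_mul_ediv p B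
  have h2 := Int.emod_nonneg p (by positivity : (B : ℤ) ≠ 0)
  have h3 := Int.emod_lt_of_pos p (by exact_mod_cast hB : (0 : ℤ) < B)
  have h1' : ((p % (B : ℤ) : ℤ) : ℝ) + B * ((p / (B : ℤ) : ℤ) : ℝ) = p := by exact_mod_cast h1
  have h2' : (0 : ℝ) ≤ ((p % (B : ℤ) : ℤ) : ℝ) := by exact_mod_cast h2
  have h3' : ((p % (B : ℤ) : ℤ) : ℝ) < B := by exact_mod_cast h3
  have : ((p / (B : ℤ) : ℤ) : ℝ) - p / B = -((p % (B : ℤ) : ℤ) : ℝ) / B := by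
    field_simp; linarith
  rw [this, abs_div, abs_neg, abs_of_nonneg h2', abs_of_pos hB', div_le_one hB']
  exact h3'.le

theorem norm_fixed_ediv_sub_le {B : ℕ} (hB : 0 < B) (p q : ℤ) :
    ‖fixed B (p / B) (q / B) - ⟨p / B / B, q / B / B⟩‖ ≤ 2 / B := by
  have hB' : (0 : ℝ) < B := by exact_mod_cast hB
  refine (Complex.norm_le_abs_re_add_abs_im _).trans ?_
  simp only [fixed, Complex.sub_re, Complex.sub_im]
  rw [← sub_div, ← sub_div, abs_div, abs_div, abs_of_pos hB', ← add_div]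
  gcongr
  linarith [abs_ediv_sub_le hB p, abs_ediv_sub_le hB q]

/-- Rounding error of a fixed-point multiplication. -/
theorem norm_fixed_mul_sub_le {B : ℕ} (hB : 0 < B) (a b c d : ℤ) :
    ‖fixed B ((a * c - b * d) / B) ((a * d + b * c) / B) - fixed B a b * fixed B c d‖ ≤ 2 / B := by
  have h := norm_fixed_ediv_sub_le hB (a * c - b * d) (a * d + b * c)
  convert h using 3
  have hB' : (B : ℝ) ≠ 0 := by positivity
  apply Complex.ext
  · simp only [fixed, Complex.mul_re]; push_cast; field_simp
  · simp only [fixed, Complex.mul_im]; push_cast; field_simp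

theorem fixed_add (B : ℕ) (a b c d : ℤ) : fixed B (a + c) (b + d) = fixed B a b + fixed B c d := by
  apply Complex.ext <;> simp [fixed, add_div]

theorem abs_re_le_of_norm_fixed_le {B : ℕ} (hB : 0 < B) {a b : ℤ} {M : ℝ}
    (h : ‖fixed B a b‖ ≤ M) : |(a : ℝ)| ≤ M * B ∧ |(b : ℝ)| ≤ M * B := by
  have hB' : (0 : ℝ) < B := by exact_mod_cast hB
  have h1 := (Complex.abs_re_le_norm (fixed B a b)).trans h
  have h2 := (Complex.abs_im_le_norm (fixed B a b)).trans h
  simp only [fixed, abs_div, abs_of_pos hB', div_le_iff₀ hB'] at h1 h2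
  exact ⟨h1, h2⟩

/-- Error propagation in one butterfly. -/
theorem norm_butterfly_sub_le {a b w a' b' w' z : ℂ} {E η M ρ : ℝ} (ha : ‖a' - a‖ ≤ E)
    (hb : ‖b' - b‖ ≤ E) (hw : ‖w' - w‖ ≤ η) (hη : η ≤ 1) (hw1 : ‖w‖ = 1) (hM : ‖b‖ ≤ M)
    (hz : ‖z - (a' + w' * b')‖ ≤ ρ) : ‖z - (a + w * b)‖ ≤ 3 * E + (η * M + ρ) := by
  have hw2 : ‖w'‖ ≤ 2 := by
    calc ‖w'‖ = ‖(w' - w) + w‖ := by ring_nf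
      _ ≤ ‖w' - w‖ + ‖w‖ := norm_add_le _ _
      _ ≤ 2 := by linarith
  have e : z - (a + w * b) = (z - (a' + w' * b')) + (a' - a) + w' * (b' - b) + (w' - w) * b := by
    ring
  rw [e]
  have h1 : ‖w' * (b' - b)‖ ≤ 2 * E := by rw [norm_mul]; gcongr
  have h2 : ‖(w' - w) * b‖ ≤ η * M := by
    rw [norm_mul]; gcongr; exact (norm_nonneg _).trans hw
  refine (norm_add_le _ _).trans ((add_le_add (norm_add₃_le) le_rfl).trans ?_)
  linarith

/-! ### Roots of unity in fixed-point arithmetic -/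

theorem abs_sqrt_sub_sqrt_le (x y : ℝ) : |√x - √y| ≤ √|x - y| := by
  have h : ∀ x y : ℝ, √x ≤ √y + √|x - y| := by
    intro x y
    rcases le_or_gt 0 y with hy | hy
    · refine Real.sqrt_le_iff.2 ⟨by positivity, ?_⟩
      have h1 := Real.sq_sqrt hy
      have h2 := Real.sq_sqrt (abs_nonneg (x - y))
      nlinarith [le_abs_self (x - y), mul_nonneg (Real.sqrt_nonneg y) (Real.sqrt_nonneg |x - y|)]
    · have := Real.sqrt_le_sqrt (show x ≤ |x - y| by linarith [le_abs_self (x - y)])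
      linarith [Real.sqrt_nonneg y]
  rw [abs_le]
  have h1 := h x y
  have h2 := h y x
  rw [abs_sub_comm] at h2
  constructor <;> linarith

theorem abs_sub_sqrt_le_one {r : ℕ} {x : ℝ} (h1 : (r : ℝ) ^ 2 ≤ x) (h2 : x < ((r : ℝ) + 1) ^ 2) :
    |(r : ℝ) - √x| ≤ 1 := by
  have h3 : (r : ℝ) ≤ √x := Real.le_sqrt_of_sq_le h1
  have h4 : √x ≤ r + 1 := Real.sqrt_le_iff.2 ⟨by positivity, h2.le⟩
  rw [abs_le]; constructor <;> linarith

/-- A step of the half-angle recursion `2 cos (θ / 2) = √(2 + 2 cos θ)` adds at most one unit of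
error. -/
theorem abs_sub_sqrt_two_add_le {B r : ℕ} (hB : 1 ≤ B) {c C e : ℝ} (hc : 0 ≤ c) (hC : 0 ≤ C)
    (he : |C - B * c| ≤ e)
    (h1 : (r : ℝ) ^ 2 ≤ 2 * B ^ 2 + B * C) (h2 : 2 * B ^ 2 + B * C < ((r : ℝ) + 1) ^ 2) :
    |(r : ℝ) - B * √(2 + c)| ≤ e + 1 := by
  have hB' : (1 : ℝ) ≤ B := by exact_mod_cast hB
  have h3 := abs_sub_sqrt_le_one h1 h2
  have h4 : (B : ℝ) * √(2 + c) = √(2 * B ^ 2 + B * (B * c)) := by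
    rw [show 2 * (B : ℝ) ^ 2 + B * (B * c) = B ^ 2 * (2 + c) by ring, Real.sqrt_mul (by positivity),
      Real.sqrt_sq (by positivity)]
  set p := √(2 * (B : ℝ) ^ 2 + B * C)
  set q := √(2 * (B : ℝ) ^ 2 + B * (B * c))
  have hp : p ^ 2 = 2 * B ^ 2 + B * C := Real.sq_sqrt (by positivity)
  have hq : q ^ 2 = 2 * B ^ 2 + B * (B * c) := Real.sq_sqrt (by positivity)
  have hp1 : (B : ℝ) ≤ p :=
    Real.le_sqrt_of_sq_le (by nlinarith [mul_nonneg (by positivity : (0 : ℝ) ≤ B) hC])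
  have hq1 : 0 ≤ q := Real.sqrt_nonneg _
  have h5 : |p - q| ≤ e := by
    have h6 : |p - q| * (p + q) = B * |C - B * c| := by
      have : |p - q| * |p + q| = |(B : ℝ)| * |C - B * c| := by
        rw [← abs_mul, ← abs_mul]; congr 1; nlinarith
      rwa [abs_of_nonneg (by linarith : 0 ≤ p + q),
        abs_of_nonneg (by linarith : (0 : ℝ) ≤ B)] at this
    have h7 : |p - q| * B ≤ B * e := by
      calc |p - q| * B ≤ |p - q| * (p + q) := by gcongr; linarith
        _ = B * |C - B * c| := h6
        _ ≤ B * e := by gcongr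
    nlinarith
  rw [h4]
  calc |(r : ℝ) - q| = |(r - p) + (p - q)| := by ring_nf
    _ ≤ |r - p| + |p - q| := abs_add_le _ _
    _ ≤ e + 1 := by linarith

/-- Computing `2 sin θ = √(4 - (2 cos θ) ^ 2)` may lose half of the digits of `2 cos θ`, as the
argument of the root may be close to `0`. -/
theorem abs_sub_sqrt_four_sub_le {B r : ℕ} {c C e : ℝ} (hc : 0 ≤ c) (hc2 : c ≤ 2)
    (hC : 0 ≤ C) (hC2 : C ≤ 2 * B) (he : |C - B * c| ≤ e)
    (h1 : (r : ℝ) ^ 2 ≤ 4 * B ^ 2 - C ^ 2) (h2 : 4 * B ^ 2 - C ^ 2 < ((r : ℝ) + 1) ^ 2) :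
    |(r : ℝ) - B * √(4 - c ^ 2)| ≤ 2 * √(e * B) + 1 := by
  have h3 := abs_sub_sqrt_le_one h1 h2
  have h4 : (B : ℝ) * √(4 - c ^ 2) = √(4 * B ^ 2 - (B * c) ^ 2) := by
    rw [show 4 * (B : ℝ) ^ 2 - (B * c) ^ 2 = B ^ 2 * (4 - c ^ 2) by ring,
      Real.sqrt_mul (by positivity), Real.sqrt_sq (by positivity)]
  have h5 := abs_sqrt_sub_sqrt_le (4 * (B : ℝ) ^ 2 - C ^ 2) (4 * B ^ 2 - (B * c) ^ 2)
  have h6 : √|4 * (B : ℝ) ^ 2 - C ^ 2 - (4 * B ^ 2 - (B * c) ^ 2)| ≤ 2 * √(e * B) := by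
    rw [show (2 : ℝ) * √(e * B) = √(2 ^ 2 * (e * B)) by
      rw [Real.sqrt_mul (by norm_num) (e * B), Real.sqrt_sq (by norm_num)]]
    apply Real.sqrt_le_sqrt
    rw [show 4 * (B : ℝ) ^ 2 - C ^ 2 - (4 * B ^ 2 - (B * c) ^ 2) = -((C - B * c) * (C + B * c)) by
      ring, abs_neg, abs_mul, abs_of_nonneg (by positivity : 0 ≤ C + B * c)]
    have : C + B * c ≤ 4 * B := by nlinarith [(Nat.cast_nonneg B : (0 : ℝ) ≤ B)]
    calc _ ≤ e * (4 * B) := mul_le_mul he this (by positivity) ((abs_nonneg _).trans he)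
      _ = _ := by ring
  rw [h4]
  calc |(r : ℝ) - √(4 * B ^ 2 - (B * c) ^ 2)|
      = |(r - √(4 * B ^ 2 - C ^ 2)) + (√(4 * B ^ 2 - C ^ 2) - √(4 * B ^ 2 - (B * c) ^ 2))| := by
        ring_nf
    _ ≤ |r - √(4 * B ^ 2 - C ^ 2)| + |√(4 * B ^ 2 - C ^ 2) - √(4 * B ^ 2 - (B * c) ^ 2)| :=
        abs_add_le _ _
    _ ≤ _ := by linarith

/-- Error propagation in the table of the powers of `ζ`: the error grows linearly, as long as it
stays below `1`. -/
theorem norm_power_table_sub_le {ζ ζ' : ℂ} {η ρ : ℝ} (hζ : ‖ζ‖ = 1) (hη : ‖ζ' - ζ‖ ≤ η)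
    (z : ℕ → ℂ) (h0 : z 0 = 1) (hz : ∀ y, ‖z (y + 1) - z y * ζ'‖ ≤ ρ) (y : ℕ)
    (hy : (y : ℝ) * (2 * η + ρ) ≤ 1) : ‖z y - ζ ^ y‖ ≤ y * (2 * η + ρ) := by
  have hη0 : 0 ≤ η := (norm_nonneg _).trans hη
  have hρ0 : 0 ≤ ρ := (norm_nonneg _).trans (hz 0)
  induction y with
  | zero => simp [h0]
  | succ y ih =>
    push_cast at hy ⊢
    have hy' : (y : ℝ) * (2 * η + ρ) ≤ 1 := by nlinarith
    have h := ih hy'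
    have e : z (y + 1) - ζ ^ (y + 1) = (z (y + 1) - z y * ζ') + (z y - ζ ^ y) * ζ +
        (z y - ζ ^ y) * (ζ' - ζ) + ζ ^ y * (ζ' - ζ) := by ring
    rw [e]
    have n1 : ‖(z y - ζ ^ y) * ζ‖ ≤ y * (2 * η + ρ) := by rw [norm_mul, hζ, mul_one]; exact h
    have n2 : ‖(z y - ζ ^ y) * (ζ' - ζ)‖ ≤ 1 * η := by
      rw [norm_mul]; gcongr; exact h.trans hy'
    have n3 : ‖ζ ^ y * (ζ' - ζ)‖ ≤ η := by rw [norm_mul, norm_pow, hζ, one_pow, one_mul]; exact hη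
    refine (norm_add_le _ _).trans ((add_le_add norm_add₃_le le_rfl).trans ?_)
    linarith [hz y]

namespace WordRAM

open WordRAM.Expr (reg get const less equal)

variable {W β : ℕ} {ω : ℕ → Bool}

/-! ### Comparison of states -/

section Simp
variable (s : State) (Y a : ℕ) (f : ℕ → ℤ) (y : ℕ) (v i : ℤ)

@[simp] theorem fill_reg : (s.fill Y a f y).reg = Function.update s.reg Y y := rfl
@[simp] theorem fill_arr :
    (s.fill Y a f y).arr = Function.update s.arr a (patch (s.arr a) f y) := rfl
@[simp] theorem fill_coins : (s.fill Y a f y).coins = s.coins := rfl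
@[simp] theorem setReg_reg : (s.setReg Y v).reg = Function.update s.reg Y v := rfl
@[simp] theorem setReg_arr : (s.setReg Y v).arr = s.arr := rfl
@[simp] theorem setReg_coins : (s.setReg Y v).coins = s.coins := rfl
@[simp] theorem setArr_reg : (s.setArr a i v).reg = s.reg := rfl
@[simp] theorem setArr_arr :
    (s.setArr a i v).arr = Function.update s.arr a (Function.update (s.arr a) i v) := rfl
@[simp] theorem setArr_coins : (s.setArr a i v).coins = s.coins := rfl

end Simp

/-- The states `s` and `s'` differ at most in the listed registers and arrays. -/
structure SameExcept (rs as : List ℕ) (s s' : State) : Prop where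
  reg : ∀ x, x ∉ rs → s'.reg x = s.reg x
  arr : ∀ a, a ∉ as → s'.arr a = s.arr a
  coins : s'.coins = s.coins

theorem SameExcept.refl (rs as : List ℕ) (s : State) : SameExcept rs as s s :=
  ⟨fun _ _ => rfl, fun _ _ => rfl, rfl⟩

theorem SameExcept.trans {rs as : List ℕ} {s s' s'' : State} (h : SameExcept rs as s s')
    (h' : SameExcept rs as s' s'') : SameExcept rs as s s'' :=
  ⟨fun x hx => (h'.reg x hx).trans (h.reg x hx), fun a ha => (h'.arr a ha).trans (h.arr a ha),
    h'.coins.trans h.coins⟩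

theorem SameExcept.mono {rs as rs' as' : List ℕ} {s s' : State} (h : SameExcept rs as s s')
    (hr : rs ⊆ rs') (ha : as ⊆ as') : SameExcept rs' as' s s' :=
  ⟨fun x hx => h.reg x fun h' => hx (hr h'), fun a hx => h.arr a fun h' => hx (ha h'), h.coins⟩

/-! ### The transform as a program -/

/-- Address of the first operand of the butterfly for the cell in register `16`. -/
def indexU : Expr :=
  reg 16 / (const 2 * reg 18) * reg 18 + (reg 16 - reg 16 / reg 18 * reg 18)

/-- Address of the second operand of a butterfly. -/
def indexV : Expr := indexU + reg 4 / const 2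

/-- Address of the root of unity of a butterfly. -/
def indexW : Expr :=
  (reg 16 - reg 16 / (const 2 * reg 18) * (const 2 * reg 18)) * (reg 4 / (const 2 * reg 18))

/-- Real part of the result of a butterfly. -/
def butterflyRe : Expr :=
  get 6 indexU + (get 4 indexW * get 6 indexV - get 5 indexW * get 7 indexV) / reg 6

/-- Imaginary part of the result of a butterfly. -/
def butterflyIm : Expr :=
  get 7 indexU + (get 4 indexW * get 7 indexV + get 5 indexW * get 6 indexV) / reg 6

/-- Copies the arrays `8`, `9` to the arrays `6`, `7`. -/
def copyBack : Prog := .seq (.fill 16 4 6 (get 8 (reg 16))) (.fill 16 4 7 (get 9 (reg 16)))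

/-- One stage of the transform, computed from the arrays `6`, `7` into the arrays `8`, `9`. -/
def fftStageProg : Prog :=
  .seq (.fill 16 4 8 butterflyRe) (.seq (.fill 16 4 9 butterflyIm)
    (.seq copyBack (.assign 18 (reg 18 * const 2))))

/-- Replaces the vector in the arrays `6`, `7` by its discrete Fourier transform. -/
def fftProg : Prog := .seq (.assign 18 (const 1)) (.while (less (reg 18) (reg 4)) fftStageProg)

/-- Replaces the vector in the arrays `6`, `7` by the vector of the squares of its entries. -/
def squareProg : Prog :=
  .seq (.fill 16 4 8 ((get 6 (reg 16) * get 6 (reg 16) - get 7 (reg 16) * get 7 (reg 16)) / reg 6))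
    (.seq (.fill 16 4 9
      ((get 6 (reg 16) * get 7 (reg 16) + get 7 (reg 16) * get 6 (reg 16)) / reg 6)) copyBack)

theorem eval_indexU {s : State} {y L : ℕ} (h16 : s.reg 16 = y) (h18 : s.reg 18 = L) :
    indexU.eval s = ((y / (2 * L) * L + y % L : ℕ) : ℤ) := by
  simp only [indexU, Expr.eval_add, Expr.eval_mul, Expr.eval_div, Expr.eval_sub, Expr.eval_reg,
    Expr.eval_const, h16, h18]
  push_cast
  rw [Int.emod_def]; ring

theorem eval_indexV {s : State} {y L N : ℕ} (h16 : s.reg 16 = y) (h18 : s.reg 18 = L)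
    (h4 : s.reg 4 = N) :
    indexV.eval s = ((y / (2 * L) * L + y % L + N / 2 : ℕ) : ℤ) := by
  rw [indexV, Expr.eval_add, eval_indexU h16 h18]
  simp [h4]

theorem eval_indexW {s : State} {y L N : ℕ} (h16 : s.reg 16 = y) (h18 : s.reg 18 = L)
    (h4 : s.reg 4 = N) :
    indexW.eval s = ((y % (2 * L) * (N / (2 * L)) : ℕ) : ℤ) := by
  simp only [indexW, Expr.eval_mul, Expr.eval_div, Expr.eval_sub, Expr.eval_reg,
    Expr.eval_const, h16, h18, h4]
  push_cast
  rw [Int.emod_def]; ring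

theorem Runs.copyBack (hR : Room W β) {s : State} {N : ℕ} (hs : Bounded W β s)
    (h4 : s.reg 4 = N) (hN : N ≤ β) (h8 : ∀ y < N, |s.arr 8 (y : ℕ)| ≤ (β : ℤ) ^ 40)
    (h9 : ∀ y < N, |s.arr 9 (y : ℕ)| ≤ (β : ℤ) ^ 40) :
    Runs W ω copyBack s (N * 24 + 12) fun s' => Bounded W β s' ∧ SameExcept [16] [6, 7] s s' ∧
      ∀ y < N, s'.arr 6 (y : ℕ) = s.arr 8 (y : ℕ) ∧ s'.arr 7 (y : ℕ) = s.arr 9 (y : ℕ) := by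
  refine Runs.mono (t := N * 12 + 6 + (N * 12 + 6)) (Runs.seq (Runs.fill hR 16 4 6 _ 12 N
    (fun y => s.arr 8 y) hs h4 hN h8 (fun y _ => by simp) (fun y _ => by simp) fun hs1 => ?_))
    (by omega) fun _ h => h
  refine Runs.fill hR 16 4 7 _ 12 N (fun y => s.arr 9 y) hs1 (by simpa using h4) hN h9
    (fun y _ => by simp) (fun y _ => by simp) fun hs2 => ?_
  refine ⟨hs2, ⟨fun x hx => ?_, fun a ha => ?_, rfl⟩, fun y hy => ?_⟩
  · have : x ≠ 16 := by simpa using hx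
    simp [this]
  · simp only [List.mem_cons, List.not_mem_nil, or_false, not_or] at ha
    simp [ha.1, ha.2]
  · simp [patch_of_lt hy]

/-- The fixed-point numbers in the arrays `6`, `7` approximate the entries of `x` up to `E`. -/
def Holds (B N : ℕ) (s : State) (x : ℕ → ℂ) (E : ℝ) : Prop :=
  ∀ y < N, ‖fixed B (s.arr 6 (y : ℕ)) (s.arr 7 (y : ℕ)) - x y‖ ≤ E

/-- The arrays `4`, `5` hold the powers of `ζ` up to an error of `η`. -/
def RootTable (B N : ℕ) (s : State) (ζ : ℂ) (η : ℝ) : Prop :=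
  ∀ e < N, ‖fixed B (s.arr 4 (e : ℕ)) (s.arr 5 (e : ℕ)) - ζ ^ e‖ ≤ η

theorem abs_le_of_norm_fixed_sub_le {B : ℕ} (hB : 0 < B) {a b : ℤ} {z : ℂ} {E M : ℝ} {k : ℕ}
    (h : ‖fixed B a b - z‖ ≤ E) (hz : ‖z‖ ≤ M) (hk : (M + E) * B ≤ (β : ℝ) ^ k) :
    |a| ≤ (β : ℤ) ^ k ∧ |b| ≤ (β : ℤ) ^ k := by
  have h1 : ‖fixed B a b‖ ≤ M + E := by
    calc ‖fixed B a b‖ = ‖z + (fixed B a b - z)‖ := by ring_nf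
      _ ≤ M + E := (norm_add_le _ _).trans (by linarith)
  obtain ⟨h2, h3⟩ := abs_re_le_of_norm_fixed_le hB h1
  exact ⟨by exact_mod_cast h2.trans hk, by exact_mod_cast h3.trans hk⟩

theorem Runs.fftStageProg (hR : Room W β) {s : State} {K j B : ℕ} (hs : Bounded W β s)
    (hN : 2 ^ K ≤ β) (hB : 0 < B) (h4 : s.reg 4 = (2 ^ K : ℕ)) (h6 : s.reg 6 = B)
    (h18 : s.reg 18 = (2 ^ j : ℕ)) (hj : j < K) {ζ : ℂ} (hζ : ‖ζ‖ = 1) {η : ℝ} (hη : η ≤ 1)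
    (hw : RootTable B (2 ^ K) s ζ η) {x : ℕ → ℂ} {E M : ℝ}
    (hx : Holds B (2 ^ K) s (fftStage K (fun e => ζ ^ e) x j) E)
    (hM : ∀ i ≤ K, ∀ y < 2 ^ K, ‖fftStage K (fun e => ζ ^ e) x i y‖ ≤ M)
    (hk : (M + (3 * E + (η * M + 2 / B))) * B ≤ (β : ℝ) ^ 40) :
    Runs W ω fftStageProg s (2 ^ K * 250 + 100) fun s' => Bounded W β s' ∧
      SameExcept [16, 18] [6, 7, 8, 9] s s' ∧ s'.reg 18 = (2 ^ (j + 1) : ℕ) ∧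
      Holds B (2 ^ K) s' (fftStage K (fun e => ζ ^ e) x (j + 1)) (3 * E + (η * M + 2 / B)) := by
  set U : ℕ → ℕ := fun y => y / (2 * 2 ^ j) * 2 ^ j + y % 2 ^ j with hU
  set V : ℕ → ℕ := fun y => y / (2 * 2 ^ j) * 2 ^ j + y % 2 ^ j + 2 ^ K / 2 with hV
  set Z : ℕ → ℕ := fun y => y % (2 * 2 ^ j) * (2 ^ K / (2 * 2 ^ j)) with hZ
  set f : ℕ → ℤ := fun y => s.arr 6 (U y) +
    (s.arr 4 (Z y) * s.arr 6 (V y) - s.arr 5 (Z y) * s.arr 7 (V y)) / (B : ℤ) with hf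
  set g : ℕ → ℤ := fun y => s.arr 7 (U y) +
    (s.arr 4 (Z y) * s.arr 7 (V y) + s.arr 5 (Z y) * s.arr 6 (V y)) / (B : ℤ) with hg
  have hfg : ∀ y < 2 ^ K, ‖fixed B (f y) (g y) - fftStage K (fun e => ζ ^ e) x (j + 1) y‖ ≤
      3 * E + (η * M + 2 / B) := by
    intro y hy
    have hu := fft_index_lt hj hy
    have hz := fft_root_index_lt (y := y) hj
    have h2 := two_mul_half (by omega : 0 < K)
    rw [pow_succ'] at hu hz
    have hu' : U y < 2 ^ K := by simp only [hU]; omega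
    have hv' : V y < 2 ^ K := by simp only [hV]; omega
    have hz' : Z y < 2 ^ K := hz
    rw [fftStage, pow_succ']
    refine norm_butterfly_sub_le (hx _ hu') (hx _ hv') (hw _ hz') hη (by simp [hζ])
      (hM j (by omega) _ hv') ?_
    rw [hf, hg, fixed_add]
    refine le_trans (le_of_eq ?_) (norm_fixed_mul_sub_le hB (s.arr 4 (Z y)) (s.arr 5 (Z y))
      (s.arr 6 (V y)) (s.arr 7 (V y)))
    congr 1; ring
  have hfb : ∀ y < 2 ^ K, |f y| ≤ (β : ℤ) ^ 40 ∧ |g y| ≤ (β : ℤ) ^ 40 := fun y hy =>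
    abs_le_of_norm_fixed_sub_le hB (hfg y hy) (hM (j + 1) (by omega) y hy) hk
  have hL : ((2 ^ j : ℕ) : ℤ) ≠ 0 := by positivity
  have hBz : (B : ℤ) ≠ 0 := by positivity
  have h18' : (2 * 2 ^ j : ℕ) = (2 * (2 ^ j : ℕ)) := rfl
  refine Runs.mono (t := 2 ^ K * 113 + 6 + (2 ^ K * 113 + 6 + (2 ^ K * 24 + 12 + 4)))
    (Runs.seq (Runs.fill hR 16 4 8 _ 113 (2 ^ K) f hs h4 hN (fun y hy => (hfb y hy).1) ?_ ?_
      fun hs1 => Runs.seq (Runs.fill hR 16 4 9 _ 113 (2 ^ K) g hs1 (by simpa using h4) hN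
        (fun y hy => (hfb y hy).2) ?_ ?_ fun hs2 => Runs.seq ((Runs.copyBack hR hs2
          (by simpa using h4) hN ?_ ?_).mono le_rfl ?_))))
    (by omega) fun _ h => h
  · intro y _
    simp [butterflyRe, indexU, indexV, indexW, h18, h6, hB.ne']
  · intro y hy
    have e16 : (s.fill 16 8 f y).reg 16 = y := by simp
    have e18 : (s.fill 16 8 f y).reg 18 = (2 ^ j : ℕ) := by simpa using h18
    have e4 : (s.fill 16 8 f y).reg 4 = (2 ^ K : ℕ) := by simpa using h4
    simp only [butterflyRe, Expr.eval_add, Expr.eval_sub, Expr.eval_mul, Expr.eval_div,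
      Expr.eval_get, eval_indexU e16 e18, eval_indexV e16 e18 e4, eval_indexW e16 e18 e4]
    simp [h6, hf, hU, hV, hZ]
  · intro y _
    simp [butterflyIm, indexU, indexV, indexW, h18, h6, hB.ne']
  · intro y hy
    set s1 := s.fill 16 8 f (2 ^ K) with hs1'
    have e16 : (s1.fill 16 9 g y).reg 16 = y := by simp
    have e18 : (s1.fill 16 9 g y).reg 18 = (2 ^ j : ℕ) := by simpa [hs1'] using h18
    have e4 : (s1.fill 16 9 g y).reg 4 = (2 ^ K : ℕ) := by simpa [hs1'] using h4
    simp only [butterflyIm, Expr.eval_add, Expr.eval_mul, Expr.eval_div,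
      Expr.eval_get, eval_indexU e16 e18, eval_indexV e16 e18 e4, eval_indexW e16 e18 e4]
    simp [h6, hg, hU, hV, hZ, hs1']
  · intro y hy
    simpa [patch_of_lt hy] using (hfb y hy).1
  · intro y hy
    simpa [patch_of_lt hy] using (hfb y hy).2
  · rintro s' ⟨hs3, hsame, hval⟩
    have e18 : s'.reg 18 = (2 ^ j : ℕ) := by rw [hsame.reg 18 (by decide)]; simpa using h18
    have hpow : 2 ^ (j + 1) ≤ β := (Nat.pow_le_pow_right (by norm_num) hj).trans hN
    have e18' : (reg 18 * const 2).eval s' = ((2 ^ (j + 1) : ℕ) : ℤ) := by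
      simp [e18, pow_succ]
    refine Runs.assign (e := reg 18 * const 2) (hs3.fits hR rfl (by simp)) ?_
    rw [e18']
    refine ⟨hs3.setReg (by decide) ?_, ⟨fun x hx => ?_, fun a ha => ?_, ?_⟩, by simp,
      fun y hy => ?_⟩
    · simpa [regDeg] using (by exact_mod_cast hpow : ((2 : ℤ) ^ (j + 1)) ≤ β)
    · simp only [List.mem_cons, List.not_mem_nil, or_false, not_or] at hx
      simp [hx.2, hsame.reg x (by simp [hx.1]), hx.1]
    · simp only [List.mem_cons, List.not_mem_nil, or_false, not_or] at ha
      simp [hsame.arr a (by simp [ha.1, ha.2.1]), ha.2.2]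
    · simpa using hsame.coins
    · have := hval y hy
      simp only [setReg_arr, this.1, this.2]
      simpa [patch_of_lt hy] using hfg y hy

/-- A stage triples the error and adds `η * (2 ^ K * M) + 2 / B` to it, so that after all stages it
is at most `4 ^ K` times the sum of this number and the initial error. -/
theorem Runs.fftProg (hR : Room W β) {s : State} {K B : ℕ} (hs : Bounded W β s)
    (hN : 2 ^ K ≤ β) (hB : 0 < B) (h4 : s.reg 4 = (2 ^ K : ℕ)) (h6 : s.reg 6 = B)
    {ζ : ℂ} (hζ : ‖ζ‖ = 1) (hζK : ζ ^ 2 ^ K = 1) {η : ℝ} (hη0 : 0 ≤ η) (hη : η ≤ 1)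
    (hw : RootTable B (2 ^ K) s ζ η) {x : ℕ → ℂ} {E M : ℝ} (hE : 0 ≤ E) (hM0 : 0 ≤ M)
    (hx : Holds B (2 ^ K) s x E) (hM : ∀ y < 2 ^ K, ‖x y‖ ≤ M)
    (hk : (2 ^ K * M + 4 ^ K * (E + (η * (2 ^ K * M) + 2 / B))) * B ≤ (β : ℝ) ^ 40) :
    Runs W ω fftProg s (K * (2 ^ K * 250 + 104) + 6) fun s' => Bounded W β s' ∧
      SameExcept [16, 18] [6, 7, 8, 9] s s' ∧
      Holds B (2 ^ K) s' (dft (2 ^ K) ζ x) (4 ^ K * (E + (η * (2 ^ K * M) + 2 / B))) := by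
  set τ : ℝ := η * (2 ^ K * M) + 2 / B with hτ
  have hτ0 : 0 ≤ τ := by positivity
  have hMi : ∀ i ≤ K, ∀ y < 2 ^ K, ‖fftStage K (fun e => ζ ^ e) x i y‖ ≤ 2 ^ K * M := by
    intro i hi y hy
    refine (norm_fftStage_le K ζ hζ x M hM i hi y hy).trans ?_
    gcongr
    norm_num
  refine Runs.mono (t := 2 + (K * ((2 ^ K * 250 + 100) + 4) + 4)) (Runs.seq (Runs.assign
    (hs.fits hR rfl trivial) (Runs.mono (Runs.while (fun j s' => Bounded W β s' ∧
      SameExcept [16, 18] [6, 7, 8, 9] s s' ∧ s'.reg 18 = (2 ^ j : ℕ) ∧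
      Holds B (2 ^ K) s' (fftStage K (fun e => ζ ^ e) x j) (4 ^ j * (E + τ)))
      K (2 ^ K * 250 + 100) ?_ ?_ ?_ ?_ ?_) le_rfl ?_))) (by ring_nf; omega) fun _ h => h
  · rintro j - s' ⟨h1, -⟩
    exact h1.fits hR rfl (by simp)
  · rintro j hj s' ⟨-, h2, h3, -⟩
    have : s'.reg 4 = (2 ^ K : ℕ) := by rw [h2.reg 4 (by decide), h4]
    have hlt : (2 : ℤ) ^ j < 2 ^ K := pow_lt_pow_right₀ (by norm_num) hj
    simp [this, h3, hlt]
  · rintro s' ⟨-, h2, h3, -⟩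
    have : s'.reg 4 = (2 ^ K : ℕ) := by rw [h2.reg 4 (by decide), h4]
    simp [this, h3]
  · rintro j hj s' ⟨h1, h2, h3, h5⟩
    have hstep : 3 * (4 ^ j * (E + τ)) + τ ≤ 4 ^ (j + 1) * (E + τ) := by
      have : (1 : ℝ) ≤ 4 ^ j := one_le_pow₀ (by norm_num)
      rw [pow_succ]; nlinarith
    have hpow : (4 : ℝ) ^ (j + 1) ≤ 4 ^ K := pow_le_pow_right₀ (by norm_num) hj
    have hw' : RootTable B (2 ^ K) s' ζ η := by
      intro e he
      rw [h2.arr 4 (by decide), h2.arr 5 (by decide)]; exact hw e he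
    refine (Runs.fftStageProg hR h1 hN hB (by rw [h2.reg 4 (by decide), h4])
      (by rw [h2.reg 6 (by decide), h6]) h3 hj hζ hη hw' h5 hMi ?_).mono le_rfl ?_
    · refine le_trans ?_ hk
      gcongr
      exact hstep.trans (by gcongr)
    · rintro s'' ⟨g1, g2, g3, g4⟩
      exact ⟨g1, h2.trans g2, g3, fun y hy => (g4 y hy).trans hstep⟩
  · refine ⟨hs.setReg (by decide) (by simp [regDeg]; have := hR.four_le; omega), ⟨fun x hx => ?_,
      fun a _ => rfl, rfl⟩, by simp, ?_⟩
    · simp only [List.mem_cons, List.not_mem_nil, or_false, not_or] at hx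
      simp [hx.2]
    · intro y hy
      have := hx y hy
      simp only [fftStage, setReg_arr, pow_zero, one_mul]
      linarith
  · rintro s' ⟨h1, h2, -, h4⟩
    refine ⟨h1, h2, fun y hy => ?_⟩
    rw [← fftStage_self K ζ hζK x hy]
    exact h4 y hy

theorem Runs.squareProg (hR : Room W β) {s : State} {N B : ℕ} (hs : Bounded W β s)
    (hN : N ≤ β) (hB : 0 < B) (h4 : s.reg 4 = N) (h6 : s.reg 6 = B) {x : ℕ → ℂ} {E M : ℝ}
    (hE : 0 ≤ E) (hx : Holds B N s x E) (hM : ∀ y < N, ‖x y‖ ≤ M)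
    (hk : (M * M + (E * (2 * M + E) + 2 / B)) * B ≤ (β : ℝ) ^ 40) :
    Runs W ω squareProg s (N * 100 + 30) fun s' => Bounded W β s' ∧
      SameExcept [16] [6, 7, 8, 9] s s' ∧
      Holds B N s' (fun y => x y * x y) (E * (2 * M + E) + 2 / B) := by
  set f : ℕ → ℤ := fun y => (s.arr 6 y * s.arr 6 y - s.arr 7 y * s.arr 7 y) / (B : ℤ) with hf
  set g : ℕ → ℤ := fun y => (s.arr 6 y * s.arr 7 y + s.arr 7 y * s.arr 6 y) / (B : ℤ) with hg
  have hfg : ∀ y < N, ‖fixed B (f y) (g y) - x y * x y‖ ≤ E * (2 * M + E) + 2 / B := by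
    intro y hy
    have h1 := norm_fixed_mul_sub_le hB (s.arr 6 y) (s.arr 7 y) (s.arr 6 y) (s.arr 7 y)
    set z := fixed B (s.arr 6 y) (s.arr 7 y)
    have h2 : ‖z - x y‖ ≤ E := hx y hy
    have h3 := hM y hy
    have h4 : ‖z * z - x y * x y‖ ≤ E * (2 * M + E) := by
      rw [show z * z - x y * x y = (z - x y) * (2 * x y + (z - x y)) by ring, norm_mul]
      have : ‖2 * x y + (z - x y)‖ ≤ 2 * M + E := by
        refine (norm_add_le _ _).trans ?_
        rw [norm_mul, Complex.norm_ofNat]; linarith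
      gcongr
    calc _ = ‖(fixed B (f y) (g y) - z * z) + (z * z - x y * x y)‖ := by ring_nf
      _ ≤ 2 / B + E * (2 * M + E) := (norm_add_le _ _).trans (add_le_add h1 h4)
      _ = _ := by ring
  have hfb : ∀ y < N, |f y| ≤ (β : ℤ) ^ 40 ∧ |g y| ≤ (β : ℤ) ^ 40 := fun y hy =>
    abs_le_of_norm_fixed_sub_le hB (hfg y hy)
      (by rw [norm_mul]; exact mul_self_le_mul_self (norm_nonneg _) (hM y hy)) hk
  refine Runs.mono (t := N * 30 + 6 + (N * 30 + 6 + (N * 24 + 12)))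
    (Runs.seq (Runs.fill hR 16 4 8 _ 30 N f hs h4 hN (fun y hy => (hfb y hy).1) ?_ ?_
      fun hs1 => Runs.seq (Runs.fill hR 16 4 9 _ 30 N g hs1 (by simpa using h4) hN
        (fun y hy => (hfb y hy).2) ?_ ?_ fun hs2 => ((Runs.copyBack hR hs2
          (by simpa using h4) hN ?_ ?_).mono le_rfl ?_))))
    (by omega) fun _ h => h
  · intro y _; simp [h6, hB.ne']
  · intro y _; simp [h6, hf]
  · intro y _; simp [h6, hB.ne']
  · intro y _; simp [h6, hg]
  · intro y hy
    simpa [patch_of_lt hy] using (hfb y hy).1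
  · intro y hy
    simpa [patch_of_lt hy] using (hfb y hy).2
  · rintro s' ⟨hs3, hsame, hval⟩
    refine ⟨hs3, ⟨fun x hx => ?_, fun a ha => ?_, ?_⟩, fun y hy => ?_⟩
    · simp [hsame.reg x hx, (by simpa using hx : x ≠ 16)]
    · simp only [List.mem_cons, List.not_mem_nil, or_false, not_or] at ha
      simp [hsame.arr a (by simp [ha.1, ha.2.1]), ha.2.2]
    · simpa using hsame.coins
    · have := hval y hy
      simp only [this.1, this.2]
      simpa [patch_of_lt hy] using hfg y hy

/-! ### Assignments -/

theorem Runs.assign_of_bounded (hR : Room W β) {s : State} (x : ℕ) (e : Expr) (t : ℕ) (v : ℤ)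
    (hs : Bounded W β s) (hq : e.DivOK s) (hv : e.eval s = v) (hb : |v| ≤ (β : ℤ) ^ regDeg x)
    {Q : State → Prop} (hQ : Bounded W β (s.setReg x v) → Q (s.setReg x v))
    (hd : e.degOK = true := by decide) (hx : regDeg x < degLimit := by decide)
    (ht : e.cost + 1 ≤ t := by decide) : Runs W ω (.assign x e) s t Q := by
  refine (Runs.assign (hs.fits hR hd hq) ?_).mono ht fun _ h => h
  rw [hv]
  exact hQ (hs.setReg hx hb)

theorem SameExcept.setReg {rs as : List ℕ} {s s' : State} (h : SameExcept rs as s s') {x : ℕ}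
    {v : ℤ} (hx : x ∈ rs := by decide) : SameExcept rs as s (s'.setReg x v) where
  reg y hy := by
    have : y ≠ x := fun e => hy (e ▸ hx)
    simp [this, h.reg y hy]
  arr := h.arr
  coins := h.coins

/-! ### The parameters of the algorithm -/

/-- Computes `N = 2 ^ K > n` in register `4`, `K` in `5`, the scale `N ^ 32` of the fixed-point
numbers in `6`, the number of rounds in `7` and `n - m + 1` in `8`. -/
def sizesProg (K₀ : ℕ) : Prog :=
  .seq (.assign 3 (const K₀)) <| .seq (.assign 4 (const 4)) <| .seq (.assign 5 (const 2)) <|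
  .seq (.while (less (reg 4) (reg 0 + const 1))
    (.seq (.assign 4 (reg 4 * const 2)) (.assign 5 (reg 5 + const 1)))) <|
  .seq (.assign 6 (reg 4)) <| .seq (.assign 6 (reg 6 * reg 6)) <|
  .seq (.assign 6 (reg 6 * reg 6)) <| .seq (.assign 6 (reg 6 * reg 6)) <|
  .seq (.assign 6 (reg 6 * reg 6)) <| .seq (.assign 6 (reg 6 * reg 6)) <|
  .seq (.assign 7 (reg 3 * (reg 2 * reg 2) * reg 5)) (.assign 8 (reg 0 - reg 1 + const 1))

/-- The logarithm of the length of the transforms for a text of length `n`. -/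
def logLen (n : ℕ) : ℕ := Nat.clog 2 (n + 1)

theorem lt_two_pow_logLen (n : ℕ) : n < 2 ^ logLen n :=
  Nat.lt_of_succ_le (Nat.le_pow_clog (by norm_num) (n + 1))

theorem two_pow_le_of_lt_logLen {n j : ℕ} (h : j < logLen n) : 2 ^ j ≤ n := by
  by_contra hlt
  exact absurd (Nat.clog_le_of_le_pow (by omega : n + 1 ≤ 2 ^ j)) (by unfold logLen at h; omega)

theorem two_le_logLen {n : ℕ} (hn : 2 ≤ n) : 2 ≤ logLen n := by
  by_contra h
  have h1 := lt_two_pow_logLen n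
  have h2 : 2 ^ logLen n ≤ 2 ^ 1 := Nat.pow_le_pow_right (by norm_num) (by omega)
  omega

theorem two_pow_logLen_le {n : ℕ} (hn : 2 ≤ n) : 2 ^ logLen n ≤ 2 * n := by
  have h := two_le_logLen hn
  have h1 := two_pow_le_of_lt_logLen (by omega : logLen n - 1 < logLen n)
  rw [show logLen n = logLen n - 1 + 1 by omega, pow_succ]
  omega

theorem Runs.sizesProg (hR : Room W β) {s : State} {n m q K₀ : ℕ} (hs : Bounded W β s) (hn : 2 ≤ n)
    (hm : 1 ≤ m) (hmn : m ≤ n) (h0 : s.reg 0 = n) (h1 : s.reg 1 = m) (h2 : s.reg 2 = q)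
    (hnβ : 2 * n ≤ β) (hqβ : q ≤ β) (hK₀ : K₀ ≤ β) :
    Runs W ω (sizesProg K₀) s (logLen n * 14 + 60) fun s' => Bounded W β s' ∧
      SameExcept [3, 4, 5, 6, 7, 8] [] s s' ∧ s'.reg 4 = (2 ^ logLen n : ℕ) ∧
      s'.reg 5 = logLen n ∧ s'.reg 6 = ((2 ^ logLen n) ^ 32 : ℕ) ∧
      s'.reg 7 = (K₀ * (q * q) * logLen n : ℕ) ∧ s'.reg 8 = (n - m + 1 : ℕ) := by
  have hβ := hR.four_le
  have hK := two_le_logLen hn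
  have hNβ := (two_pow_logLen_le hn).trans hnβ
  have hKβ : logLen n ≤ β := (Nat.lt_two_pow_self).le.trans hNβ
  set K := logLen n with hKdef
  have pw : ∀ k : ℕ, ((2 ^ K) ^ k : ℕ) ≤ β ^ k := fun k => Nat.pow_le_pow_left hNβ k
  have pw' : ∀ {k l : ℕ}, k ≤ l → ((2 ^ K) ^ k : ℕ) ≤ β ^ l := fun h =>
    (pw _).trans (Nat.pow_le_pow_right (by omega) h)
  have hK₀W : K₀ ≤ W := hK₀.trans hR.le
  refine Runs.mono (t := 2 + (2 + (2 + (((K - 2) * (8 + 6) + 6) + (2 + (4 + (4 + (4 + (4 + (4 +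
    (8 + 6))))))))))) ?_ (by omega) fun _ h => h
  refine Runs.seq (Runs.assign (by simp [Expr.Fits, hK₀W]) ?_)
  have hs0 : Bounded W β (s.setReg 3 K₀) := hs.setReg (by decide) (by simpa [regDeg] using hK₀)
  refine Runs.seq (Runs.assign_of_bounded hR 4 _ 2 4 hs0
      (by simp) (by simp) (by simpa [regDeg] using (by omega : 4 ≤ β)) fun hs1 => ?_)
  refine Runs.seq (Runs.assign_of_bounded hR 5 _ 2 2 hs1
      (by simp) (by simp) (by simpa [regDeg] using (by omega : 2 ≤ β)) fun hs2 => ?_)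
  refine Runs.seq (Runs.mono (Runs.while (fun j s' =>
        Bounded W β s' ∧ SameExcept [3, 4, 5] [] s s' ∧ s'.reg 3 = K₀ ∧
        s'.reg 4 = (2 ^ (j + 2) : ℕ) ∧ s'.reg 5 = (j + 2 : ℕ)) (K - 2) 8
        ?_ ?_ ?_ ?_ ?_) le_rfl ?_)
  · rintro j - s' ⟨h, -⟩
    exact h.fits hR (by decide) (by simp)
  · rintro j hj s' ⟨-, h, -, h4, -⟩
    have := two_pow_le_of_lt_logLen (by omega : j + 2 < logLen n)
    have h0' : s'.reg 0 = n := by rw [h.reg 0 (by decide), h0]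
    have : (2 : ℤ) ^ (j + 2) < n + 1 := by exact_mod_cast (by omega : 2 ^ (j + 2) < n + 1)
    simp [h4, h0', this]
  · rintro s' ⟨-, h, -, h4, -⟩
    have := lt_two_pow_logLen n
    have h0' : s'.reg 0 = n := by rw [h.reg 0 (by decide), h0]
    have : ¬ (2 : ℤ) ^ K < n + 1 := by
      have : (n : ℤ) < 2 ^ K := by exact_mod_cast this
      omega
    simp only [Expr.eval_less, Expr.eval_reg, h4, Expr.eval_add, h0', Expr.eval_const,
      show K - 2 + 2 = K by omega]
    push_cast
    simp [this]
  · rintro j hj s' ⟨h, h', h3, h4, h5⟩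
    have hp : 2 ^ (j + 1 + 2) ≤ β := (Nat.pow_le_pow_right (by norm_num) (by omega)).trans hNβ
    refine Runs.seq (t₁ := 4) (t₂ := 4) (Runs.assign_of_bounded hR 4 _ 4
      (2 ^ (j + 1 + 2) : ℕ) h (by simp) (by simp [h4, pow_succ])
      (by simpa [regDeg] using (by exact_mod_cast hp : (2 : ℤ) ^ (j + 1 + 2) ≤ β)) fun hs3 =>
      Runs.assign_of_bounded hR 5 _ 4 (j + 1 + 2 : ℕ) hs3 (by simp)
      (by simp [h5]; ring) ?_ fun hs4 => ⟨hs4, h'.setReg.setReg, by simp [h3], by simp, by simp⟩)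
    have : j + 1 + 2 ≤ β := by omega
    simp only [regDeg, pow_one, Nat.abs_cast]
    exact_mod_cast this
  · refine ⟨hs2, ?_, by simp, by simp, by simp⟩
    exact (SameExcept.refl _ _ s).setReg.setReg.setReg
  rintro s' ⟨hs3, hsame, h3, h4, h5⟩
  rw [show K - 2 + 2 = K by omega] at h4 h5
  have key : ∀ {k l : ℕ}, k ≤ l → |(((2 ^ K) ^ k : ℕ) : ℤ)| ≤ (β : ℤ) ^ l := by
    intro k l h
    rw [Nat.abs_cast]; exact_mod_cast pw' h
  have h0' : s'.reg 0 = n := by rw [hsame.reg 0 (by decide), h0]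
  have h1' : s'.reg 1 = m := by rw [hsame.reg 1 (by decide), h1]
  have h2' : s'.reg 2 = q := by rw [hsame.reg 2 (by decide), h2]
  refine Runs.seq (Runs.assign_of_bounded hR 6 _ 2 ((2 ^ K) ^ 1 : ℕ) hs3 (by simp)
    (by simp [h4]) (key (by decide)) fun hs4 => ?_)
  refine Runs.seq (Runs.assign_of_bounded hR 6 _ 4 ((2 ^ K) ^ 2 : ℕ) hs4 (by simp)
    (by simp; ring) (key (by decide)) fun hs5 => ?_)
  refine Runs.seq (Runs.assign_of_bounded hR 6 _ 4 ((2 ^ K) ^ 4 : ℕ) hs5 (by simp)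
    (by simp; ring) (key (by decide)) fun hs6 => ?_)
  refine Runs.seq (Runs.assign_of_bounded hR 6 _ 4 ((2 ^ K) ^ 8 : ℕ) hs6 (by simp)
    (by simp; ring) (key (by decide)) fun hs7 => ?_)
  refine Runs.seq (Runs.assign_of_bounded hR 6 _ 4 ((2 ^ K) ^ 16 : ℕ) hs7 (by simp)
    (by simp; ring) (key (by decide)) fun hs8 => ?_)
  refine Runs.seq (Runs.assign_of_bounded hR 6 _ 4 ((2 ^ K) ^ 32 : ℕ) hs8 (by simp)
    (by simp; ring) (key (by decide)) fun hs9 => ?_)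
  refine Runs.seq (Runs.assign_of_bounded hR 7 _ 8 (K₀ * (q * q) * K : ℕ) hs9 (by simp)
    (by simp [h3, h2', h5]) ?_ fun hs10 => ?_)
  · rw [Nat.abs_cast]
    have : K₀ * (q * q) * K ≤ β ^ 4 := by
      calc K₀ * (q * q) * K ≤ β * (β * β) * β := by gcongr
        _ = β ^ 4 := by ring
    exact_mod_cast this
  refine Runs.assign_of_bounded hR 8 _ 6 (n - m + 1 : ℕ) hs10 (by simp)
    (by simp [h0', h1', Nat.cast_sub hmn]) ?_ fun hs11 => ?_
  · rw [Nat.abs_cast, show regDeg 8 = 1 from rfl, pow_one]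
    exact_mod_cast (by omega : n - m + 1 ≤ β)
  refine ⟨hs11, ?_, by simp [h4], by simp [h5], by simp, by simp, by simp⟩
  exact (hsame.mono (by decide) (by decide)).setReg.setReg.setReg.setReg.setReg.setReg.setReg.setReg

/-! ### Integer square roots -/

/-- Integer square root of register `11`, binary digit by binary digit, in register `12`. -/
def sqrtProg : Prog :=
  .seq (.assign 12 (const 0)) <| .seq (.assign 13 (const 2 * reg 6)) <|
  .while (less (const 0) (reg 13)) <|
  .seq (.ite (less (reg 11) ((reg 12 + reg 13) * (reg 12 + reg 13))) .skip
    (.assign 12 (reg 12 + reg 13))) (.assign 13 (reg 13 / const 2))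

theorem Runs.sqrtProg (hR : Room W β) {s : State} {b x : ℕ} (hs : Bounded W β s)
    (h6 : s.reg 6 = (2 ^ b : ℕ)) (hb : 4 * 2 ^ b ≤ β ^ 33) (h11 : s.reg 11 = x)
    (hx : x < (4 * 2 ^ b) ^ 2) :
    Runs W ω sqrtProg s ((b + 2) * 24 + 10) fun s' => Bounded W β s' ∧
      SameExcept [12, 13] [] s s' ∧ ∃ r : ℕ, s'.reg 12 = r ∧ r ^ 2 ≤ x ∧ x < (r + 1) ^ 2 := by
  have hb' : (4 * 2 ^ b : ℤ) ≤ (β : ℤ) ^ 33 := by exact_mod_cast hb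
  have h2b : (0 : ℤ) < 2 ^ b := by positivity
  refine Runs.mono (t := 2 + (4 + ((b + 2) * (20 + 4) + 4)))
    (Runs.seq (Runs.assign_of_bounded hR 12 _ 2 0 hs (by simp) (by simp) (by simp) fun hs1 =>
    Runs.seq (Runs.assign_of_bounded hR 13 _ 4 (2 * 2 ^ b) hs1 (by simp)
    (by simp [h6]) (by simp only [regDeg]; rw [abs_of_nonneg (by positivity)]; linarith)
    fun hs2 => ?_)))
    (by omega) fun _ h => h
  -- before round `j` the root is known up to `2 ^ (b + 2 - j)`
  refine (Runs.while (fun j s' => Bounded W β s' ∧ SameExcept [12, 13] [] s s' ∧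
    s'.reg 13 = (2 ^ (b + 2 - j) / 2 : ℕ) ∧
    ∃ r : ℕ, s'.reg 12 = r ∧ r ^ 2 ≤ x ∧ x < (r + 2 ^ (b + 2 - j)) ^ 2) (b + 2) 20
    ?_ ?_ ?_ ?_ ?_).mono le_rfl ?_
  · rintro j - s' ⟨h, -⟩
    exact h.fits hR (by decide) (by simp)
  · rintro j hj s' ⟨-, -, h, -⟩
    rw [show b + 2 - j = b + 1 - j + 1 by omega, pow_succ, Nat.mul_div_cancel _ (by norm_num)] at h
    simp [h]
  · rintro s' ⟨-, -, h, -⟩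
    simp [h]
  · rintro j hj s' ⟨hs3, hsame, h13, r, h12, hr1, hr2⟩
    have e1 : b + 2 - j = b + 2 - (j + 1) + 1 := by omega
    rw [e1, pow_succ, Nat.mul_div_cancel _ (by norm_num)] at h13
    rw [e1, pow_succ] at hr2
    set d := 2 ^ (b + 2 - (j + 1)) with hd
    have hdb : d ≤ 2 * 2 ^ b := by
      rw [hd, ← pow_succ']; exact Nat.pow_le_pow_right (by norm_num) (by omega)
    have h11' : s'.reg 11 = x := by rw [hsame.reg 11 (by decide), h11]
    refine Runs.seq (t₁ := 16) (t₂ := 4) (Q := _) ?_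
    have fin : ∀ (s'' : State) (r' : ℕ), Bounded W β s'' → SameExcept [12, 13] [] s s'' →
        s''.reg 13 = d → s''.reg 12 = r' → r' ^ 2 ≤ x → x < (r' + d) ^ 2 →
        Runs W ω (.assign 13 (reg 13 / const 2)) s'' 4 fun s' => Bounded W β s' ∧
        SameExcept [12, 13] [] s s' ∧ s'.reg 13 = (d / 2 : ℕ) ∧
        ∃ r : ℕ, s'.reg 12 = r ∧ r ^ 2 ≤ x ∧ x < (r + d) ^ 2 := by
      intro s'' r' g1 g2 g3 g4 g5 g6
      refine Runs.assign_of_bounded hR 13 _ 4 (d / 2 : ℕ) g1 (by simp) (by simp [g3]) ?_ fun g7 =>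
        ⟨g7, g2.setReg, by simp, r', by simp [g4], g5, g6⟩
      rw [Nat.abs_cast]
      exact_mod_cast (by omega : d / 2 ≤ β ^ 33)
    refine (Runs.ite (t := 4) (hs3.fits hR (by decide) (by simp)) (fun hlt => ?_)
      (fun hge => ?_)).mono (by decide) fun _ h => h
    · refine (Runs.skip ?_).mono (by norm_num) fun _ h => h
      refine fin s' r hs3 hsame h13 h12 hr1 ?_
      by_contra hcon
      refine hlt ?_
      have : ¬ (x : ℤ) < (r + d) * (r + d) := by
        rw [← sq]; exact_mod_cast hcon
      simp [h11', h12, h13, this]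
    · have hle : (r + d) ^ 2 ≤ x := by
        by_contra hcon
        have : (x : ℤ) < (r + d) * (r + d) := by
          rw [← sq]; exact_mod_cast (by omega : x < (r + d) ^ 2)
        simp [h11', h12, h13, this] at hge
      have hlt : r + d < 4 * 2 ^ b := lt_of_pow_lt_pow_left₀ 2 (by positivity) (hle.trans_lt hx)
      refine Runs.assign_of_bounded hR 12 _ 4 (r + d : ℕ) hs3 (by simp) (by simp [h12, h13]) ?_
        fun hs4 => fin _ (r + d) hs4 hsame.setReg
          (by simp [h13]) (by simp) hle (by convert hr2 using 2; ring)
      rw [Nat.abs_cast]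
      exact_mod_cast (by omega : r + d ≤ β ^ 33)
  · refine ⟨hs2, (SameExcept.refl _ _ s).setReg.setReg,
      ?_, 0, by simp, by simp, ?_⟩
    · rw [Nat.sub_zero, pow_succ, Nat.mul_div_cancel _ (by norm_num)]
      simp [pow_succ, mul_comm]
    · rw [Nat.sub_zero, zero_add, pow_add, mul_comm]; exact hx
  · rintro s' ⟨g1, g2, -, r, g3, g4, g5⟩
    exact ⟨g1, g2, r, g3, g4, by simpa using g5⟩

/-! ### The table of roots of unity -/

/-- The root of unity of order `2 ^ K`. -/
noncomputable def rootOfUnity (K : ℕ) : ℂ := Complex.exp (2 * Real.pi * Complex.I / (2 ^ K : ℕ))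

theorem isPrimitiveRoot_rootOfUnity (K : ℕ) : IsPrimitiveRoot (rootOfUnity K) (2 ^ K) :=
  Complex.isPrimitiveRoot_exp _ (by positivity)

theorem norm_rootOfUnity (K : ℕ) : ‖rootOfUnity K‖ = 1 :=
  (isPrimitiveRoot_rootOfUnity K).norm'_eq_one (by positivity)

/-- The half-angle formula, iterated, gives the root of unity by square roots. -/
theorem rootOfUnity_re_im {K : ℕ} (hK : 2 ≤ K) :
    rootOfUnity K = ⟨Real.sqrtTwoAddSeries 0 (K - 2) / 2,
      √(4 - Real.sqrtTwoAddSeries 0 (K - 2) ^ 2) / 2⟩ := by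
  set θ : ℝ := Real.pi / 2 ^ (K - 2 + 1) with hθ
  have h1 : Real.cos θ = Real.sqrtTwoAddSeries 0 (K - 2) / 2 := Real.cos_pi_over_two_pow _
  have h2 : rootOfUnity K = Complex.exp (θ * Complex.I) := by
    have hp : (2 : ℂ) ^ K = 2 * 2 ^ (K - 2 + 1) := by
      rw [← pow_succ']; congr 1; omega
    rw [rootOfUnity, hθ]; push_cast
    rw [hp]; congr 1; field_simp
  have h3 : 0 ≤ Real.sin θ := by
    refine Real.sin_nonneg_of_nonneg_of_le_pi (by positivity) (div_le_self Real.pi_pos.le ?_)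
    exact one_le_pow₀ (by norm_num)
  have h4 : √(4 - Real.sqrtTwoAddSeries 0 (K - 2) ^ 2) = 2 * Real.sin θ := by
    rw [show (4 : ℝ) - Real.sqrtTwoAddSeries 0 (K - 2) ^ 2 = (2 * Real.sin θ) ^ 2 by
      have := Real.sin_sq_add_cos_sq θ
      rw [h1] at this; linarith, Real.sqrt_sq (by positivity)]
  rw [h2]
  apply Complex.ext
  · simp [Complex.exp_ofReal_mul_I_re, h1]
  · simp only [Complex.exp_ofReal_mul_I_im, h4]; ring

/-- With the scale `N ^ 32`, where `N = 2 ^ K`, the cosine is found up to about `N ^ (-31)`, and the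
sine still up to about `N ^ (-15)`. -/
theorem norm_fixed_sub_rootOfUnity_le {K C r : ℕ} (hK : 2 ≤ K) {B : ℕ} (hB : B = (2 ^ K) ^ 32)
    (hC : C ≤ 2 * B) (hc : |(C : ℝ) - B * Real.sqrtTwoAddSeries 0 (K - 2)| ≤ K)
    (h1 : r ^ 2 ≤ 4 * B ^ 2 - C ^ 2) (h2 : 4 * B ^ 2 - C ^ 2 < (r + 1) ^ 2) :
    ‖fixed B ((C : ℤ) / 2) ((r : ℤ) / 2) - rootOfUnity K‖ ≤ 1 / ((2 ^ K : ℕ) : ℝ) ^ 13 := by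
  rw [rootOfUnity_re_im hK]
  set c := Real.sqrtTwoAddSeries 0 (K - 2) with hcdef
  have hc0 : 0 ≤ c := Real.sqrtTwoAddSeries_zero_nonneg _
  have hc2 : c ≤ 2 := (Real.sqrtTwoAddSeries_lt_two _).le
  have hCB : C ^ 2 ≤ 4 * B ^ 2 := by
    calc C ^ 2 ≤ (2 * B) ^ 2 := Nat.pow_le_pow_left hC 2
      _ = 4 * B ^ 2 := by ring
  have hs := abs_sub_sqrt_four_sub_le (r := r) hc0 hc2 (Nat.cast_nonneg C) (by exact_mod_cast hC)
    hc (by rw [← Nat.cast_pow C, ← Nat.cast_pow B]; exact_mod_cast h1.trans (by omega)) (by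
      have : 4 * B ^ 2 < (r + 1) ^ 2 + C ^ 2 := by omega
      have : (4 * B ^ 2 : ℝ) < (r + 1) ^ 2 + C ^ 2 := by exact_mod_cast this
      linarith)
  set N : ℝ := ((2 ^ K : ℕ) : ℝ) with hN
  have hN4 : (4 : ℝ) ≤ N := by
    have : 2 ^ 2 ≤ 2 ^ K := Nat.pow_le_pow_right (by norm_num) hK
    rw [hN]; exact_mod_cast this
  have hKN : (K : ℝ) ≤ N := by
    rw [hN]; exact_mod_cast Nat.lt_two_pow_self.le
  have hBN : (B : ℝ) = N ^ 32 := by rw [hB, hN]; push_cast; rfl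
  have hB0 : (0 : ℝ) < B := by rw [hBN]; positivity
  have hsq : √(K * B) ≤ N ^ 17 := by
    refine Real.sqrt_le_iff.2 ⟨by positivity, ?_⟩
    rw [hBN]
    calc (K : ℝ) * N ^ 32 ≤ N * N ^ 32 := by gcongr
      _ ≤ N * N ^ 32 * N := le_mul_of_one_le_right (by positivity) (by linarith)
      _ = (N ^ 17) ^ 2 := by ring
  have d1 := abs_ediv_sub_le (B := 2) (by norm_num) (C : ℤ)
  have d2 := abs_ediv_sub_le (B := 2) (by norm_num) (r : ℤ)
  push_cast at d1 d2
  refine (Complex.norm_le_abs_re_add_abs_im _).trans ?_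
  simp only [fixed, Complex.sub_re, Complex.sub_im]
  set p : ℝ := (((C : ℤ) / 2 : ℤ) : ℝ) with hp
  set q : ℝ := (((r : ℤ) / 2 : ℤ) : ℝ) with hq
  have e1 : |p / B - c / 2| ≤ (1 + K / 2) / B := by
    rw [show p / B - c / 2 = (p - B * c / 2) / B by field_simp, abs_div, abs_of_pos hB0]
    gcongr
    rw [abs_le] at d1 hc ⊢
    constructor <;> linarith [d1.1, d1.2, hc.1, hc.2]
  have e2 : |q / B - √(4 - c ^ 2) / 2| ≤ (3 / 2 + √(K * B)) / B := by
    rw [show q / B - √(4 - c ^ 2) / 2 = (q - B * √(4 - c ^ 2) / 2) / B by field_simp, abs_div,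
      abs_of_pos hB0]
    gcongr
    rw [abs_le] at d2 hs ⊢
    constructor <;> linarith [d2.1, d2.2, hs.1, hs.2]
  refine (add_le_add e1 e2).trans ?_
  rw [← add_div, div_le_div_iff₀ hB0 (by positivity), one_mul, hBN]
  have hN17 : N ≤ N ^ 17 := le_self_pow₀ (by linarith) (by norm_num)
  calc (1 + K / 2 + (3 / 2 + √(K * N ^ 32))) * N ^ 13 ≤ (N ^ 17 * N ^ 2) * N ^ 13 := by
        gcongr
        rw [← hBN]
        have : N ^ 17 * 16 ≤ N ^ 17 * N ^ 2 := by gcongr; nlinarith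
        linarith
    _ = N ^ 32 := by ring

/-- Computes the root of unity of order `N`: real part in register `9`, imaginary part in `14`. The
loop computes `2 cos (2 π / N)` by the half-angle formula, starting from `2 cos (π / 2) = 0`. -/
def rootProg : Prog :=
  .seq (.assign 9 (const 0)) <| .seq (.assign 10 (const 2)) <|
  .seq (.while (less (reg 10) (reg 5))
    (.seq (.assign 11 (const 2 * (reg 6 * reg 6) + reg 6 * reg 9)) <| .seq sqrtProg <|
    .seq (.assign 9 (reg 12)) (.assign 10 (reg 10 + const 1)))) <|
  .seq (.assign 11 (const 4 * (reg 6 * reg 6) - reg 9 * reg 9)) <| .seq sqrtProg <|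
  .seq (.assign 14 (reg 12 / const 2)) (.assign 9 (reg 9 / const 2))

theorem Runs.rootProg (hR : Room W β) {s : State} {K B : ℕ} (hs : Bounded W β s) (hK : 2 ≤ K)
    (hN : 2 ^ K ≤ β) (hB : B = (2 ^ K) ^ 32) (h5 : s.reg 5 = K) (h6 : s.reg 6 = B) :
    Runs W ω rootProg s (K * (K * 800 + 200)) fun s' => Bounded W β s' ∧
      SameExcept [9, 10, 11, 12, 13, 14] [] s s' ∧
      ‖fixed B (s'.reg 9) (s'.reg 14) - rootOfUnity K‖ ≤ 1 / ((2 ^ K : ℕ) : ℝ) ^ 13 := by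
  have hβ := hR.four_le
  have hBpow : B = 2 ^ (K * 32) := by rw [hB, ← pow_mul]
  have hB0 : 0 < B := by rw [hBpow]; positivity
  have hBβ : B ≤ β ^ 32 := by rw [hB]; exact Nat.pow_le_pow_left hN 32
  have h4B : 4 * B ≤ β ^ 33 := by
    calc 4 * B ≤ β * β ^ 32 := Nat.mul_le_mul hβ hBβ
      _ = β ^ 33 := by ring
  have h4B2 : 4 * B ^ 2 ≤ β ^ 66 := by
    calc 4 * B ^ 2 ≤ β * (β ^ 32) ^ 2 := Nat.mul_le_mul hβ (Nat.pow_le_pow_left hBβ 2)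
      _ = β ^ 65 := by ring
      _ ≤ β ^ 66 := Nat.pow_le_pow_right (by omega) (by norm_num)
  have hB16 : 4 * B ^ 2 < (4 * B) ^ 2 := by
    have : 0 < B ^ 2 := by positivity
    calc 4 * B ^ 2 < 16 * B ^ 2 := by omega
      _ = (4 * B) ^ 2 := by ring
  have hKβ : K ≤ β := Nat.lt_two_pow_self.le.trans hN
  have small : ∀ {v k : ℕ}, v ≤ β ^ k → |((v : ℕ) : ℤ)| ≤ (β : ℤ) ^ k := by
    intro v k h
    rw [Nat.abs_cast]; exact_mod_cast h
  refine Runs.mono (t := 2 + (2 + (((K - 2) *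
    ((10 + (((K * 32 + 2) * 24 + 10) + (2 + 4))) + 4) + 4) +
    (10 + (((K * 32 + 2) * 24 + 10) + (4 + 4)))))) ?_ ?_ fun _ h => h
  swap
  · obtain ⟨k, rfl⟩ := Nat.exists_eq_add_of_le hK
    rw [show 2 + k - 2 = k by omega]
    ring_nf
    nlinarith
  refine Runs.seq (Runs.assign_of_bounded hR 9 _ 2 0 hs (by simp) (by simp) (by simp) fun hs1 => ?_)
  refine Runs.seq (Runs.assign_of_bounded hR 10 _ 2 2 hs1 (by simp) (by simp)
    (by simpa [regDeg] using (by omega : 2 ≤ β)) fun hs2 => ?_)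
  refine Runs.seq (Runs.mono (Runs.while (fun j s' => Bounded W β s' ∧
    SameExcept [9, 10, 11, 12, 13, 14] [] s s' ∧ s'.reg 10 = (j + 2 : ℕ) ∧
    ∃ C : ℕ, s'.reg 9 = C ∧ C ≤ 2 * B ∧ |(C : ℝ) - B * Real.sqrtTwoAddSeries 0 j| ≤ j) (K - 2)
    (10 + (((K * 32 + 2) * 24 + 10) + (2 + 4))) ?_ ?_ ?_ ?_ ?_) le_rfl ?_)
  · rintro j - s' ⟨h, -⟩
    exact h.fits hR (by decide) (by simp)
  · rintro j hj s' ⟨-, h, h10, -⟩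
    have h5' : s'.reg 5 = K := by rw [h.reg 5 (by decide), h5]
    have : (j : ℤ) + 2 < K := by exact_mod_cast (by omega : j + 2 < K)
    simp [h10, h5', this]
  · rintro s' ⟨-, h, h10, -⟩
    have h5' : s'.reg 5 = K := by rw [h.reg 5 (by decide), h5]
    simp [h10, h5', show ((K - 2 : ℕ) : ℤ) = K - 2 by omega]
  · rintro j hj s' ⟨hs3, hsame, h10, C, h9, hC, hcos⟩
    have h6' : s'.reg 6 = B := by rw [hsame.reg 6 (by decide), h6]
    have hx : 2 * (B * B) + B * C ≤ 4 * B ^ 2 := by nlinarith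
    refine Runs.seq (Runs.assign_of_bounded hR 11 _ 10 (2 * (B * B) + B * C : ℕ) hs3 (by simp)
      (by simp [h6', h9]) (small (hx.trans h4B2)) fun hs4 => ?_)
    refine Runs.seq ((Runs.sqrtProg hR (b := K * 32) (x := 2 * (B * B) + B * C) hs4
      (by simp [h6', hBpow]) (by rw [← hBpow]; exact h4B) (by simp)
      (by rw [← hBpow]; omega)).mono le_rfl ?_)
    rintro s'' ⟨hs5, hsame', r, h12, hr1, hr2⟩
    have hrB : r ≤ 2 * B := by
      refine (Nat.pow_le_pow_iff_left two_ne_zero).1 ?_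
      exact (hr1.trans hx).trans (by ring_nf; omega)
    refine Runs.seq (Runs.assign_of_bounded hR 9 _ 2 r hs5 (by simp) (by simp [h12])
      (small (by simpa [regDeg] using (by omega : r ≤ β ^ 33))) fun hs6 => ?_)
    have h10' : s''.reg 10 = (j + 2 : ℕ) := by
      rw [hsame'.reg 10 (by decide)]; simp [h10]
    refine Runs.assign_of_bounded hR 10 _ 4 (j + 1 + 2 : ℕ) hs6 (by simp)
      (by simp [h10']; ring) (small (by simpa [regDeg] using (by omega : j + 1 + 2 ≤ β)))
      fun hs7 => ⟨hs7, ?_, by simp, r, by simp, hrB, ?_⟩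
    · exact (hsame.setReg.trans (hsame'.mono (by decide) (by decide))).setReg.setReg
    · rw [Real.sqrtTwoAddSeries]
      push_cast
      refine abs_sub_sqrt_two_add_le hB0 (Real.sqrtTwoAddSeries_zero_nonneg j) (Nat.cast_nonneg C)
        hcos ?_ ?_
      · have : (r : ℝ) ^ 2 ≤ 2 * (B * B) + B * C := by exact_mod_cast hr1
        linarith [sq (B : ℝ)]
      · have : (2 * (B * B) + B * C : ℝ) < (r + 1) ^ 2 := by exact_mod_cast hr2
        linarith [sq (B : ℝ)]
  · exact ⟨hs2, (SameExcept.refl _ _ s).setReg.setReg, by simp, 0, by simp, by omega, by simp⟩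
  rintro s' ⟨hs3, hsame, -, C, h9, hC, hcos⟩
  have h6' : s'.reg 6 = B := by rw [hsame.reg 6 (by decide), h6]
  have hCB : C ^ 2 ≤ 4 * B ^ 2 := by
    calc C ^ 2 ≤ (2 * B) ^ 2 := Nat.pow_le_pow_left hC 2
      _ = 4 * B ^ 2 := by ring
  refine Runs.seq (Runs.assign_of_bounded hR 11 _ 10 (4 * B ^ 2 - C ^ 2 : ℕ) hs3 (by simp)
    (by simp [h6', h9, Nat.cast_sub hCB]; ring) (small (by simpa [regDeg] using (by omega)))
    fun hs4 => ?_)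
  refine Runs.seq ((Runs.sqrtProg hR (b := K * 32) (x := 4 * B ^ 2 - C ^ 2) hs4
    (by simp [h6', hBpow]) (by rw [← hBpow]; exact h4B) (by simp)
    (by rw [← hBpow]; omega)).mono le_rfl ?_)
  rintro s'' ⟨hs5, hsame', r, h12, hr1, hr2⟩
  have hrB : r ≤ 2 * B := by
    refine (Nat.pow_le_pow_iff_left two_ne_zero).1 ?_
    exact (hr1.trans (Nat.sub_le _ _)).trans (by ring_nf; omega)
  have h9' : s''.reg 9 = C := by rw [hsame'.reg 9 (by decide)]; simp [h9]
  refine Runs.seq (Runs.assign_of_bounded hR 14 _ 4 ((r : ℤ) / 2) hs5 (by simp) (by simp [h12])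
    (small (k := 33) (v := r / 2) (by omega)) fun hs6 => ?_)
  refine Runs.assign_of_bounded hR 9 _ 4 ((C : ℤ) / 2) hs6 (by simp) (by simp [h9'])
    (small (k := 33) (v := C / 2) (by omega)) fun hs7 => ⟨hs7, ?_, ?_⟩
  · exact (hsame.setReg.trans (hsame'.mono (by decide) (by decide))).setReg.setReg
  · have hKc : |(C : ℝ) - B * Real.sqrtTwoAddSeries 0 (K - 2)| ≤ K := by
      refine hcos.trans ?_
      exact_mod_cast Nat.sub_le K 2
    simpa using norm_fixed_sub_rootOfUnity_le hK hB hC hKc hr1 hr2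

/-- Real and imaginary parts of the powers of a complex number, in fixed-point arithmetic. -/
def powerTable (B p q : ℤ) : ℕ → ℤ × ℤ
  | 0 => (B, 0)
  | y + 1 => (((powerTable B p q y).1 * p - (powerTable B p q y).2 * q) / B,
      ((powerTable B p q y).1 * q + (powerTable B p q y).2 * p) / B)

/-- Real part of the next power. For the exponent `0` the product reads the cells `-1`, which hold
`0`. -/
def tableRe : Expr := equal (reg 16) (const 0) * reg 6 +
  (get 4 (reg 16 - const 1) * reg 9 - get 5 (reg 16 - const 1) * reg 14) / reg 6

/-- Imaginary part of the next power. -/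
def tableIm : Expr :=
  (get 4 (reg 16 - const 1) * reg 14 + get 5 (reg 16 - const 1) * reg 9) / reg 6

/-- Fills the arrays `4`, `5` with the powers of the root of unity. -/
def tableProg : Prog :=
  .for 16 4 (.seq (.store 4 (reg 16) tableRe) (.store 5 (reg 16) tableIm))

theorem norm_powerTable_sub_le {K B : ℕ} (hK : 2 ≤ K) (hB : B = (2 ^ K) ^ 32) {p q : ℤ}
    (hpq : ‖fixed B p q - rootOfUnity K‖ ≤ 1 / ((2 ^ K : ℕ) : ℝ) ^ 13) {y : ℕ} (hy : y < 2 ^ K) :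
    ‖fixed B (powerTable B p q y).1 (powerTable B p q y).2 - rootOfUnity K ^ y‖ ≤
      1 / ((2 ^ K : ℕ) : ℝ) ^ 11 := by
  have hB0 : 0 < B := by rw [hB]; positivity
  set N : ℝ := ((2 ^ K : ℕ) : ℝ) with hN
  have hN4 : (4 : ℝ) ≤ N := by
    have : 2 ^ 2 ≤ 2 ^ K := Nat.pow_le_pow_right (by norm_num) hK
    rw [hN]; exact_mod_cast this
  have hyN : (y : ℝ) ≤ N := by rw [hN]; exact_mod_cast hy.le
  have hBN : (B : ℝ) = N ^ 32 := by rw [hB, hN]; push_cast; rfl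
  have hb : (y : ℝ) * (2 * (1 / N ^ 13) + 2 / B) ≤ 1 / N ^ 11 := by
    have e1 : (2 : ℝ) / B ≤ 2 / N ^ 13 := by
      rw [hBN]; gcongr <;> linarith
    calc (y : ℝ) * (2 * (1 / N ^ 13) + 2 / B) ≤ N * (2 * (1 / N ^ 13) + 2 / N ^ 13) := by gcongr
      _ = 4 / N * (1 / N ^ 11) := by field_simp; ring
      _ ≤ 1 * (1 / N ^ 11) := by
        gcongr
        rw [div_le_one (by linarith)]; exact hN4
      _ = _ := one_mul _
  refine (norm_power_table_sub_le (norm_rootOfUnity K) hpq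
    (fun y => fixed B (powerTable B p q y).1 (powerTable B p q y).2) (ρ := 2 / B)
    ?_ ?_ y ?_).trans hb
  · apply Complex.ext <;> simp [fixed, powerTable, hB0.ne']
  · intro z
    exact norm_fixed_mul_sub_le hB0 _ _ _ _
  · refine hb.trans ?_
    rw [div_le_one (by positivity)]
    exact one_le_pow₀ (by linarith)

theorem Runs.tableProg (hR : Room W β) {s : State} {K B : ℕ} (hs : Bounded W β s) (hK : 2 ≤ K)
    (hN : 2 ^ K ≤ β) (hB : B = (2 ^ K) ^ 32) (h4 : s.reg 4 = (2 ^ K : ℕ)) (h6 : s.reg 6 = B)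
    (hpq : ‖fixed B (s.reg 9) (s.reg 14) - rootOfUnity K‖ ≤ 1 / ((2 ^ K : ℕ) : ℝ) ^ 13)
    (ha4 : s.arr 4 (-1) = 0) (ha5 : s.arr 5 (-1) = 0) :
    Runs W ω tableProg s (2 ^ K * 60 + 6) fun s' => Bounded W β s' ∧
      SameExcept [16] [4, 5] s s' ∧
      RootTable B (2 ^ K) s' (rootOfUnity K) (1 / ((2 ^ K : ℕ) : ℝ) ^ 11) := by
  have hβ := hR.four_le
  have hB0 : 0 < B := by rw [hB]; positivity
  have hB1 : (B : ℤ) ≠ 0 := by positivity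
  have hBβ : B ≤ β ^ 32 := by rw [hB]; exact Nat.pow_le_pow_left hN 32
  set p := s.reg 9
  set q := s.reg 14
  have htab : ∀ y < 2 ^ K, |(powerTable B p q y).1| ≤ (β : ℤ) ^ 33 ∧
      |(powerTable B p q y).2| ≤ (β : ℤ) ^ 33 := by
    intro y hy
    refine abs_le_of_norm_fixed_sub_le hB0 (norm_powerTable_sub_le hK hB hpq hy) (M := 1)
      (by simp [norm_rootOfUnity]) ?_
    have h1 : (1 : ℝ) / ((2 ^ K : ℕ) : ℝ) ^ 11 ≤ 1 := by
      rw [div_le_one (by positivity)]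
      exact one_le_pow₀ (by exact_mod_cast Nat.one_le_two_pow)
    have h2 : 4 * B ≤ β ^ 33 := by
      calc 4 * B ≤ β * β ^ 32 := Nat.mul_le_mul hβ hBβ
        _ = β ^ 33 := by ring
    calc (1 + 1 / ((2 ^ K : ℕ) : ℝ) ^ 11) * B ≤ 4 * B := by gcongr; linarith
      _ ≤ (β : ℝ) ^ 33 := by exact_mod_cast h2
  refine (Runs.for (fun y s' => Bounded W β s' ∧ SameExcept [16] [4, 5] s s' ∧
    s'.arr 4 (-1) = 0 ∧ s'.arr 5 (-1) = 0 ∧ ∀ z < y, s'.arr 4 (z : ℕ) = (powerTable B p q z).1 ∧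
      s'.arr 5 (z : ℕ) = (powerTable B p q z).2) (2 ^ K) 50 (by decide) (hN.trans hR.le)
    hR.one_le h4 ?_ ?_).mono (by omega) ?_
  · exact ⟨hs.setReg (by decide) (by simp), (SameExcept.refl _ _ s).setReg, ha4, ha5,
      fun z hz => absurd hz (by omega)⟩
  · rintro y hy s' h16 h4' ⟨hs1, hsame, h4m, h5m, hval⟩
    have h6' : s'.reg 6 = B := by rw [hsame.reg 6 (by decide), h6]
    have h9' : s'.reg 9 = p := hsame.reg 9 (by decide)
    have h14' : s'.reg 14 = q := hsame.reg 14 (by decide)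
    have hv : (if (y : ℤ) = 0 then 1 else 0) * (B : ℤ) +
        (s'.arr 4 (y - 1) * p - s'.arr 5 (y - 1) * q) / (B : ℤ) = (powerTable B p q y).1 ∧
        (s'.arr 4 (y - 1) * q + s'.arr 5 (y - 1) * p) / (B : ℤ) = (powerTable B p q y).2 := by
      cases y with
      | zero => simp [h4m, h5m, powerTable]
      | succ y =>
        have := hval y (by omega)
        simp [powerTable, this.1, this.2]
        omega
    have hidx : ((y : ℤ) - 1 ≠ y) := by omega
    refine Runs.mono (t := 25 + 25) (Runs.seq (Runs.mono (Runs.store (hs1.fits hR (by decide)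
      (by simp)) (hs1.fits hR (by decide) (by simp [tableRe, h6', hB0.ne'])) ?_) (by decide)
      fun _ h => h))
      le_rfl fun _ h => h
    have e1 : tableRe.eval s' = (powerTable B p q y).1 := by
      rw [← hv.1]; simp [tableRe, h16, h6', h9', h14']
    rw [Expr.eval_reg, h16, e1]
    have hs2 : Bounded W β (s'.setArr 4 y (powerTable B p q y).1) :=
      hs1.setArr (by decide) (htab y hy).1
    refine Runs.mono (Runs.store (hs2.fits hR (by decide)
      (by simp)) (hs2.fits hR (by decide) (by simp [tableIm, h6', hB0.ne'])) ?_) (by decide)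
      fun _ h => h
    have e2 : tableIm.eval (s'.setArr 4 y (powerTable B p q y).1) = (powerTable B p q y).2 := by
      rw [← hv.2]; simp [tableIm, h16, h6', h9', h14', hidx]
    have h16' : (s'.setArr 4 y (powerTable B p q y).1).reg 16 = y := h16
    rw [Expr.eval_reg, h16', e2]
    have hs3 : Bounded W β ((s'.setArr 4 y (powerTable B p q y).1).setArr 5 y
      (powerTable B p q y).2) := hs2.setArr (by decide) (htab y hy).2
    have hy' : (y : ℤ) + 1 = ((y + 1 : ℕ) : ℤ) := by push_cast; rfl
    refine ⟨h16, h4', ?_, ⟨?_, ?_, ?_⟩, ?_, ?_, ?_⟩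
    · refine hs3.setReg (by decide) ?_
      simp only [regDeg, pow_one]
      rw [hy', Nat.abs_cast]; exact_mod_cast (by omega : y + 1 ≤ β)
    · intro x hx
      have : x ≠ 16 := by simpa using hx
      simp [this, hsame.reg x hx]
    · intro a ha
      have ha' := ha
      simp only [List.mem_cons, List.not_mem_nil, or_false, not_or] at ha'
      simp [ha'.1, ha'.2, hsame.arr a ha]
    · exact hsame.coins
    · have : (-1 : ℤ) ≠ y := by omega
      simp [this, h4m]
    · have : (-1 : ℤ) ≠ y := by omega
      simp [this, h5m]
    · intro z hz
      rcases Nat.lt_succ_iff_lt_or_eq.1 hz with h | rfl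
      · have : (z : ℤ) ≠ y := by omega
        simpa [this] using hval z h
      · simp
  · rintro s' ⟨-, -, h1, h2, -, -, h3⟩
    refine ⟨h1, h2, fun e he => ?_⟩
    rw [(h3 e he).1, (h3 e he).2]
    exact norm_powerTable_sub_le hK hB hpq he

/-! ### Random signs for the letters -/

/-- The sign that a coin stands for. -/
def coinSign (b : Bool) : ℤ := if b then -1 else 1

theorem abs_coinSign (b : Bool) : |coinSign b| = 1 := by cases b <;> rfl

/-- The table of signs after the letters `X 0, …, X (l - 1)` have, one after the other, been given
the signs of the coins from number `c` on; a repeated letter has its sign overwritten. -/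
def signTable (ω : ℕ → Bool) (c : ℕ) (X : ℕ → ℤ) (h : ℤ → ℤ) : ℕ → ℤ → ℤ
  | 0 => h
  | j + 1 => Function.update (signTable ω c X h j) (X j) (coinSign (ω (c + j)))

/-- The text followed by the pattern. -/
def joined (n : ℕ) (T P : ℕ → ℤ) (j : ℕ) : ℤ := if j < n then T j else P (j - n)

theorem signTable_congr (ω : ℕ → Bool) (c : ℕ) {X Y : ℕ → ℤ} (h : ℤ → ℤ) {l : ℕ}
    (hXY : ∀ j < l, X j = Y j) : signTable ω c X h l = signTable ω c Y h l := by
  induction l with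
  | zero => rfl
  | succ l ih =>
    rw [signTable, signTable, ih fun j hj => hXY j (by omega), hXY l (by omega)]

theorem signTable_joined (ω : ℕ → Bool) (c n m : ℕ) (T P : ℕ → ℤ) (h : ℤ → ℤ) :
    signTable ω (c + n) P (signTable ω c T h n) m = signTable ω c (joined n T P) h (n + m) := by
  induction m with
  | zero => exact signTable_congr ω c h fun j hj => by simp [joined, hj]
  | succ m ih =>
    rw [signTable, ih, ← add_assoc, signTable]
    simp [joined, add_assoc]

/-- The sign of a letter is decided by the coin that belongs to its last occurrence. -/
theorem exists_signTable_eq (X : ℕ → ℤ) (l : ℕ) : ∃ f : ℤ → ℕ, ∀ j < l,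
    f (X j) < l ∧ X (f (X j)) = X j ∧
      ∀ (ω : ℕ → Bool) (c : ℕ) (h : ℤ → ℤ),
        signTable ω c X h l (X j) = coinSign (ω (c + f (X j))) := by
  induction l with
  | zero => exact ⟨fun _ => 0, fun j hj => absurd hj (by omega)⟩
  | succ l ih =>
    obtain ⟨f, hf⟩ := ih
    refine ⟨Function.update f (X l) l, fun j hj => ?_⟩
    by_cases he : X j = X l
    · rw [he]
      exact ⟨by simp, by simp, fun ω c h => by simp [signTable]⟩
    · obtain ⟨h1, h2, h3⟩ := hf j (by
        rcases Nat.lt_succ_iff_lt_or_eq.1 hj with h | rfl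
        · exact h
        · exact absurd rfl he)
      rw [Function.update_of_ne he]
      exact ⟨by omega, h2, fun ω c h => by rw [signTable, Function.update_of_ne he, h3]⟩

/-- Gives fresh random signs to the letters of the string in array `a`, of the length in register
`l`. The array `3` is indexed by the letters themselves. -/
def signProg (l a : ℕ) : Prog :=
  .for 16 l (.seq (.flip 17) (.store 3 (get a (reg 16)) (const 1 - const 2 * reg 17)))

theorem Runs.signProg (hR : Room W β) {s : State} {l a n : ℕ} (hs : Bounded W β s)
    (hl : s.reg l = n) (hn : n ≤ β) (hl16 : l ≠ 16) (hl17 : l ≠ 17) (ha : a ≠ 3) :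
    Runs W ω (signProg l a) s (n * 20 + 6) fun s' => Bounded W β s' ∧
      (∀ x, x ≠ 16 → x ≠ 17 → s'.reg x = s.reg x) ∧ (∀ b, b ≠ 3 → s'.arr b = s.arr b) ∧
      s'.coins = s.coins + n ∧
      s'.arr 3 = signTable ω s.coins (fun j => s.arr a j) (s.arr 3) n := by
  refine (Runs.for (fun y s' => Bounded W β s' ∧
      (∀ x, x ≠ 16 → x ≠ 17 → s'.reg x = s.reg x) ∧ (∀ b, b ≠ 3 → s'.arr b = s.arr b) ∧
      s'.coins = s.coins + y ∧
      s'.arr 3 = signTable ω s.coins (fun j => s.arr a j) (s.arr 3) y) n 12 hl16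
    (hn.trans hR.le) hR.one_le hl ?_ ?_).mono (by omega) ?_
  · exact ⟨hs.setReg (by decide) (by simp), fun x h _ => by simp [h], fun _ _ => rfl, rfl, rfl⟩
  · rintro y hy s' h16 hl' ⟨h1, h2, h3, h4, h5⟩
    have hbit : (if ω s'.coins then (1 : ℤ) else 0) = 0 ∨
        (if ω s'.coins then (1 : ℤ) else 0) = 1 := by
      split <;> simp
    have hb1 : Bounded W β (s'.setReg 17 (if ω s'.coins then 1 else 0)) := by
      refine h1.setReg (by decide) ?_
      rcases hbit with h | h <;> simp [h, regDeg]
    have hb2 := hb1.coins (s'.coins + 1)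
    have hsign : (1 : ℤ) - 2 * (if ω s'.coins then 1 else 0) = coinSign (ω (s.coins + y)) := by
      rw [h4, coinSign]; split <;> rfl
    refine Runs.mono (t := 1 + 11) (Runs.seq (Runs.flip (Runs.mono (Runs.store
      (hb2.fits hR rfl (by simp)) (hb2.fits hR (by decide) (by simp)) ?_)
      (by exact (by norm_num : 8 ≤ 11)) fun _ h => h))) le_rfl fun _ h => h
    have e2 : (const 1 - const 2 * reg 17).eval
        { s'.setReg 17 (if ω s'.coins then 1 else 0) with coins := s'.coins + 1 } =
        coinSign (ω (s.coins + y)) := by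
      rw [← hsign]; simp
    have e1 : (get a (reg 16)).eval
        { s'.setReg 17 (if ω s'.coins then 1 else 0) with coins := s'.coins + 1 } =
        s.arr a y := by
      simp [h16, h3 a ha]
    rw [e1, e2]
    have hb3 := hb2.setArr (a := 3) (i := s.arr a y) (v := coinSign (ω (s.coins + y))) (by decide)
      (by simp [abs_coinSign, arrDeg])
    refine ⟨by simp [h16], by simp [hl', hl17], ?_, ?_, ?_, ?_, ?_⟩
    · refine hb3.setReg (by decide) ?_
      have : (y : ℤ) + 1 = ((y + 1 : ℕ) : ℤ) := by push_cast; rfl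
      rw [this, Nat.abs_cast]
      simpa [regDeg] using (by exact_mod_cast (by omega : y + 1 ≤ β) : (y : ℤ) + 1 ≤ β)
    · intro x hx hx'
      simp [hx, hx', h2 x hx hx']
    · intro b hb
      simp [hb, h3 b hb]
    · simp [h4, add_assoc]
    · simp [h5, signTable]
  · rintro s' ⟨-, -, h⟩
    exact h

/-! ### One round -/

/-- Loads the signs of the letters of the reversed text and of the pattern, padded with zeros to
length `N`, into the arrays `6` and `7` as fixed-point numbers. -/
def loadProg : Prog :=
  .seq (.fill 16 4 6 (get 3 (get 0 (reg 4 - const 1 - reg 16)) *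
      less (reg 4 - const 1 - reg 16) (reg 0) * reg 6))
    (.fill 16 4 7 (get 3 (get 1 (reg 16)) * less (reg 16) (reg 1) * reg 6))

/-- Adds the correlations, which are the imaginary parts of the doubly transformed vector divided by
`2 * N` and rounded, to the array `10`. -/
def accumulateProg : Prog :=
  .fill 16 8 10 (get 10 (reg 16) +
    (get 7 (reg 16 + const 1) + reg 6 * reg 4) / (const 2 * (reg 6 * reg 4)))

/-- Adds to the array `10` the correlations of text and pattern under fresh random signs. -/
def roundProg : Prog :=
  .seq (signProg 0 0) <| .seq (signProg 1 1) <| .seq loadProg <| .seq fftProg <|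
  .seq squareProg <| .seq fftProg accumulateProg

/-- The part of the state that the rounds rely on. -/
structure Ready (W β n m K k : ℕ) (T P : ℕ → ℤ) (s : State) : Prop where
  bounded : Bounded W β s
  r0 : s.reg 0 = n
  r1 : s.reg 1 = m
  r4 : s.reg 4 = (2 ^ K : ℕ)
  r6 : s.reg 6 = ((2 ^ K) ^ 32 : ℕ)
  r7 : s.reg 7 = k
  r8 : s.reg 8 = (n - m + 1 : ℕ)
  a0 : ∀ j : ℕ, s.arr 0 j = T j
  a1 : ∀ j : ℕ, s.arr 1 j = P j
  table : RootTable ((2 ^ K) ^ 32) (2 ^ K) s (rootOfUnity K) (1 / ((2 ^ K : ℕ) : ℝ) ^ 11)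

theorem Holds.mono {B N : ℕ} {s : State} {x : ℕ → ℂ} {E E' : ℝ} (h : Holds B N s x E)
    (hE : E ≤ E') : Holds B N s x E' := fun y hy => (h y hy).trans hE

theorem norm_dft_le {N : ℕ} {ζ : ℂ} (hζ : ‖ζ‖ = 1) {x : ℕ → ℂ} {M : ℝ}
    (hx : ∀ y < N, ‖x y‖ ≤ M) (r : ℕ) : ‖dft N ζ x r‖ ≤ N * M := by
  refine (norm_sum_le _ _).trans ?_
  calc ∑ l ∈ Finset.range N, ‖x l * ζ ^ (r * l)‖ ≤ ∑ l ∈ Finset.range N, M := by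
        refine Finset.sum_le_sum fun l hl => ?_
        rw [norm_mul, norm_pow, hζ, one_pow, mul_one]
        exact hx l (Finset.mem_range.1 hl)
    _ = N * M := by simp

theorem Runs.loadProg (hR : Room W β) {s : State} {n m K k : ℕ} {T P : ℕ → ℤ}
    (h : Ready W β n m K k T P s) (hN : 2 ^ K ≤ β) :
    Runs W ω loadProg s (2 ^ K * 60 + 12) fun s' => Bounded W β s' ∧
      SameExcept [16] [6, 7] s s' ∧
      Holds ((2 ^ K) ^ 32) (2 ^ K) s' (packed (2 ^ K) n m (fun x => s.arr 3 (T x))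
        fun j => s.arr 3 (P j)) 0 := by
  set N := 2 ^ K with hNdef
  set B := N ^ 32 with hB
  have hN0 : 0 < N := by positivity
  have hBβ : B ≤ β ^ 40 :=
    (Nat.pow_le_pow_left hN 32).trans
      (Nat.pow_le_pow_right (by have := hR.four_le; omega) (by norm_num))
  have hB0 : (B : ℝ) ≠ 0 := by positivity
  have h3 : ∀ z, |s.arr 3 z| ≤ 1 := by
    intro z
    simpa [sizeBound, arrDeg, degLimit] using h.bounded.arr 3 z
  have bd : ∀ (z : ℤ) (p : Prop) [Decidable p],
      |s.arr 3 z * (if p then 1 else 0) * (B : ℤ)| ≤ (β : ℤ) ^ 40 := by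
    intro z p _
    have hB' : (B : ℤ) ≤ (β : ℤ) ^ 40 := by exact_mod_cast hBβ
    have hB'' : (0 : ℤ) ≤ B := by positivity
    rw [abs_mul, abs_mul, Nat.abs_cast]
    have hi : |(if p then 1 else 0 : ℤ)| ≤ 1 := by split <;> simp
    calc _ ≤ 1 * 1 * (B : ℤ) := by
          gcongr
          exact h3 z
      _ ≤ _ := by linarith
  refine Runs.mono (t := N * 30 + 6 + (N * 30 + 6)) (Runs.seq ?_) (by omega) fun _ h => h
  refine Runs.fill hR 16 4 6 _ 30 N (fun y => s.arr 3 (T (N - 1 - y)) *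
    (if N - 1 - y < n then 1 else 0) * (B : ℤ)) h.bounded h.r4 hN (fun y _ => bd _ _)
    (fun y _ => by simp) (fun y hy => ?_) fun hs1 => ?_
  · have hc : (N : ℤ) - 1 - y = ((N - 1 - y : ℕ) : ℤ) := by omega
    simp [h.r4, ← hNdef, h.r0, h.r6, ← hB, h.a0, hc]
  refine Runs.fill hR 16 4 7 _ 30 N (fun y => s.arr 3 (P y) *
    (if y < m then 1 else 0) * (B : ℤ)) hs1
    (by rw [fill_reg, Function.update_of_ne (by decide)]; exact h.r4) hN (fun y _ => bd _ _)
    (fun y _ => by simp) (fun y hy => ?_) fun hs2 => ?_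
  · simp [h.r1, h.r6, h.a1, hB, hNdef]
  refine ⟨hs2, ⟨fun x hx => ?_, fun a ha => ?_, rfl⟩, fun y hy => ?_⟩
  · have : x ≠ 16 := by simpa using hx
    simp [this]
  · simp only [List.mem_cons, List.not_mem_nil, or_false, not_or] at ha
    simp [ha.1, ha.2]
  · simp only [fill_arr, Function.update_self]
    rw [Function.update_of_ne (by decide), Function.update_self, patch_of_lt hy, patch_of_lt hy]
    refine le_of_eq (norm_eq_zero.2 (sub_eq_zero.2 ?_))
    apply Complex.ext
    · simp only [fixed, packed]
      split <;> simp [hB0]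
    · simp only [fixed, packed]
      split <;> simp [hB0]

theorem ready_of_sameExcept {n m K k : ℕ} {T P : ℕ → ℤ} {s s' : State}
    (h : Ready W β n m K k T P s) (hb : Bounded W β s')
    (hr : ∀ x ∈ [0, 1, 4, 6, 7, 8], s'.reg x = s.reg x)
    (ha : ∀ a ∈ [0, 1, 4, 5], s'.arr a = s.arr a) : Ready W β n m K k T P s' where
  bounded := hb
  r0 := by rw [hr 0 (by decide), h.r0]
  r1 := by rw [hr 1 (by decide), h.r1]
  r4 := by rw [hr 4 (by decide), h.r4]
  r6 := by rw [hr 6 (by decide), h.r6]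
  r7 := by rw [hr 7 (by decide), h.r7]
  r8 := by rw [hr 8 (by decide), h.r8]
  a0 := by rw [ha 0 (by decide)]; exact h.a0
  a1 := by rw [ha 1 (by decide)]; exact h.a1
  table := by
    intro e he
    rw [ha 4 (by decide), ha 5 (by decide)]; exact h.table e he

/-- The errors of the first transform, of the squaring and of the second transform, for an error of
`N ^ (-11)` in the table of the roots of unity. The last one is well below the error of `N` at which
rounding would begin to miss the correlations. -/
theorem error_bounds {N B : ℝ} (hN : 4 ≤ N) (hB : B = N ^ 32) :
    N ^ 2 * (0 + (1 / N ^ 11 * (N * 2) + 2 / B)) ≤ 1 / N ^ 7 ∧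
    1 / N ^ 7 * (2 * (N * 2) + 1 / N ^ 7) + 2 / B ≤ 1 / N ^ 4 ∧
    N ^ 2 * (1 / N ^ 4 + (1 / N ^ 11 * (N * (N * 2 * (N * 2))) + 2 / B)) ≤ 1 / 2 := by
  have h0 : 0 < N := by linarith
  have hB' : ∀ k ≤ 32, N ^ k ≤ B := fun k hk => by
    rw [hB]; exact pow_le_pow_right₀ (by linarith) hk
  have inv : ∀ k l, l ≤ k → 1 / N ^ k ≤ 1 / N ^ l := by
    intro k l hk
    gcongr
    linarith
  have h4 : 4 / N ≤ 1 := by rw [div_le_one h0]; exact hN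
  refine ⟨?_, ?_, ?_⟩
  · calc N ^ 2 * (0 + (1 / N ^ 11 * (N * 2) + 2 / B))
        ≤ N ^ 2 * (0 + (1 / N ^ 11 * (N * 2) + 2 / N ^ 10)) := by
          gcongr; exact hB' 10 (by norm_num)
      _ = 4 / N * (1 / N ^ 7) := by field_simp; ring
      _ ≤ 1 * (1 / N ^ 7) := by gcongr
      _ = _ := one_mul _
  · have h7 : 1 / N ^ 7 ≤ 1 := by rw [div_le_one (by positivity)]; exact one_le_pow₀ (by linarith)
    calc 1 / N ^ 7 * (2 * (N * 2) + 1 / N ^ 7) + 2 / B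
        ≤ 1 / N ^ 7 * (2 * (N * 2) + N) + 2 / N ^ 6 := by
          gcongr
          · linarith
          · exact hB' 6 (by norm_num)
      _ = (7 / 16) * (4 / N) * (4 / N) * (1 / N ^ 4) := by field_simp; norm_num
      _ ≤ 1 * 1 * 1 * (1 / N ^ 4) := by gcongr; norm_num
      _ = _ := by ring
  · calc N ^ 2 * (1 / N ^ 4 + (1 / N ^ 11 * (N * (N * 2 * (N * 2))) + 2 / B))
        ≤ N ^ 2 * (1 / N ^ 4 + (1 / N ^ 7 * 4 * (1 / N) + 2 / N ^ 4)) := by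
          gcongr ?_ * (_ + (?_ + ?_))
          · rw [show 1 / N ^ 11 * (N * (N * 2 * (N * 2))) = 1 / N ^ 7 * 4 * (1 / N) by
              field_simp; ring]
          · exact div_le_div_of_nonneg_left (by norm_num) (by positivity) (hB' 4 (by norm_num))
      _ = 3 / N ^ 2 + 4 / N * (1 / N ^ 5) := by field_simp; ring
      _ ≤ 3 / N ^ 2 + 1 * (1 / N ^ 2) :=
          add_le_add le_rfl (mul_le_mul h4 (inv 5 2 (by norm_num)) (by positivity) zero_le_one)
      _ = 4 / N ^ 2 := by ring
      _ ≤ 4 / 4 ^ 2 := by gcongr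
      _ ≤ _ := by norm_num

/-- Rounding removes the error of the transforms, the correlation `c` being an integer. -/
theorem round_eq {B N : ℕ} (hB : 0 < B) (hN : 0 < N) {z c : ℤ}
    (h : |(z : ℝ) / B - 2 * N * c| ≤ 1 / 2) :
    (z + B * N) / (2 * ((B : ℤ) * N)) = c := by
  have hB' : (0 : ℝ) < B := by exact_mod_cast hB
  have h1 : |(z : ℝ) - 2 * N * c * B| ≤ B / 2 := by
    have : (z : ℝ) - 2 * N * c * B = ((z : ℝ) / B - 2 * N * c) * B := by field_simp
    rw [this, abs_mul, abs_of_pos hB']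
    linarith [mul_le_mul_of_nonneg_right h hB'.le]
  have h2 : |2 * (z - 2 * N * c * B)| ≤ (B : ℤ) := by
    have : |2 * ((z : ℝ) - 2 * N * c * B)| ≤ B := by
      rw [abs_mul, abs_two]; linarith
    exact_mod_cast this
  have h3 : (B : ℤ) ≤ B * N := le_mul_of_one_le_right (by positivity) (by exact_mod_cast hN)
  have hBz : (0 : ℤ) < B := by exact_mod_cast hB
  have hpos : (0 : ℤ) < 2 * ((B : ℤ) * N) := by positivity
  rw [abs_le] at h2
  refine Int.ediv_eq_iff_of_pos hpos |>.2 ⟨?_, ?_⟩ <;> nlinarith [h2.1, h2.2]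

theorem norm_packed_le {N n m : ℕ} {u v : ℕ → ℝ} (hu : ∀ x, |u x| ≤ 1) (hv : ∀ x, |v x| ≤ 1)
    (a : ℕ) : ‖packed N n m u v a‖ ≤ 2 := by
  refine (Complex.norm_le_abs_re_add_abs_im _).trans ?_
  have h1 : |(packed N n m u v a).re| ≤ 1 := by
    simp only [packed]; split
    · exact hu _
    · simp
  have h2 : |(packed N n m u v a).im| ≤ 1 := by
    simp only [packed]; split
    · exact hv _
    · simp
  linarith

theorem Runs.roundProg (hR : Room W β) {s : State} {n m K k : ℕ} {T P : ℕ → ℤ}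
    (h : Ready W β n m K k T P s) (hK : 2 ≤ K) (hN : 2 ^ K ≤ β) (hn : n < 2 ^ K) (hm : 1 ≤ m)
    (hmn : m ≤ n)
    (hacc : ∀ i < n - m + 1, |s.arr 10 i + ∑ j ∈ Finset.range m,
      signTable ω s.coins (joined n T P) (s.arr 3) (n + m) (T (i + j)) *
      signTable ω s.coins (joined n T P) (s.arr 3) (n + m) (P j)| ≤ (β : ℤ) ^ 5) :
    Runs W ω roundProg s (2 ^ K * (K * 1000)) fun s' => Ready W β n m K k T P s' ∧
      s'.reg 15 = s.reg 15 ∧ s'.coins = s.coins + (n + m) ∧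
      ∀ i < n - m + 1, s'.arr 10 (i : ℕ) = s.arr 10 i + ∑ j ∈ Finset.range m,
        signTable ω s.coins (joined n T P) (s.arr 3) (n + m) (T (i + j)) *
        signTable ω s.coins (joined n T P) (s.arr 3) (n + m) (P j) := by
  set sgn := signTable ω s.coins (joined n T P) (s.arr 3) (n + m) with hsgn
  have h4N : 4 ≤ 2 ^ K := by
    calc 4 = 2 ^ 2 := rfl
      _ ≤ 2 ^ K := Nat.pow_le_pow_right (by norm_num) hK
  have hN0 : 0 < 2 ^ K := by positivity
  have hB0 : 0 < (2 ^ K) ^ 32 := by positivity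
  refine Runs.mono (t := (n * 20 + 6) + ((m * 20 + 6) + ((2 ^ K * 60 + 12) +
    ((K * (2 ^ K * 250 + 104) + 6) + ((2 ^ K * 100 + 30) + ((K * (2 ^ K * 250 + 104) + 6) +
    ((n - m + 1) * 30 + 6))))))) ?_ ?_ fun _ h => h
  swap
  · set N := 2 ^ K
    have h1 : n * 20 ≤ N * 20 := by omega
    have h2 : m * 20 ≤ N * 20 := by omega
    have h3 : (n - m + 1) * 30 ≤ N * 30 + 30 := by omega
    have h5 : 2 * N ≤ N * K := by nlinarith
    have h6 : 4 * K ≤ N * K := Nat.mul_le_mul_right _ h4N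
    nlinarith
  refine Runs.seq ((Runs.signProg hR h.bounded h.r0 (by omega) (by decide) (by decide)
    (by decide)).mono le_rfl ?_)
  rintro s1 ⟨b1, r1, a1, c1, t1⟩
  refine Runs.seq ((Runs.signProg hR b1 (by rw [r1 1 (by decide) (by decide)]; exact h.r1)
    (by omega) (by decide) (by decide) (by decide)).mono le_rfl ?_)
  rintro s2 ⟨b2, r2, a2, c2, t2⟩
  have hs2 : Ready W β n m K k T P s2 := ready_of_sameExcept h b2
    (fun x hx => by
      have h16 : x ≠ 16 := by rintro rfl; simp at hx
      have h17 : x ≠ 17 := by rintro rfl; simp at hx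
      rw [r2 x h16 h17, r1 x h16 h17])
    (fun a ha => by
      have h3 : a ≠ 3 := by rintro rfl; simp at ha
      rw [a2 a h3, a1 a h3])
  have ht : s2.arr 3 = sgn := by
    rw [t2, t1, c1, a1 1 (by decide), show (fun j : ℕ => s.arr 0 j) = T from funext h.a0,
      show (fun j : ℕ => s.arr 1 j) = P from funext h.a1, signTable_joined]
  have h10 : s2.arr 10 = s.arr 10 := by rw [a2 10 (by decide), a1 10 (by decide)]
  have h15 : s2.reg 15 = s.reg 15 := by
    rw [r2 15 (by decide) (by decide), r1 15 (by decide) (by decide)]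
  have hcoins : s2.coins = s.coins + (n + m) := by rw [c2, c1, add_assoc]
  have hsgn1 : ∀ z, |(sgn z : ℝ)| ≤ 1 := by
    intro z
    have := b2.arr 3 z
    rw [ht] at this
    have : |sgn z| ≤ 1 := by simpa [sizeBound, arrDeg, degLimit] using this
    exact_mod_cast this
  refine Runs.seq ((Runs.loadProg hR hs2 hN).mono le_rfl ?_)
  rintro s3 ⟨b3, f3, v3⟩
  have hs3 : Ready W β n m K k T P s3 := ready_of_sameExcept hs2 b3
    (fun x hx => f3.reg x (by rintro h; fin_cases hx <;> simp at h))
    (fun a ha => f3.arr a (by rintro h; fin_cases ha <;> simp at h))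
  set Nr : ℝ := ((2 ^ K : ℕ) : ℝ) with hNr
  have hNr4 : 4 ≤ Nr := by rw [hNr]; exact_mod_cast h4N
  have h2K : (2 : ℝ) ^ K = Nr := by rw [hNr]; push_cast; rfl
  have h4K : (4 : ℝ) ^ K = Nr ^ 2 := by
    rw [← h2K, ← pow_mul, mul_comm, pow_mul]; norm_num
  have hBr : (((2 ^ K) ^ 32 : ℕ) : ℝ) = Nr ^ 32 := by rw [hNr]; push_cast; rfl
  obtain ⟨e1, e2, e3⟩ := error_bounds hNr4 hBr
  have inv1 : ∀ l, 1 / Nr ^ l ≤ 1 := fun l => by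
    rw [div_le_one (by positivity)]; exact one_le_pow₀ (by linarith)
  have size : ∀ Y : ℝ, Y ≤ 4 * Nr ^ 3 + 1 → Y * (((2 ^ K) ^ 32 : ℕ) : ℝ) ≤ (β : ℝ) ^ 40 := by
    intro Y hY
    have c1 : 4 * Nr ^ 3 ≤ Nr * Nr ^ 3 := by gcongr
    have c2 : (1 : ℝ) ≤ Nr ^ 4 := one_le_pow₀ (by linarith)
    have c3 : 2 * Nr ^ 4 ≤ Nr * Nr ^ 4 := by gcongr; linarith
    have c4 : Nr ^ 5 ≤ Nr ^ 8 := pow_le_pow_right₀ (by linarith) (by norm_num)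
    have c5 : Nr ≤ β := by rw [hNr]; exact_mod_cast hN
    calc Y * (((2 ^ K) ^ 32 : ℕ) : ℝ) ≤ Nr ^ 8 * Nr ^ 32 := by
          rw [hBr]; gcongr; linarith [c1, c3, pow_succ' Nr 3, pow_succ' Nr 4]
      _ = Nr ^ 40 := by ring
      _ ≤ (β : ℝ) ^ 40 := by gcongr
  have hNr3 : Nr ≤ Nr ^ 3 := le_self_pow₀ (by linarith) (by norm_num)
  have hNr23 : Nr ^ 2 ≤ Nr ^ 3 := pow_le_pow_right₀ (by linarith) (by norm_num)
  set ζ := rootOfUnity K with hζ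
  have hζp : IsPrimitiveRoot ζ (2 ^ K) := isPrimitiveRoot_rootOfUnity K
  have hζ1 : ‖ζ‖ = 1 := norm_rootOfUnity K
  set x := packed (2 ^ K) n m (fun x => (sgn (T x) : ℝ)) (fun j => (sgn (P j) : ℝ)) with hx
  have hx2 : ∀ y < 2 ^ K, ‖x y‖ ≤ 2 := fun y _ =>
    norm_packed_le (fun _ => hsgn1 _) (fun _ => hsgn1 _) y
  have hη0 : 0 ≤ 1 / Nr ^ 11 := by positivity
  have v3' : Holds ((2 ^ K) ^ 32) (2 ^ K) s3 x 0 := by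
    rw [ht] at v3; exact v3
  refine Runs.seq ((Runs.fftProg hR b3 hN hB0 hs3.r4 hs3.r6 hζ1 hζp.pow_eq_one hη0 (inv1 11)
    hs3.table le_rfl zero_le_two v3' hx2 ?_).mono le_rfl ?_)
  · rw [h2K, h4K]
    exact size _ (by linarith [inv1 7])
  rintro s4 ⟨b4, f4, v4⟩
  rw [h2K, h4K] at v4
  have hs4 : Ready W β n m K k T P s4 := ready_of_sameExcept hs3 b4
    (fun x hx => f4.reg x (by rintro h; fin_cases hx <;> simp at h))
    (fun a ha => f4.arr a (by rintro h; fin_cases ha <;> simp at h))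
  have hd2 : ∀ y < 2 ^ K, ‖dft (2 ^ K) ζ x y‖ ≤ Nr * 2 := fun y _ => norm_dft_le hζ1 hx2 y
  refine Runs.seq ((Runs.squareProg hR b4 hN hB0 hs4.r4 hs4.r6 (by positivity) (v4.mono e1) hd2
    ?_).mono le_rfl ?_)
  · exact size _ (by nlinarith [inv1 4, e2])
  rintro s5 ⟨b5, f5, v5⟩
  have hs5 : Ready W β n m K k T P s5 := ready_of_sameExcept hs4 b5
    (fun x hx => f5.reg x (by rintro h; fin_cases hx <;> simp at h))
    (fun a ha => f5.arr a (by rintro h; fin_cases ha <;> simp at h))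
  have hq2 : ∀ y < 2 ^ K, ‖dft (2 ^ K) ζ x y * dft (2 ^ K) ζ x y‖ ≤ Nr * 2 * (Nr * 2) := by
    intro y hy
    rw [norm_mul]
    exact mul_self_le_mul_self (norm_nonneg _) (hd2 y hy)
  refine Runs.seq ((Runs.fftProg hR b5 hN hB0 hs5.r4 hs5.r6 hζ1 hζp.pow_eq_one hη0 (inv1 11)
    hs5.table (by positivity) (by positivity) (v5.mono e2) hq2 ?_).mono le_rfl ?_)
  · rw [h2K, h4K]
    refine size _ ?_
    have : Nr * (Nr * 2 * (Nr * 2)) = 4 * Nr ^ 3 := by ring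
    linarith
  rintro s6 ⟨b6, f6, v6⟩
  rw [h2K, h4K] at v6
  have hs6 : Ready W β n m K k T P s6 := ready_of_sameExcept hs5 b6
    (fun x hx => f6.reg x (by rintro h; fin_cases hx <;> simp at h))
    (fun a ha => f6.arr a (by rintro h; fin_cases ha <;> simp at h))
  have hcorr : ∀ i < n - m + 1, (s6.arr 7 ((i : ℤ) + 1) + ((2 ^ K) ^ 32 : ℕ) * (2 ^ K : ℕ)) /
      (2 * (((2 ^ K) ^ 32 : ℕ) * (2 ^ K : ℕ) : ℤ)) =
      ∑ j ∈ Finset.range m, sgn (T (i + j)) * sgn (P j) := by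
    intro i hi
    refine round_eq hB0 hN0 ?_
    have h1 := (Complex.abs_im_le_norm _).trans (v6 (i + 1) (by omega))
    rw [Complex.sub_im, im_dft_sq_dft_packed hζp _ _ hn (by omega)] at h1
    refine le_trans (le_of_eq ?_) (h1.trans e3)
    simp only [fixed]
    push_cast
    rfl
  have h10' : s6.arr 10 = s.arr 10 := by
    rw [f6.arr 10 (by decide), f5.arr 10 (by decide), f4.arr 10 (by decide),
      f3.arr 10 (by decide), h10]
  refine Runs.fill hR 16 8 10 _ 30 (n - m + 1) (fun i => s.arr 10 i +
    ∑ j ∈ Finset.range m, sgn (T (i + j)) * sgn (P j)) b6 hs6.r8 (by omega) hacc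
    (fun y _ => ?_) (fun y hy => ?_) fun hs7 => ⟨?_, ?_, ?_, ?_⟩
  · simp [hs6.r4, hs6.r6]
  · rw [← hcorr y hy, ← h10']
    have r4 := hs6.r4
    have r6 := hs6.r6
    simp only [Expr.eval_add, Expr.eval_get, Expr.eval_reg, Expr.eval_mul, Expr.eval_div,
      Expr.eval_const, fill_reg, fill_arr, Function.update_self, patch_self]
    rw [Function.update_of_ne (by decide), Function.update_of_ne (by decide),
      Function.update_of_ne (by decide), r4, r6]
  · exact ready_of_sameExcept hs6 hs7
      (fun x hx => by
        have : x ≠ 16 := by rintro rfl; simp at hx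
        simp [this])
      (fun a ha => by
        have : a ≠ 10 := by rintro rfl; simp at ha
        simp [this])
  · have : (s6.fill 16 10 (fun i => s.arr 10 i +
        ∑ j ∈ Finset.range m, sgn (T (i + j)) * sgn (P j)) (n - m + 1)).reg 15 = s6.reg 15 := by
      simp
    rw [this, f6.reg 15 (by decide), f5.reg 15 (by decide), f4.reg 15 (by decide),
      f3.reg 15 (by decide), h15]
  · rw [fill_coins, f6.coins, f5.coins, f4.coins, f3.coins, hcoins]
  · intro i hi
    rw [fill_arr, Function.update_self, patch_of_lt hi]

/-! ### The whole program -/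

/-- Turns the accumulated correlations into estimates, rounded to the nearest integer. -/
def outputProg : Prog :=
  .fill 16 8 2 ((const 2 * (reg 7 * reg 1 - get 10 (reg 16)) + reg 7) / (const 2 * reg 7))

/-- The approximation algorithm: the number of rounds is `K₀ * q ^ 2 * K`, for the constant `K₀`,
the precision parameter `q` and the logarithm `K` of the length of the transforms. -/
def mainProg (K₀ : ℕ) : Prog :=
  .seq (sizesProg K₀) <| .seq rootProg <| .seq tableProg <| .seq (.for 15 7 roundProg) outputProg

/-- Correlation at position `i` of text and pattern under the signs given by the coins from number
`c` on, where `f` assigns coins to letters. -/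
def correlation (ω : ℕ → Bool) (f : ℤ → ℕ) (T P : ℕ → ℤ) (m c i : ℕ) : ℤ :=
  ∑ j ∈ Finset.range m, coinSign (ω (c + f (T (i + j)))) * coinSign (ω (c + f (P j)))

theorem abs_correlation_le (ω : ℕ → Bool) (f : ℤ → ℕ) (T P : ℕ → ℤ) (m c i : ℕ) :
    |correlation ω f T P m c i| ≤ m := by
  refine (Finset.abs_sum_le_sum_abs _ _).trans ?_
  simp [abs_mul, abs_coinSign]

theorem abs_sum_correlation_le (ω : ℕ → Bool) (f : ℤ → ℕ) (T P : ℕ → ℤ) (m i l k : ℕ) :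
    |∑ r ∈ Finset.range k, correlation ω f T P m (r * l) i| ≤ k * m := by
  refine (Finset.abs_sum_le_sum_abs _ _).trans ?_
  refine (Finset.sum_le_sum fun r _ => abs_correlation_le ω f T P m (r * l) i).trans ?_
  simp

/-- The estimate that the program outputs for position `i` after `k` rounds: `m` minus the average
correlation, rounded to the nearest integer. Each round uses `n + m` coins. -/
def estimate (ω : ℕ → Bool) (f : ℤ → ℕ) (T P : ℕ → ℤ) (n m k i : ℕ) : ℤ :=
  (2 * ((k : ℤ) * m - ∑ r ∈ Finset.range k, correlation ω f T P m (r * (n + m)) i) + k) / (2 * k)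

/-- For all coin outcomes, the program halts in time and outputs the estimates. The hypothesis `hf`
says that `f` assigns to each letter the coin, within a round, that decides its sign. -/
theorem Runs.mainProg (hR : Room W β) {n m q K₀ : ℕ} {T : Fin n → ℤ} {P : Fin m → ℤ} (hn : 2 ≤ n)
    (hm : 1 ≤ m) (hmn : m ≤ n) (hq : 1 ≤ q) (hK₀ : 1 ≤ K₀) (hnβ : 2 * n ≤ β) (hqβ : q ≤ β)
    (hK₀β : K₀ ≤ β) (hT : ∀ i, |T i| ≤ W) (hP : ∀ j, |P j| ≤ W) {f : ℤ → ℕ}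
    (hf : ∀ j < n + m, ∀ (ω : ℕ → Bool) (c : ℕ) (h : ℤ → ℤ),
      signTable ω c (joined n (fun j => load T j) fun j => load P j) h (n + m)
        (joined n (fun j => load T j) (fun j => load P j) j) =
        coinSign (ω (c + f (joined n (fun j => load T j) (fun j => load P j) j)))) :
    Runs W ω (mainProg K₀) (init T P q)
      (3000 * (K₀ * (q * q) * logLen n * (2 ^ logLen n * logLen n))) fun s' =>
      ∀ i < n - m + 1, s'.arr 2 (i : ℕ) = estimate ω f (fun j => load T j) (fun j => load P j) n m
        (K₀ * (q * q) * logLen n) i := by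
  set K := logLen n with hKdef
  set k := K₀ * (q * q) * K with hk
  set T' : ℕ → ℤ := fun j => load T j with hT'
  set P' : ℕ → ℤ := fun j => load P j with hP'
  have hβ := hR.four_le
  have hK : 2 ≤ K := two_le_logLen hn
  have hN : 2 ^ K ≤ β := (two_pow_logLen_le hn).trans hnβ
  have hKN : K < 2 ^ K := Nat.lt_two_pow_self
  have hkβ : k ≤ β ^ 4 := by
    calc K₀ * (q * q) * K ≤ β * (β * β) * β := by gcongr; omega
      _ = β ^ 4 := by ring
  have hkW : k ≤ W := hkβ.trans (hR.pow_le_of_le (by decide))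
  have hk1 : 1 ≤ k := by
    have : 0 < K₀ * (q * q) * K := by positivity
    omega
  have hload : ∀ {l : ℕ} (X : Fin l → ℤ), (∀ i, |X i| ≤ W) → ∀ z, |load X z| ≤ W := by
    intro l X hX z
    unfold load; split
    · exact hX _
    · simp
  have hs0 : Bounded W β (init T P q) := by
    constructor
    · intro x
      have one : ((sizeBound W β 1 : ℕ) : ℤ) = β := by simp [sizeBound, degLimit]
      by_cases h0 : x = 0
      · subst h0; simp [init, regDeg, one]; omega
      by_cases h1 : x = 1
      · subst h1; simp [init, regDeg, one]; omega
      by_cases h2 : x = 2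
      · subst h2; simp [init, regDeg, one]; omega
      · simp [init, h0, h1, h2]
    · intro a z
      by_cases h0 : a = 0
      · subst h0; simpa [init, arrDeg, sizeBound] using hload T hT z
      by_cases h1 : a = 1
      · subst h1; simpa [init, arrDeg, sizeBound] using hload P hP z
      · simp [init, h0, h1]
  refine Runs.mono (t := (K * 14 + 60) + ((K * (K * 800 + 200)) + ((2 ^ K * 60 + 6) +
    ((k * (2 ^ K * (K * 1000) + 8) + 6) + ((n - m + 1) * 30 + 6))))) ?_ ?_ fun _ h => h
  swap
  · have hn' : n - m + 1 ≤ 2 ^ K := by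
      have : n < 2 ^ K := lt_two_pow_logLen n
      omega
    set N := 2 ^ K
    have a1 : K * K ≤ N * K := Nat.mul_le_mul_right _ hKN.le
    have a2 : N * 2 ≤ N * K := Nat.mul_le_mul_left _ hK
    have a3 : N * K ≤ k * (N * K) := Nat.le_mul_of_pos_left _ hk1
    have a4 : k * 3 ≤ k * (N * K) := Nat.mul_le_mul_left _ (by nlinarith)
    nlinarith
  refine Runs.seq ((Runs.sizesProg hR hs0 hn hm hmn rfl rfl rfl hnβ hqβ hK₀β).mono le_rfl ?_)
  rintro s1 ⟨b1, f1, h4, h5, h6, h7, h8⟩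
  refine Runs.seq ((Runs.rootProg hR b1 hK hN rfl h5 h6).mono le_rfl ?_)
  rintro s2 ⟨b2, f2, hroot⟩
  refine Runs.seq ((Runs.tableProg hR b2 hK hN rfl (by rw [f2.reg 4 (by decide), h4])
    (by rw [f2.reg 6 (by decide), h6]) hroot ?_ ?_).mono le_rfl ?_)
  · rw [f2.arr 4 (by decide), f1.arr 4 (by decide)]; rfl
  · rw [f2.arr 5 (by decide), f1.arr 5 (by decide)]; rfl
  rintro s3 ⟨b3, f3, htab⟩
  have hready : Ready W β n m K k T' P' s3 := by
    refine ⟨b3, ?_, ?_, ?_, ?_, ?_, ?_, ?_, ?_, htab⟩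
    · rw [f3.reg 0 (by decide), f2.reg 0 (by decide), f1.reg 0 (by decide)]; rfl
    · rw [f3.reg 1 (by decide), f2.reg 1 (by decide), f1.reg 1 (by decide)]; rfl
    · rw [f3.reg 4 (by decide), f2.reg 4 (by decide), h4]
    · rw [f3.reg 6 (by decide), f2.reg 6 (by decide), h6]
    · rw [f3.reg 7 (by decide), f2.reg 7 (by decide), h7]
    · rw [f3.reg 8 (by decide), f2.reg 8 (by decide), h8]
    · rw [f3.arr 0 (by decide), f2.arr 0 (by decide), f1.arr 0 (by decide)]; exact fun _ => rfl
    · rw [f3.arr 1 (by decide), f2.arr 1 (by decide), f1.arr 1 (by decide)]; exact fun _ => rfl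
  have hc0 : s3.coins = 0 := by rw [f3.coins, f2.coins, f1.coins]; rfl
  have h10 : ∀ z, s3.arr 10 z = 0 := by
    rw [f3.arr 10 (by decide), f2.arr 10 (by decide), f1.arr 10 (by decide)]; exact fun _ => rfl
  have setReady : ∀ {s : State} (v : ℕ), v ≤ k → Ready W β n m K k T' P' s →
      Ready W β n m K k T' P' (s.setReg 15 v) := by
    intro s v hv h
    refine ready_of_sameExcept h (h.bounded.setReg (by decide) ?_) (fun x hx => ?_) fun _ _ => rfl
    · rw [Nat.abs_cast]; exact_mod_cast hv.trans hkβ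
    · have : x ≠ 15 := by rintro rfl; simp at hx
      simp [this]
  refine Runs.seq ((Runs.for (fun r s => Ready W β n m K k T' P' s ∧ s.coins = r * (n + m) ∧
    ∀ i < n - m + 1, s.arr 10 (i : ℕ) =
      ∑ r' ∈ Finset.range r, correlation ω f T' P' m (r' * (n + m)) i) k (2 ^ K * (K * 1000))
    (by decide) hkW hR.one_le hready.r7 ?_ ?_).mono le_rfl ?_)
  · exact ⟨setReady 0 (by omega) hready, by simp [hc0], fun i _ => by simp [h10]⟩
  · rintro r hr s h15 - ⟨g1, g2, g3⟩
    have hcorr : ∀ i < n - m + 1, ∑ j ∈ Finset.range m,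
        signTable ω s.coins (joined n T' P') (s.arr 3) (n + m) (T' (i + j)) *
        signTable ω s.coins (joined n T' P') (s.arr 3) (n + m) (P' j) =
        correlation ω f T' P' m (r * (n + m)) i := by
      intro i hi
      refine Finset.sum_congr rfl fun j hj => ?_
      have hj := Finset.mem_range.1 hj
      have e1 : joined n T' P' (i + j) = T' (i + j) := by
        rw [joined, if_pos (by omega)]
      have e2 : joined n T' P' (n + j) = P' j := by simp [joined]
      have s1 := hf (i + j) (by omega) ω s.coins (s.arr 3)
      have s2 := hf (n + j) (by omega) ω s.coins (s.arr 3)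
      rw [e1] at s1
      rw [e2] at s2
      rw [s1, s2, g2]
    have hsum : ∀ i < n - m + 1, s.arr 10 (i : ℕ) + ∑ j ∈ Finset.range m,
        signTable ω s.coins (joined n T' P') (s.arr 3) (n + m) (T' (i + j)) *
        signTable ω s.coins (joined n T' P') (s.arr 3) (n + m) (P' j) =
        ∑ r' ∈ Finset.range (r + 1), correlation ω f T' P' m (r' * (n + m)) i := by
      intro i hi
      rw [hcorr i hi, g3 i hi, Finset.sum_range_succ]
    refine (Runs.roundProg hR g1 hK hN (lt_two_pow_logLen n) hm hmn fun i hi => ?_).mono le_rfl ?_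
    · rw [hsum i hi]
      refine (abs_sum_correlation_le ω f T' P' m i (n + m) (r + 1)).trans ?_
      have : (r + 1) * m ≤ β ^ 5 := by
        calc (r + 1) * m ≤ β ^ 4 * β := Nat.mul_le_mul (by omega) (by omega)
          _ = β ^ 5 := by ring
      exact_mod_cast this
    · rintro s' ⟨g1', g15, g2', g3'⟩
      refine ⟨by rw [g15, h15], g1'.r7, ?_, ?_, fun i hi => ?_⟩
      · exact_mod_cast setReady (r + 1) (by omega) g1'
      · rw [setReg_coins, g2', g2]; ring
      · rw [setReg_arr, g3' i hi, hsum i hi]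
  rintro s4 ⟨-, -, h, -, hacc⟩
  have hk0 : (k : ℤ) ≠ 0 := by omega
  refine Runs.fill hR 16 8 2 _ 30 (n - m + 1) (fun i => estimate ω f T' P' n m k i) h.bounded h.r8
    (by omega) (fun y hy => ?_) (fun y hy => ?_) (fun y hy => ?_) fun _ i hi => ?_
  · have hR' := abs_sum_correlation_le ω f T' P' m y (n + m) k
    set R := ∑ r ∈ Finset.range k, correlation ω f T' P' m (r * (n + m)) y with hRdef
    rw [abs_le] at hR'
    have hkpos : (0 : ℤ) < k := by omega
    have hnum : 0 ≤ 2 * ((k : ℤ) * m - R) + k := by linarith [hR'.2]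
    have h1 : 0 ≤ estimate ω f T' P' n m k y := Int.ediv_nonneg hnum (by positivity)
    have h2 : estimate ω f T' P' n m k y ≤ 3 * m := by
      refine Int.ediv_le_of_le_mul (by positivity) ?_
      have : (1 : ℤ) ≤ m := by exact_mod_cast hm
      nlinarith [hR'.1]
    rw [abs_of_nonneg h1]
    refine h2.trans ?_
    have : 3 * m ≤ β ^ 3 := by
      calc 3 * m ≤ β * β := Nat.mul_le_mul (by omega) (by omega)
        _ ≤ β * β * β := Nat.le_mul_of_pos_right _ (by omega)
        _ = β ^ 3 := by ring
    exact_mod_cast this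
  · simp [h.r7]; omega
  · have := hacc y hy
    simp [h.r7, h.r1, this, estimate]
  · rw [fill_arr, Function.update_self, patch_of_lt hi]

/-! ### Concentration of the correlations -/

open MeasureTheory ProbabilityTheory

instance : IsProbabilityMeasure coinLaw := by unfold coinLaw; infer_instance

/-- The coins are independent. -/
theorem iIndepFun_coins : iIndepFun (fun (j : ℕ) (ω : ℕ → Bool) => ω j) coinLaw :=
  iIndepFun_infinitePi (X := fun _ b => b) fun _ => measurable_id

theorem map_coin (j : ℕ) :
    coinLaw.map (fun ω : ℕ → Bool => ω j) = (PMF.uniformOfFintype Bool).toMeasure :=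
  Measure.infinitePi_map_eval _ j

/-- Selecting coins without repetition gives again a family of independent fair coins. -/
theorem map_coins_of_injective {ι : Type*} [Countable ι] {g : ι → ℕ} (hg : g.Injective) :
    coinLaw.map (fun (ω : ℕ → Bool) (i : ι) => ω (g i)) =
      Measure.infinitePi fun _ : ι => (PMF.uniformOfFintype Bool).toMeasure := by
  have h := (iIndepFun_coins.precomp hg).map_fun_eq_infinitePi_map fun i => measurable_pi_apply _
  refine h.trans ?_
  congr 1
  exact funext fun i => map_coin (g i)

/-- Disjoint blocks of coins are independent. -/
theorem iIndepFun_coinBlocks (l : ℕ) :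
    iIndepFun (fun (r : ℕ) (ω : ℕ → Bool) (j : Fin l) => ω (r * l + j)) coinLaw := by
  have hg : Function.Injective fun p : ℕ × Fin l => p.1 * l + (p.2 : ℕ) := by
    rintro ⟨r, j⟩ ⟨r', j'⟩ h
    have hl : 0 < l := j.pos
    have h1 := congrArg (· / l) h
    have h2 := congrArg (· % l) h
    simp only [Nat.add_comm _ (j : ℕ), Nat.add_comm _ (j' : ℕ), Nat.add_mul_div_right _ _ hl,
      Nat.div_eq_of_lt j.isLt, Nat.div_eq_of_lt j'.isLt, Nat.add_mul_mod_self_right,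
      Nat.mod_eq_of_lt j.isLt, Nat.mod_eq_of_lt j'.isLt, zero_add] at h1 h2
    exact Prod.ext h1 (Fin.ext h2)
  rw [iIndepFun_iff_map_fun_eq_infinitePi_map fun r => by fun_prop]
  have h1 : (fun (ω : ℕ → Bool) (r : ℕ) (j : Fin l) => ω (r * l + j)) =
      (MeasurableEquiv.curry ℕ (Fin l) Bool) ∘
        fun (ω : ℕ → Bool) (p : ℕ × Fin l) => ω (p.1 * l + (p.2 : ℕ)) := rfl
  rw [h1, ← Measure.map_map (MeasurableEquiv.measurable _) (by fun_prop),
    map_coins_of_injective hg,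
    Measure.infinitePi_map_curry fun _ _ => (PMF.uniformOfFintype Bool).toMeasure]
  congr 1
  refine funext fun r => (map_coins_of_injective (g := fun j : Fin l => r * l + j) ?_).symm
  exact fun j j' h => (Prod.mk.inj (hg (a₁ := (r, j)) (a₂ := (r, j')) h)).2

theorem measurable_coinSign (j : ℕ) : Measurable fun ω : ℕ → Bool => (coinSign (ω j) : ℝ) :=
  (measurable_of_finite fun b : Bool => (coinSign b : ℝ)).comp (measurable_pi_apply j)

theorem abs_coinSign_mul (b b' : Bool) : |(coinSign b : ℝ) * coinSign b'| = 1 := by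
  cases b <;> cases b' <;> simp [coinSign]

theorem integral_coinSign (j : ℕ) : ∫ ω, (coinSign (ω j) : ℝ) ∂coinLaw = 0 := by
  have h := integral_map (μ := coinLaw) (φ := fun ω : ℕ → Bool => ω j)
    (f := fun b : Bool => (coinSign b : ℝ)) (measurable_pi_apply j).aemeasurable
    (measurable_of_finite _).aestronglyMeasurable
  rw [map_coin, PMF.integral_eq_sum] at h
  rw [← h]
  simp [coinSign]

/-- The signs of two distinct coins are uncorrelated. -/
theorem integral_coinSign_mul {a b : ℕ} (hab : a ≠ b) :
    ∫ ω, (coinSign (ω a) : ℝ) * coinSign (ω b) ∂coinLaw = 0 := by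
  have h := (iIndepFun_coins.indepFun hab).comp
    (φ := fun b : Bool => (coinSign b : ℝ)) (ψ := fun b : Bool => (coinSign b : ℝ))
    (measurable_of_finite _) (measurable_of_finite _)
  have := h.integral_fun_mul_eq_mul_integral (measurable_coinSign a).aestronglyMeasurable
    (measurable_coinSign b).aestronglyMeasurable
  simp only [Function.comp_def] at this
  rw [this, integral_coinSign, zero_mul]

/-- The contribution to the correlation of the positions in `D`, where the letters to be compared
have the coins `a j` and `b j`. -/
def noise (D : Finset ℕ) (a b : ℕ → ℕ) (x : ℕ → Bool) : ℝ :=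
  ∑ j ∈ D, (coinSign (x (a j)) : ℝ) * coinSign (x (b j))

theorem abs_noise_le (D : Finset ℕ) (a b : ℕ → ℕ) (x : ℕ → Bool) : |noise D a b x| ≤ D.card := by
  refine (Finset.abs_sum_le_sum_abs _ _).trans ?_
  simp only [abs_coinSign_mul, Finset.sum_const, nsmul_one, le_refl]

/-- Two letters that differ have different coins, so that mismatches contribute nothing on
average. -/
theorem integral_noise {D : Finset ℕ} {a b : ℕ → ℕ} (hab : ∀ j ∈ D, a j ≠ b j) (c : ℕ) :
    ∫ ω, noise D a b (fun j => ω (c + j)) ∂coinLaw = 0 := by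
  unfold noise
  rw [integral_finsetSum]
  · exact Finset.sum_eq_zero fun j hj => integral_coinSign_mul fun h => hab j hj (by omega)
  · intro j _
    exact Integrable.of_bound ((measurable_coinSign _).mul
      (measurable_coinSign _)).aestronglyMeasurable 1
      (ae_of_all _ fun ω => (abs_coinSign_mul _ _).le)

/-- Different rounds use different coins. -/
theorem iIndepFun_noise {D : Finset ℕ} {a b : ℕ → ℕ} {l : ℕ} (ha : ∀ j ∈ D, a j < l)
    (hb : ∀ j ∈ D, b j < l) :
    iIndepFun (fun (r : ℕ) (ω : ℕ → Bool) => noise D a b fun j => ω (r * l + j)) coinLaw := by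
  have h := (iIndepFun_coinBlocks l).comp
    (fun _ x => noise D a b fun j => if h : j < l then x ⟨j, h⟩ else true) fun _ =>
      measurable_of_finite _
  convert h using 3 with r ω
  refine Finset.sum_congr rfl fun j hj => ?_
  simp [ha j hj, hb j hj]

theorem measurable_noise (D : Finset ℕ) (a b : ℕ → ℕ) (c : ℕ) :
    Measurable fun ω : ℕ → Bool => noise D a b fun j => ω (c + j) := by
  exact Finset.measurable_fun_sum _ fun j _ => (measurable_coinSign _).mul (measurable_coinSign _)

/-- Hoeffding's inequality for the noise of `k` rounds. -/
theorem measure_noise_ge_le {D : Finset ℕ} {a b : ℕ → ℕ} {l k : ℕ} {δ : ℝ}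
    (ha : ∀ j ∈ D, a j < l) (hb : ∀ j ∈ D, b j < l) (hab : ∀ j ∈ D, a j ≠ b j)
    (hD : D.Nonempty) (hk : 1 ≤ k) (hδ : 0 ≤ δ) :
    coinLaw.real {ω | k * D.card * δ ≤
      |∑ r ∈ Finset.range k, noise D a b fun j => ω (r * l + j)|} ≤
        2 * Real.exp (-(k * δ ^ 2 / 2)) := by
  have hS : (0 : ℝ) < D.card := by exact_mod_cast hD.card_pos
  have hk' : (0 : ℝ) < k := by exact_mod_cast hk
  have hsub : ∀ r : ℕ, HasSubgaussianMGF (fun ω : ℕ → Bool => noise D a b fun j => ω (r * l + j))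
      ((D.card : NNReal) ^ 2) coinLaw := by
    intro r
    have h := hasSubgaussianMGF_of_mem_Icc_of_integral_eq_zero (a := -(D.card : ℝ)) (b := D.card)
      (measurable_noise D a b (r * l)).aemeasurable
      (ae_of_all coinLaw fun ω => abs_le.1 (abs_noise_le D a b fun j => ω (r * l + j)))
      (integral_noise hab (r * l))
    convert h using 2
    rw [sub_neg_eq_add, ← two_mul, nnnorm_mul]
    ext
    simp
  have hind := iIndepFun_noise ha hb
  have hexp : -(k * D.card * δ) ^ 2 / (2 * k * ((D.card : NNReal) ^ 2 : NNReal)) =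
      -(k * δ ^ 2 / 2) := by
    push_cast
    field_simp
  have h1 := HasSubgaussianMGF.measure_sum_range_ge_le_of_iIndepFun hind (n := k)
    (fun r _ => hsub r) (ε := k * D.card * δ) (by positivity)
  have h2 := HasSubgaussianMGF.measure_sum_range_ge_le_of_iIndepFun
    (hind.comp (fun _ => fun x : ℝ => -x) fun _ => measurable_neg) (n := k)
    (fun r _ => (hsub r).neg) (ε := k * D.card * δ) (by positivity)
  rw [hexp] at h1 h2
  rw [two_mul]
  refine (measureReal_mono fun ω hω => ?_).trans
    ((measureReal_union_le _ _).trans (add_le_add h1 h2))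
  simp only [Set.mem_ofPred_eq, le_abs, Set.mem_union, Function.comp_apply,
    Finset.sum_neg_distrib] at hω ⊢
  exact hω

/-! ### From correlations to Hamming distances -/

/-- The positions of the pattern, placed at position `i` of the text, with a mismatch. -/
def mismatches (T P : ℕ → ℤ) (m i : ℕ) : Finset ℕ := {j ∈ Finset.range m | T (i + j) ≠ P j}

theorem hammingDist_window {n m : ℕ} (T : Fin n → ℤ) (P : Fin m → ℤ) (i : ℕ) (h : i + m ≤ n) :
    hammingDist (window T m i h) P =
      (mismatches (fun j => load T j) (fun j => load P j) m i).card := by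
  rw [hammingDist, mismatches, Finset.card_filter, Finset.card_filter, Finset.sum_range]
  refine Finset.sum_congr rfl fun j _ => ?_
  have h1 : load T ((i + j : ℕ) : ℤ) = window T m i h j := by
    have : i + (j : ℕ) < n := by omega
    have h0 : (0 : ℤ) ≤ ((i + j : ℕ) : ℤ) := by positivity
    simp only [load, window, Int.toNat_natCast, h0, this, and_self, dite_true]
  have h2 : load P ((j : ℕ) : ℤ) = P j := by simp [load]
  rw [h1, h2]

/-- A matched position contributes `1` to the correlation, whatever the coins. -/
theorem correlation_eq (ω : ℕ → Bool) (f : ℤ → ℕ) (T P : ℕ → ℤ) (m c i : ℕ) :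
    (correlation ω f T P m c i : ℝ) = m - (mismatches T P m i).card +
      noise (mismatches T P m i) (fun j => f (T (i + j))) (fun j => f (P j))
        fun j => ω (c + j) := by
  have h1 : ∑ j ∈ Finset.range m with ¬T (i + j) ≠ P j,
      (coinSign (ω (c + f (T (i + j)))) : ℝ) * coinSign (ω (c + f (P j))) =
        m - (mismatches T P m i).card := by
    have h2 : (Finset.range m).card = _ :=
      (Finset.card_filter_add_card_filter_not (s := Finset.range m)
        fun j => T (i + j) ≠ P j).symm
    rw [Finset.card_range] at h2
    have h3 : (m : ℝ) - (mismatches T P m i).card =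
        ({j ∈ Finset.range m | ¬T (i + j) ≠ P j}).card := by
      rw [sub_eq_iff_eq_add', mismatches, ← Nat.cast_add]
      exact congrArg _ h2
    rw [h3, Finset.card_eq_sum_ones, Nat.cast_sum]
    refine Finset.sum_congr rfl fun j hj => ?_
    rw [not_not.1 (Finset.mem_filter.1 hj).2]
    cases ω (c + f (P j)) <;> simp [coinSign]
  rw [← h1, correlation]
  push_cast
  rw [← Finset.sum_filter_add_sum_filter_not (Finset.range m) fun j => T (i + j) ≠ P j, add_comm]
  rfl

/-- Rounding to the nearest integer keeps a sufficiently good approximation of an integer good: an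
absolute error below `1 / 4` disappears, and otherwise the error was allowed to be at least `1`. -/
theorem ediv_approximates {k S : ℕ} {ε : ℝ} {z : ℤ} (hk : 1 ≤ k)
    (h : |(z : ℝ) - k * S| ≤ k * S * (ε / 4)) :
    (1 - ε) * S ≤ (((2 * z + k) / (2 * k) : ℤ) : ℝ) ∧
      (((2 * z + k) / (2 * k) : ℤ) : ℝ) ≤ (1 + ε) * S := by
  have hk' : (0 : ℝ) < k := by exact_mod_cast hk
  have hk2 : (0 : ℤ) < 2 * k := by omega
  set e : ℤ := (2 * z + k) / (2 * k)
  have h1 : e * (2 * k) ≤ 2 * z + k := Int.ediv_mul_le _ hk2.ne'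
  have h2 : 2 * z + k < (e + 1) * (2 * k) := Int.lt_ediv_add_one_mul_self _ hk2
  have h1' : (e : ℝ) * (2 * k) ≤ 2 * z + k := by exact_mod_cast h1
  have h2' : 2 * (z : ℝ) + k < (e + 1) * (2 * k) := by exact_mod_cast h2
  rw [abs_le] at h
  have h3 : (e : ℝ) ≤ S + S * (ε / 4) + 1 / 2 := by
    refine le_of_mul_le_mul_right (a := 2 * (k : ℝ)) ?_ (by positivity)
    nlinarith
  have h4 : S - S * (ε / 4) - 1 / 2 < (e : ℝ) := by
    refine lt_of_mul_lt_mul_right (a := 2 * (k : ℝ)) ?_ (by positivity)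
    nlinarith
  by_cases hS : S * ε < 1
  · have h5 : e ≤ S := by
      have : (e : ℝ) < (S + 1 : ℤ) := by push_cast; linarith
      exact Int.lt_add_one_iff.1 (by exact_mod_cast this)
    have h6 : (S : ℤ) ≤ e := by
      have : ((S - 1 : ℤ) : ℝ) < e := by push_cast; linarith
      exact Int.sub_one_lt_iff.1 (by exact_mod_cast this)
    have h7 : (e : ℝ) = S := by exact_mod_cast le_antisymm h5 h6
    have h8 : 0 ≤ S * (ε / 4) := by
      have : 0 ≤ k * (S * (ε / 4)) := by linarith
      exact nonneg_of_mul_nonneg_right this hk'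
    rw [h7]
    constructor <;> linarith
  · push Not at hS
    constructor <;> linarith

/-- The estimate for position `i` is good as soon as the noise of all rounds together is small. -/
theorem estimate_approximates {f : ℤ → ℕ} {T P : ℕ → ℤ} {n m k i : ℕ} {ε : ℝ} (hk : 1 ≤ k)
    (h : (mismatches T P m i).Nonempty →
      |∑ r ∈ Finset.range k, noise (mismatches T P m i) (fun j => f (T (i + j)))
        (fun j => f (P j)) fun j => ω (r * (n + m) + j)| ≤
          k * (mismatches T P m i).card * (ε / 4)) :
    (1 - ε) * (mismatches T P m i).card ≤ (estimate ω f T P n m k i : ℝ) ∧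
      (estimate ω f T P n m k i : ℝ) ≤ (1 + ε) * (mismatches T P m i).card := by
  refine ediv_approximates hk ?_
  push_cast
  simp only [correlation_eq, Finset.sum_add_distrib, Finset.sum_const, Finset.card_range,
    nsmul_eq_mul]
  rw [← abs_neg]
  rcases (mismatches T P m i).eq_empty_or_nonempty with h0 | h0
  · simp [h0, noise]
  · convert h h0 using 2
    ring

/-- For every position, a failure is unlikely. -/
theorem measure_estimate_bad_le {f : ℤ → ℕ} {T P : ℕ → ℤ} {n m k i : ℕ} {ε : ℝ}
    (hf : ∀ j < n + m, f (joined n T P j) < n + m ∧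
      joined n T P (f (joined n T P j)) = joined n T P j)
    (hk : 1 ≤ k) (hi : i + m ≤ n) (hε : 0 ≤ ε) :
    coinLaw.real {ω | ¬((1 - ε) * (mismatches T P m i).card ≤ (estimate ω f T P n m k i : ℝ) ∧
      (estimate ω f T P n m k i : ℝ) ≤ (1 + ε) * (mismatches T P m i).card)} ≤
        2 * Real.exp (-(k * (ε / 4) ^ 2 / 2)) := by
  have hT : ∀ j < m, f (T (i + j)) < n + m ∧ joined n T P (f (T (i + j))) = T (i + j) := by
    intro j hj
    have h := hf (i + j) (by omega)
    rwa [joined, if_pos (by omega : i + j < n)] at h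
  have hP : ∀ j < m, f (P j) < n + m ∧ joined n T P (f (P j)) = P j := by
    intro j hj
    have h := hf (n + j) (by omega)
    rwa [show joined n T P (n + j) = P j by simp [joined]] at h
  have hlt : ∀ j ∈ mismatches T P m i, j < m ∧ T (i + j) ≠ P j := fun j hj => by
    simpa [mismatches] using hj
  rcases (mismatches T P m i).eq_empty_or_nonempty with h0 | h0
  · have : {ω : ℕ → Bool | ¬((1 - ε) * (mismatches T P m i).card ≤ (estimate ω f T P n m k i : ℝ) ∧
      (estimate ω f T P n m k i : ℝ) ≤ (1 + ε) * (mismatches T P m i).card)} = ∅ :=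
      Set.eq_empty_of_forall_notMem fun ω hω =>
        hω (estimate_approximates hk fun h => absurd h0 h.ne_empty)
    rw [this, measureReal_empty]
    positivity
  · refine (measureReal_mono fun ω hω => ?_).trans (measure_noise_ge_le (k := k) (l := n + m)
      (a := fun j => f (T (i + j))) (b := fun j => f (P j)) (fun j hj => (hT j (hlt j hj).1).1)
      (fun j hj => (hP j (hlt j hj).1).1) (fun j hj he => (hlt j hj).2 ?_) h0 hk
      (by positivity : 0 ≤ ε / 4))
    · by_contra hc
      exact hω (estimate_approximates hk fun _ => (not_le.1 hc).le)
    · rw [← (hT j (hlt j hj).1).2, ← (hP j (hlt j hj).1).2]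
      exact congrArg _ he

/-- All estimates are good with high probability. -/
theorem le_measure_estimate {f : ℤ → ℕ} {T P : ℕ → ℤ} {n m k : ℕ} {ε : ℝ}
    (hf : ∀ j < n + m, f (joined n T P j) < n + m ∧
      joined n T P (f (joined n T P j)) = joined n T P j)
    (hk : 1 ≤ k) (hm : 1 ≤ m) (hε : 0 ≤ ε) :
    1 - n * (2 * Real.exp (-(k * (ε / 4) ^ 2 / 2))) ≤ coinLaw.real {ω | ∀ i, i + m ≤ n →
      ((1 - ε) * (mismatches T P m i).card ≤ (estimate ω f T P n m k i : ℝ) ∧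
        (estimate ω f T P n m k i : ℝ) ≤ (1 + ε) * (mismatches T P m i).card)} := by
  set good : ℕ → Set (ℕ → Bool) := fun i => {ω | (1 - ε) * (mismatches T P m i).card ≤
    (estimate ω f T P n m k i : ℝ) ∧
      (estimate ω f T P n m k i : ℝ) ≤ (1 + ε) * (mismatches T P m i).card} with hgood
  have hbad : coinLaw.real (⋃ i ∈ (Finset.range n).filter fun i => i + m ≤ n, (good i)ᶜ) ≤
      n * (2 * Real.exp (-(k * (ε / 4) ^ 2 / 2))) := by
    refine (measureReal_biUnion_finset_le _ _).trans ?_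
    refine (Finset.sum_le_card_nsmul _ _ _ fun i hi =>
      measure_estimate_bad_le hf hk (Finset.mem_filter.1 hi).2 hε).trans ?_
    rw [nsmul_eq_mul]
    refine mul_le_mul_of_nonneg_right ?_ (by positivity)
    exact_mod_cast (Finset.card_filter_le _ _).trans (Finset.card_range n).le
  have huniv : (1 : ℝ) = coinLaw.real Set.univ := by simp
  have hle := measureReal_union_le (μ := coinLaw) {ω | ∀ i, i + m ≤ n → ω ∈ good i}
    (⋃ i ∈ (Finset.range n).filter fun i => i + m ≤ n, (good i)ᶜ)
  have hcover : Set.univ ⊆ {ω | ∀ i, i + m ≤ n → ω ∈ good i} ∪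
      ⋃ i ∈ (Finset.range n).filter fun i => i + m ≤ n, (good i)ᶜ := by
    intro ω _
    by_cases h : ∀ i, i + m ≤ n → ω ∈ good i
    · exact Or.inl h
    · push Not at h
      obtain ⟨i, hi, hω⟩ := h
      refine Or.inr (Set.mem_biUnion (x := i) ?_ hω)
      simp only [Finset.coe_filter, Finset.mem_range, Set.mem_ofPred_eq]
      omega
  have := measureReal_mono (μ := coinLaw) hcover
  change _ ≤ coinLaw.real {ω | ∀ i, i + m ≤ n → ω ∈ good i}
  linarith

/-! ### The choice of the constants -/

theorem log_le_logLen {n : ℕ} (hn : 2 ≤ n) : Real.log n ≤ logLen n := by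
  have hn0 : (0 : ℝ) < n := by positivity
  have h1 : (n : ℝ) ≤ 2 ^ logLen n := by exact_mod_cast (lt_two_pow_logLen n).le
  have h2 := Real.log_le_log hn0 h1
  rw [Real.log_pow] at h2
  have h3 : (0 : ℝ) ≤ logLen n := by positivity
  nlinarith [Real.log_two_lt_d9]

theorem logLen_le_log {n : ℕ} (hn : 2 ≤ n) : (logLen n : ℝ) ≤ 4 * Real.log n := by
  have hn0 : (2 : ℝ) ≤ n := by exact_mod_cast hn
  have h1 : (2 : ℝ) ^ logLen n ≤ 2 * n := by exact_mod_cast two_pow_logLen_le hn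
  have h2 := Real.log_le_log (by positivity) h1
  rw [Real.log_pow, Real.log_mul (by norm_num) (by positivity)] at h2
  have h3 := Real.log_le_log (by norm_num) hn0
  have h4 : (0 : ℝ) ≤ logLen n := by positivity
  nlinarith [Real.log_two_gt_d9]

/-- The failure probability of all positions together, with `K₀ = 32 * (⌈c⌉₊ + 2)`. -/
theorem mul_exp_le {n k q K₀ : ℕ} {c ε : ℝ} (hn : 2 ≤ n) (hε : 0 < ε) (hq : 1 / ε ≤ q)
    (hk : k = K₀ * (q * q) * logLen n) (hK₀ : 32 * (c + 2) ≤ K₀) :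
    n * (2 * Real.exp (-(k * (ε / 4) ^ 2 / 2))) ≤ (n : ℝ) ^ (-c) := by
  have hn0 : (2 : ℝ) ≤ n := by exact_mod_cast hn
  have hpos : (0 : ℝ) < n := by linarith
  have hlog : 0 ≤ Real.log n := Real.log_nonneg (by linarith)
  have h1 : 1 ≤ q * ε := (div_le_iff₀ hε).1 hq
  have h2 : 1 ≤ (q * ε) ^ 2 := one_le_pow₀ h1
  have h3 : (K₀ : ℝ) * Real.log n ≤ k * ε ^ 2 := by
    have e : (k : ℝ) * ε ^ 2 = (K₀ * logLen n) * (q * ε) ^ 2 := by rw [hk]; push_cast; ring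
    rw [e]
    have h4 : (K₀ : ℝ) * Real.log n ≤ K₀ * logLen n :=
      mul_le_mul_of_nonneg_left (log_le_logLen hn) (by positivity)
    exact h4.trans (le_mul_of_one_le_right (by positivity) h2)
  have h5 : (c + 2) * Real.log n ≤ k * (ε / 4) ^ 2 / 2 := by
    have := mul_le_mul_of_nonneg_right hK₀ hlog
    linarith
  calc n * (2 * Real.exp (-(k * (ε / 4) ^ 2 / 2)))
      ≤ n * (n * Real.exp (-((c + 2) * Real.log n))) := by gcongr
    _ = (n : ℝ) ^ (-c) := by
      rw [Real.rpow_def_of_pos hpos, ← mul_assoc]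
      nth_rewrite 1 [← Real.exp_log hpos]
      nth_rewrite 2 [← Real.exp_log hpos]
      rw [← Real.exp_add, ← Real.exp_add]
      congr 1
      ring

/-- The time bound of `Runs.mainProg` in terms of `n` and `ε`. -/
theorem time_le {n q K₀ : ℕ} {ε : ℝ} (hn : 2 ≤ n) (hε : 0 < ε) (hε1 : ε ≤ 1)
    (hq : (q : ℝ) < 1 / ε + 1) :
    ((3000 * (K₀ * (q * q) * logLen n * (2 ^ logLen n * logLen n)) : ℕ) : ℝ) ≤
      1536000 * K₀ * (n * Real.log n ^ 4 / ε ^ 3) := by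
  have hn0 : (2 : ℝ) ≤ n := by exact_mod_cast hn
  have hlog : 1 / 2 ≤ Real.log n := by
    have := Real.log_le_log (by norm_num) hn0
    linarith [Real.log_two_gt_d9]
  have h1 : 1 ≤ 1 / ε := (one_le_div₀ hε).2 hε1
  have hqq : (q : ℝ) * q ≤ 4 * (1 / ε) ^ 3 := by
    have h2 : (q : ℝ) ≤ 2 * (1 / ε) := by linarith
    calc (q : ℝ) * q ≤ (2 * (1 / ε)) * (2 * (1 / ε)) := by gcongr
      _ = 4 * (1 / ε) ^ 2 := by ring
      _ ≤ 4 * (1 / ε) ^ 3 := by gcongr; norm_num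
  have hK := logLen_le_log hn
  have hpow : (2 : ℝ) ^ logLen n ≤ 2 * n := by exact_mod_cast two_pow_logLen_le hn
  have hKK : (logLen n : ℝ) * logLen n ≤ 64 * Real.log n ^ 4 := by
    calc (logLen n : ℝ) * logLen n ≤ (4 * Real.log n) * (4 * Real.log n) := by gcongr
      _ = 16 * Real.log n ^ 2 * 1 := by ring
      _ ≤ 16 * Real.log n ^ 2 * (4 * Real.log n ^ 2) := by gcongr; nlinarith
      _ = 64 * Real.log n ^ 4 := by ring
  push_cast
  calc (3000 * (K₀ * (q * q) * logLen n * (2 ^ logLen n * logLen n)) : ℝ)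
      = 3000 * K₀ * (q * q) * 2 ^ logLen n * (logLen n * logLen n) := by ring
    _ ≤ 3000 * K₀ * (4 * (1 / ε) ^ 3) * (2 * n) * (64 * Real.log n ^ 4) := by gcongr
    _ = 1536000 * K₀ * (n * Real.log n ^ 4 / ε ^ 3) := by
      rw [div_pow, one_pow]
      ring

end WordRAM

theorem theorem2 (c : ℝ) (hc : 0 < c) :
    ∃ (prog : WordRAM.Prog) (κ : ℕ) (C : ℝ),
      ∀ (n m : ℕ) (ε : ℝ) (W : ℕ) (T : Fin n → ℤ) (P : Fin m → ℤ),
        2 ≤ n → 1 ≤ m → m ≤ n → 0 < ε → ε ≤ 1 →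
        (n * ⌈1 / ε⌉₊) ^ κ ≤ W → (∀ i, |T i| ≤ W) → (∀ j, |P j| ≤ W) →
        (∀ ω : ℕ → Bool, ∃ (s : WordRAM.State) (t : ℕ),
          WordRAM.Exec W ω prog (WordRAM.init T P ⌈1 / ε⌉₊) s t ∧
            (t : ℝ) ≤ C * (n * Real.log n ^ 4 / ε ^ 3)) ∧
        1 - (n : ℝ) ^ (-c) ≤
          WordRAM.coinLaw.real {ω | ∃ (s : WordRAM.State) (t : ℕ),
            WordRAM.Exec W ω prog (WordRAM.init T P ⌈1 / ε⌉₊) s t ∧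
              ApproximatesHamming ε T P (s.arr 2)} := by
  set K₀ : ℕ := 32 * (⌈c⌉₊ + 2) with hK₀def
  refine ⟨WordRAM.mainProg K₀, (K₀ + 2) * WordRAM.degLimit, 1536000 * K₀, ?_⟩
  intro n m ε W T P hn hm hmn hε hε1 hW hT hP
  set q : ℕ := ⌈1 / ε⌉₊ with hqdef
  have hq : 1 ≤ q := Nat.one_le_ceil_iff.2 (by positivity)
  have hnq : 2 ≤ n * q := hn.trans (Nat.le_mul_of_pos_right _ hq)
  -- the exponent makes `β` at least `2 ^ K₀`, which exceeds the constant of the program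
  set β : ℕ := (n * q) ^ (K₀ + 2) with hβ
  have hsq : (n * q) * (n * q) ≤ β := by
    rw [hβ, ← sq]
    exact Nat.pow_le_pow_right (by omega) (by omega)
  have hnqβ : 2 * (n * q) ≤ β := (Nat.mul_le_mul_right _ hnq).trans hsq
  have hR : WordRAM.Room W β := ⟨by omega, by rwa [hβ, ← pow_mul]⟩
  have hnβ : 2 * n ≤ β := (Nat.mul_le_mul_left _ (Nat.le_mul_of_pos_right _ hq)).trans hnqβ
  have hqβ : q ≤ β := by
    have : q ≤ n * q := Nat.le_mul_of_pos_left _ (by omega)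
    omega
  have hK₀β : K₀ ≤ β :=
    calc K₀ ≤ 2 ^ K₀ := Nat.lt_two_pow_self.le
      _ ≤ (n * q) ^ K₀ := Nat.pow_le_pow_left hnq _
      _ ≤ β := Nat.pow_le_pow_right (by omega) (by omega)
  have hK₀ : 1 ≤ K₀ := by omega
  obtain ⟨f, hf⟩ := WordRAM.exists_signTable_eq
    (WordRAM.joined n (fun j => WordRAM.load T j) fun j => WordRAM.load P j) (n + m)
  have hruns := fun ω : ℕ → Bool => WordRAM.Runs.mainProg (ω := ω) hR hn hm hmn hq hK₀ hnβ hqβ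
    hK₀β hT hP (f := f) fun j hj => (hf j hj).2.2
  constructor
  · intro ω
    obtain ⟨s, t, ht, hexec, -⟩ := hruns ω
    refine ⟨s, t, hexec, ?_⟩
    exact (Nat.cast_le.2 ht).trans (WordRAM.time_le hn hε hε1 (Nat.ceil_lt_add_one (by positivity)))
  · set k := K₀ * (q * q) * WordRAM.logLen n with hk
    have hk1 : 1 ≤ k := by
      have := WordRAM.two_le_logLen hn
      exact Nat.one_le_iff_ne_zero.2 (by positivity)
    have hmeas := WordRAM.le_measure_estimate (f := f) (k := k) (ε := ε)
      (fun j hj => ⟨(hf j hj).1, (hf j hj).2.1⟩) hk1 hm hε.le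
    have hexp := WordRAM.mul_exp_le (c := c) hn hε (Nat.le_ceil _) hk (by
      rw [hK₀def]; push_cast; linarith [Nat.le_ceil c])
    refine le_trans (by linarith) (hmeas.trans (MeasureTheory.measureReal_mono fun ω hω => ?_))
    obtain ⟨s, t, -, hexec, hs⟩ := hruns ω
    refine ⟨s, t, hexec, fun i hi => ?_⟩
    rw [hs i (by omega), WordRAM.hammingDist_window]
    exact hω i hi
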